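/- **Setting.** Let $X_i:\Omega\to\mathbb R^{p_i}$, $i=1,2$, be jointly Gaussian with mean zero and covariance matrix $Q_{(X_1,X_2)}\succ0$. Let $W:\Omega\to\mathbb W$ be a random variable with values in an arbitrary measurable space. All statements hold for $i=1,2$. For an $\mathbb R^{p_i}$-valued random variable $\widehat X_i$ put $\widehat X_i^{\rm cm}=\mathbf E[X_i|\widehat X_i,W]$. Mutual informations are in nats with values in $[0,\infty]$; $I(\cdot;\cdot|W=w)$ and $\mathbf E[\cdot|W=w]$ are taken under the regular conditional law given $W=w$, $I(\cdot;\cdot|W)=\int I(\cdot;\cdot|W=w)\,\mathbf P_W(dw)$, and $\inf_w$ of a function of $w$ that is determined only $\mathbf P_W$-a.e. is the essential infimum. Put $\Delta_i(w)=\mathbf E[\|X_i-\widehat X_i\|^2|W=w]$ and $\Delta_i^{\rm cm}(w)=\mathbf E[\|X_i-\widehat X_i^{\rm cm}\|^2|W=w]$. Let $$R_{X_i|W}(\Delta)=\inf\{I(X_i;\widehat X_i|W):\ \mathbf P_{\widehat X_i|X_i,W}\ \text{with}\ \mathbf E\|X_i-\widehat X_i\|^2\le\Delta\},$$ and let $R_{X_i|W=w}$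 be the rate distortion function, for the square error, of the conditional law $\mathbf P_{X_i|W=w}$. We say that $\widehat X_i$ has the structural property if $$\mathbf E[X_i|\widehat X_i,W]=\mathbf E[X_i|\widehat X_i]=\widehat X_i\quad\text{a.s.}\tag{S}$$ **(a)** For every $\widehat X_i$, $$I(X_i;\widehat X_i|W)\ge I(X_i;\widehat X_i^{\rm cm}|W)=\int I(X_i;\widehat X_i^{\rm cm}|W=w)\,\mathbf P_W(dw)\ge\inf_wI(X_i;\widehat X_i^{\rm cm}|W=w)\ge0,$$ $$\mathbf E\|X_i-\widehat X_i\|^2=\int\Delta_i(w)\,\mathbf P_W(dw)\ge\int\Delta_i^{\rm cm}(w)\,\mathbf P_W(dw)\ge\inf_w\Delta_i^{\rm cm}(w)\ge0,$$ and $\mathbf E\|X_i-\widehat X_i\|^2\ge\mathbf E\|X_i-\widehat X_i^{\rm cm}\|^2$. Under (S), $I(X_i;\widehat X_i|W)=I(X_i;\widehat X_i^{\rm cm}|W)$ and $\mathbf E\|X_i-\widehat X_i\|^2=\mathbf E\|X_i-\widehat X_i^{\rm cm}\|^2$. If (S) holds and $I(X_i;\widehat X_i^{\rm cm}|W=w)$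 and $\Delta_i^{\rm cm}(w)$ do not depend on $w$ ($\mathbf P_W$-a.e.), then also $I(X_i;\widehat X_i|W)=\inf_wI(X_i;\widehat X_i^{\rm cm}|W=w)$ and $\mathbf E\|X_i-\widehat X_i\|^2=\inf_w\Delta_i^{\rm cm}(w)$. **(b)** Let $0\le\Delta<\infty$. Then $R_{X_i|W}(\Delta)<\infty$ if $\Delta>0$, and $$R_{X_i|W}(\Delta)=\inf_{\delta}\int R_{X_i|W=w}(\delta(w))\,\mathbf P_W(dw)\ \ge\ \inf_{\Delta_i^{\rm cm}}\int R_{X_i|W=w}(\Delta_i^{\rm cm}(w))\,\mathbf P_W(dw)\ \ge\ \inf_{\Delta_i^{\rm cm}}\inf_wR_{X_i|W=w}(\Delta_i^{\rm cm}(w)),$$ where $\delta$ ranges over all measurable $\delta:\mathbb W\to[0,\infty]$ with $\int\delta\,d\mathbf P_W\le\Delta$, and $\Delta_i^{\rm cm}$ over the profiles $w\mapsto\Delta_i^{\rm cm}(w)$ of all test channels $\mathbf P_{\widehat X_i|X_i,W}$ with $\int\Delta_i^{\rm cm}\,d\mathbf P_W\le\Delta$. Now let $\mathbb W=\mathbb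 R^n$ and let $W$ be Gaussian. If $(\widehat X_i,X_i,W)$ is jointly Gaussian and (S) holds, then for $\mathbf P_W$-a.e. $w$, $I(X_i;\widehat X_i^{\rm cm}|W=w)=I(X_i;\widehat X_i|W)$ and $\Delta_i^{\rm cm}(w)=\mathbf E\|X_i-\widehat X_i\|^2$, so all lower bounds in (a) hold with equality. If $(X_i,W)$ is jointly Gaussian, then the last infimum in (b), restricted to the test channels for which $(\widehat X_i,X_i,W)$ is jointly Gaussian with (S), equals $R_{X_i|W}(\Delta)$, and for $\mathbf P_W$-a.e. $w$ $$R_{X_i|W}(\Delta)=\inf_{0\le\delta\le\Delta}R_{X_i|W=w}(\delta)\qquad(\delta\ \text{constant}).$$ **(c)** Let $W$ be $\mathbb R^n$-valued with mean zero and covariance $Q_W\succ0$, with $(X_i,W)$ jointly Gaussian; let $Q_{X_i,W}=\mathbf E[X_iW^T]$ and let $Q_{X_i|W}$ be the covariance matrix of $X_i-\mathbf E[X_i|W]$ (similarly $Q_{\widehat X_i|W}$). Let $H_i,Q_{V_i},Q_{E_i}$ be matrices with $$H_iQ_{X_i|W}=Q_{X_i|W}-Q_{E_i}\succeq0,\quad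 H_iQ_{X_i|W}=Q_{X_i|W}H_i^T,\quad Q_{V_i}=H_iQ_{X_i|W}-H_iQ_{X_i|W}H_i^T\succeq0,\quad Q_{E_i}\succeq0,$$ let $V_i$ be Gaussian with mean zero and covariance $Q_{V_i}$, independent of $(X_i,W)$, and let $$\widehat X_i=H_iX_i+(I-H_i)Q_{X_i,W}Q_W^{-1}W+V_i.$$ Then $(\widehat X_i,X_i,W)$ is jointly Gaussian and satisfies (S), $X_i-\widehat X_i$ is Gaussian with mean zero and covariance $Q_{E_i}$, $Q_{\widehat X_i|W}=Q_{X_i|W}-Q_{E_i}$, all lower bounds in (a) hold with equality, $\mathbf E\|X_i-\widehat X_i\|^2=\operatorname{tr}Q_{E_i}$, and, if $Q_{E_i}\succ0$, $I(X_i;\widehat X_i|W)=\frac12\ln\big(\det Q_{X_i|W}/\det Q_{E_i}\big)^+$, where $(x)^+=\max\{1,x\}$. Such $H_i,Q_{V_i}$ exist for every $0\preceq Q_{E_i}\preceq Q_{X_i|W}$. If $Q_{X_i|W}\succ0$, then for all $0\le\Delta<\infty$ $$R_{X_i|W}(\Delta)=\inf\Big\{\tfrac12\ln\Big(\frac{\det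 Q_{X_i|W}}{\det Q_{E_i}}\Big)^+:\ Q_{E_i}\succ0,\ Q_{X_i|W}-Q_{E_i}\succeq0,\ \operatorname{tr}Q_{E_i}\le\Delta\Big\}$$ (with $\inf\emptyset=\infty$), and for $\Delta>0$ both infima, over test channels and over $Q_{E_i}$, are attained, by the test channel of such a realization and by its $Q_{E_i}$. -/

import Mathlib

open MeasureTheory ProbabilityTheory InformationTheory
open scoped ENNReal NNReal

namespace GrayWyner

/-- The Euclidean space `ℝⁿ`. -/
abbrev Euc (n : ℕ) := EuclideanSpace ℝ (Fin n)

section General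

variable {Ω S T 𝕎 : Type*} [MeasurableSpace Ω] [MeasurableSpace S] [MeasurableSpace T]
  [MeasurableSpace 𝕎]

/-- The mutual information (in nats, with values in `[0,∞]`) of the two components of a pair with
joint law `π`: the divergence of `π` from the product of its marginals. -/
noncomputable def mutualInfo (π : Measure (S × T)) : ℝ≥0∞ :=
  klDiv π (π.fst.prod π.snd)

variable [StandardBorelSpace S] [Nonempty S] [StandardBorelSpace T] [Nonempty T]

/-- `I(X; Y | W = w)`: the mutual information of the regular conditional law of `(X, Y)` given
`W = w`. -/
noncomputable def mutualInfoAt (X : Ω → S) (Y : Ω → T) (W : Ω → 𝕎) (P : Measure Ω)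
    [IsFiniteMeasure P] (w : 𝕎) : ℝ≥0∞ :=
  mutualInfo (condDistrib (fun ω => (X ω, Y ω)) W P w)

/-- The conditional mutual information `I(X; Y | W) = ∫ I(X; Y | W = w) dP_W(w)`. -/
noncomputable def condMutualInfo (X : Ω → S) (Y : Ω → T) (W : Ω → 𝕎) (P : Measure Ω)
    [IsFiniteMeasure P] : ℝ≥0∞ :=
  ∫⁻ w, mutualInfoAt X Y W P w ∂(P.map W)

end General

section Distortion

variable {Ω 𝕎 : Type*} [MeasurableSpace Ω] [MeasurableSpace 𝕎] {k : ℕ}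

/-- The mean square error `E ‖X - Y‖²`, with values in `[0,∞]`. -/
noncomputable def mse (X Y : Ω → Euc k) (P : Measure Ω) : ℝ≥0∞ :=
  ∫⁻ ω, ‖X ω - Y ω‖ₑ ^ 2 ∂P

/-- `Δ(w) = E[‖X - Y‖² | W = w]`. -/
noncomputable def mseAt (X Y : Ω → Euc k) (W : Ω → 𝕎) (P : Measure Ω) [IsFiniteMeasure P]
    (w : 𝕎) : ℝ≥0∞ :=
  ∫⁻ z, ‖z.1 - z.2‖ₑ ^ 2 ∂(condDistrib (fun ω => (X ω, Y ω)) W P w)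

/-- `E[X | Y]`, the conditional mean of `X` given the random variable `Y`. -/
noncomputable def condMean {T : Type*} [MeasurableSpace T] (X : Ω → Euc k) (Y : Ω → T)
    (P : Measure Ω) : Ω → Euc k :=
  P[X | MeasurableSpace.comap Y inferInstance]

/-- The conditional-mean reproduction `Y^cm = E[X | Y, W]`. -/
noncomputable def cmRep (X Y : Ω → Euc k) (W : Ω → 𝕎) (P : Measure Ω) : Ω → Euc k :=
  condMean X (fun ω => (Y ω, W ω)) P

/-- The structural property `E[X | Y, W] = E[X | Y] = Y` almost surely. -/
def Structural (X Y : Ω → Euc k) (W : Ω → 𝕎) (P : Measure Ω) : Prop :=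
  cmRep X Y W P =ᵐ[P] condMean X Y P ∧ condMean X Y P =ᵐ[P] Y

/-- `(Y, X, W)` is jointly Gaussian and has the structural property. -/
def GaussianStructural {n : ℕ} (X Y : Ω → Euc k) (W : Ω → Euc n) (P : Measure Ω) : Prop :=
  HasGaussianLaw (fun ω => (Y ω, X ω, W ω)) P ∧ Structural X Y W P

/-- The lower bounds on the conditional mutual information and on the mean square error by the
values of the conditional-mean reproduction, and by the (essential) infima over `w` of its
conditional values, all hold with equality for the reproduction `Y`. -/
def AttainsLowerBounds (X Y : Ω → Euc k) (W : Ω → 𝕎) (P : Measure Ω) [IsFiniteMeasure P] :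
    Prop :=
  condMutualInfo X Y W P = condMutualInfo X (cmRep X Y W P) W P ∧
  mse X Y P = mse X (cmRep X Y W P) P ∧
  condMutualInfo X Y W P = essInf (mutualInfoAt X (cmRep X Y W P) W P) (P.map W) ∧
  mse X Y P = essInf (mseAt X (cmRep X Y W P) W P) (P.map W)

/-- The cross-covariance matrix `Q_{X,Y}`. -/
noncomputable def crossCov {l : ℕ} (X : Ω → Euc k) (Y : Ω → Euc l) (P : Measure Ω) :
    Matrix (Fin k) (Fin l) ℝ :=
  Matrix.of fun a b => cov[fun ω => X ω a, fun ω => Y ω b; P]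

/-- The covariance matrix `Q_X`. -/
noncomputable def covMat (X : Ω → Euc k) (P : Measure Ω) : Matrix (Fin k) (Fin k) ℝ :=
  crossCov X X P

/-- The covariance matrix `Q_{(X,Y)}` of a pair. -/
noncomputable def jointCov {l : ℕ} (X : Ω → Euc k) (Y : Ω → Euc l) (P : Measure Ω) :
    Matrix (Fin k ⊕ Fin l) (Fin k ⊕ Fin l) ℝ :=
  Matrix.fromBlocks (covMat X P) (crossCov X Y P) (crossCov Y X P) (covMat Y P)

/-- The conditional covariance matrix `Q_{X|W}`: the covariance matrix of `X - E[X | W]`. -/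
noncomputable def condCov (X : Ω → Euc k) (W : Ω → 𝕎) (P : Measure Ω) :
    Matrix (Fin k) (Fin k) ℝ :=
  covMat (fun ω => X ω - condMean X W P ω) P

end Distortion

/-- The joint law of `(X, W)`. -/
noncomputable abbrev pairLaw {Ω 𝕎 : Type*} [MeasurableSpace Ω] [MeasurableSpace 𝕎] {k : ℕ}
    (X : Ω → Euc k) (W : Ω → 𝕎) (P : Measure Ω) : Measure (Euc k × 𝕎) :=
  P.map fun ω => (X ω, W ω)

section RateDistortion

variable {𝕎 : Type*} [MeasurableSpace 𝕎] {k : ℕ}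

/-- The rate distortion function of a source law `ν` on `ℝᵏ` for the square error, as the infimum
over all test channels. -/
noncomputable def rdf (ν : Measure (Euc k)) (D : ℝ≥0∞) : ℝ≥0∞ :=
  ⨅ (κ : Kernel (Euc k) (Euc k)) (_ : IsMarkovKernel κ)
    (_ : mse Prod.fst Prod.snd (ν ⊗ₘ κ) ≤ D), mutualInfo (ν ⊗ₘ κ)

/-- The source coordinate of a triple `((x, w), y)`. -/
abbrev src (z : (Euc k × 𝕎) × Euc k) : Euc k := z.1.1

/-- The conditioning coordinate of a triple `((x, w), y)`. -/
abbrev side (z : (Euc k × 𝕎) × Euc k) : 𝕎 := z.1.2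

/-- The reproduction coordinate of a triple `((x, w), y)`. -/
abbrev rep (z : (Euc k × 𝕎) × Euc k) : Euc k := z.2

/-- The conditional rate distortion function `R_{X|W}(Δ)` of a joint law `μ` of `(X, W)`: the
infimum of `I(X; Y | W)` over all test channels `κ = P_{Y|X,W}` with `E ‖X - Y‖² ≤ Δ`. -/
noncomputable def condRDF (μ : Measure (Euc k × 𝕎)) [IsFiniteMeasure μ] (Δ : ℝ≥0∞) : ℝ≥0∞ :=
  ⨅ (κ : Kernel (Euc k × 𝕎) (Euc k)) (_ : IsMarkovKernel κ) (_ : mse src rep (μ ⊗ₘ κ) ≤ Δ),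
    condMutualInfo src rep side (μ ⊗ₘ κ)

/-- The distortion profile `w ↦ Δ^cm(w) = E[‖X - Y^cm‖² | W = w]` of a test channel `κ`. -/
noncomputable def cmProfile (μ : Measure (Euc k × 𝕎)) [IsFiniteMeasure μ]
    (κ : Kernel (Euc k × 𝕎) (Euc k)) [IsMarkovKernel κ] (w : 𝕎) : ℝ≥0∞ :=
  mseAt src (cmRep src rep side (μ ⊗ₘ κ)) side (μ ⊗ₘ κ) w

end RateDistortion

section Realization

variable {k n : ℕ}

/-- The parameters of a Gaussian realization, with `Q = Q_{X|W}`: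
`H Q = Q - Q_E ⪰ 0`, `H Q = Q Hᵀ`, `Q_V = H Q - H Q Hᵀ ⪰ 0`, `Q ⪰ 0`, `Q_E ⪰ 0`. -/
structure RealizationParams (Q H QV QE : Matrix (Fin k) (Fin k) ℝ) : Prop where
  mul_eq : H * Q = Q - QE
  diff_psd : (Q - QE).PosSemidef
  comm : H * Q = Q * H.transpose
  noise_eq : QV = H * Q - H * Q * H.transpose
  noise_psd : QV.PosSemidef
  cond_psd : Q.PosSemidef
  error_psd : QE.PosSemidef

/-- The map `(x, w, v) ↦ H x + (I - H) G w + v`. -/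
noncomputable def reproduce (H : Matrix (Fin k) (Fin k) ℝ) (G : Matrix (Fin k) (Fin n) ℝ)
    (x : Euc k) (w : Euc n) (v : Euc k) : Euc k :=
  Matrix.toEuclideanLin H x + Matrix.toEuclideanLin ((1 - H) * G) w + v

/-- The test channel of `Y = H X + (I - H) G W + V`, where `V` is Gaussian with mean `0` and
covariance matrix `QV`, independent of `(X, W)`. -/
noncomputable def gaussianChannel (H : Matrix (Fin k) (Fin k) ℝ) (G : Matrix (Fin k) (Fin n) ℝ)
    (QV : Matrix (Fin k) (Fin k) ℝ) : Kernel (Euc k × Euc n) (Euc k) :=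
  (Kernel.id ×ₖ Kernel.const (Euc k × Euc n) (multivariateGaussian (0 : Euc k) QV)).map
    fun q => reproduce H G q.1.1 q.1.2 q.2

/-- The map adding the noise is measurable, so that the test channel is the intended kernel. -/
theorem measurable_reproduce (H : Matrix (Fin k) (Fin k) ℝ) (G : Matrix (Fin k) (Fin n) ℝ) :
    Measurable fun q : (Euc k × Euc n) × Euc k => reproduce H G q.1.1 q.1.2 q.2 := by
  have h1 : Continuous (Matrix.toEuclideanLin H) := LinearMap.continuous_of_finiteDimensional _
  have h2 : Continuous (Matrix.toEuclideanLin ((1 - H) * G)) :=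
    LinearMap.continuous_of_finiteDimensional _
  have h : Continuous fun q : (Euc k × Euc n) × Euc k => reproduce H G q.1.1 q.1.2 q.2 := by
    unfold reproduce
    exact ((h1.comp (continuous_fst.comp continuous_fst)).add
      (h2.comp (continuous_snd.comp continuous_fst))).add continuous_snd
  exact h.measurable

instance isMarkovKernel_gaussianChannel (H : Matrix (Fin k) (Fin k) ℝ)
    (G : Matrix (Fin k) (Fin n) ℝ) (QV : Matrix (Fin k) (Fin k) ℝ) :
    IsMarkovKernel (gaussianChannel H G QV) :=
  Kernel.IsMarkovKernel.map _ (measurable_reproduce H G)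

/-- The joint law of `((X, W), Y)` when the Gaussian test channel with parameters `H`, `QV` and
`G = Q_{X,W} Q_W⁻¹` is driven by `(X, W)`. -/
noncomputable abbrev realizationLaw {Ω : Type*} [MeasurableSpace Ω] (X : Ω → Euc k) (W : Ω → Euc n)
    (P : Measure Ω) (H QV : Matrix (Fin k) (Fin k) ℝ) : Measure ((Euc k × Euc n) × Euc k) :=
  pairLaw X W P ⊗ₘ gaussianChannel H (crossCov X W P * (covMat W P)⁻¹) QV

/-- The value `½ ln (det Q / det Q_E)⁺` with `x⁺ = max 1 x`. -/
noncomputable def gaussianRate (Q QE : Matrix (Fin k) (Fin k) ℝ) : ℝ≥0∞ :=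
  ENNReal.ofReal (1 / 2 * Real.log (max 1 (Q.det / QE.det)))

end Realization

end GrayWyner

namespace GrayWyner

/-! ### Divergence: chain rule, data processing, variational bound, joint convexity. -/

section KL

variable {α β S T S' T' : Type*} [MeasurableSpace α] [MeasurableSpace β] [MeasurableSpace S]
  [MeasurableSpace T] [MeasurableSpace S'] [MeasurableSpace T']

/-! The bounds for an arbitrary `W` are fibrewise. Given `W = w`, the reproduction `E[X | Y, W]` is
a function of `Y` alone, so data processing for the divergence lowers the information
(`mutualInfoAt_comp_le`); being an orthogonal projection in L², the conditional mean also lowers the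
mean square error (`mse_condMean_le`). Under the structural property it equals `Y` almost surely,
and nothing is lost.

In the formula for `R_{X|W}` as an infimum over distortion profiles, one inequality is
disintegration: the conditional law of `(X, Y)` given `W = w` competes in the rate distortion
problem of `P_{X|W=w}`. The other needs near-optimal channels chosen measurably in `w`. A countable
family of channels, namely the identity and the quantizers followed by stochastic matrices with
positive rational entries, is near optimal for every source with finite second moment at every
finite distortion (`exists_channelFamily`). Taking the least good index is then a measurable
selection (`condRDF_le_lintegral_rdf`).

If `(X, W)` is jointly Gaussian, then `X = G W + c + U` with `U` centred Gaussian and independent of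
`W`. The conditional laws are translates of the law of `U`, and translations change neither
information nor square error, so the fibrewise rate distortion function is the same for almost all
`w`. It equals `R_{X|W}` (`condRDF_pairLaw_of_sub_indepFun`): a constant profile gives one bound;
for the other, subtract `G W + c` and use that information about a source independent of `W` can
only grow by conditioning on `W`. Convexity of the rate distortion function is not needed. Under the
structural property `X - Y` is uncorrelated with `W`, so `X` and `Y` have the same regression on `W`
and the pair of residuals is independent of `W`; hence the conditional information and distortion
are constant.

The explicit realization is a second-order computation. The parameters make the error uncorrelated
with, hence independent of, `(Y, W)`. This gives the structural property and reverses the channel: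
conditionally on `W`, the source is the reproduction plus independent Gaussian noise of covariance
`Q_E`, whose density is explicit. The converse (`exists_gaussianRate_le`) applies the
Donsker–Varadhan bound to the log density of a Gaussian centred at the conditional mean; its
expectation depends only on second moments, so no Gaussianity of the test channel is needed. Finally
a determinant is maximized over a compact set of error covariances, which gives attainment. -/

theorem rnDeriv_compProd_eq_kernel_rnDeriv [MeasurableSpace.CountablyGenerated β] (μ : Measure α)
    [IsFiniteMeasure μ] (κ η : Kernel α β) [IsFiniteKernel κ] [IsFiniteKernel η]
    (h : ∀ᵐ a ∂μ, κ a ≪ η a) :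
    (μ ⊗ₘ κ).rnDeriv (μ ⊗ₘ η) =ᵐ[μ ⊗ₘ η] fun p => κ.rnDeriv η p.1 p.2 := by
  have h1 : μ ⊗ₘ κ = (μ ⊗ₘ η).withDensity (fun p => κ.rnDeriv η p.1 p.2) := by
    rw [← Measure.compProd_withDensity (κ.measurable_rnDeriv η)]
    refine Measure.compProd_congr ?_
    filter_upwards [h] with a ha
    exact (Kernel.withDensity_rnDeriv_eq ha).symm
  rw [h1]
  exact Measure.rnDeriv_withDensity _ (κ.measurable_rnDeriv η)

theorem klDiv_kernel_eq [MeasurableSpace.CountablyGenerated β] (κ η : Kernel α β)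
    [IsFiniteKernel κ] [IsFiniteKernel η] [DecidablePred fun a => κ a ≪ η a] (a : α) :
    klDiv (κ a) (η a) = if κ a ≪ η a then
      ∫⁻ x, ENNReal.ofReal (klFun (κ.rnDeriv η a x).toReal) ∂(η a) else ∞ := by
  rw [klDiv_eq_lintegral_klFun]
  split_ifs with h
  · refine lintegral_congr_ae ?_
    filter_upwards [Kernel.rnDeriv_eq_rnDeriv_measure (κ := κ) (η := η) (a := a)] with x hx
    rw [hx]
  · rfl

/-- The kernel version of the density is jointly measurable and the set of absolute continuity is
measurable; this is what makes fibrewise informations measurable in `w`. -/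
theorem measurable_klDiv_kernel [MeasurableSpace.CountablyGenerated β] (κ η : Kernel α β)
    [IsFiniteKernel κ] [IsFiniteKernel η] : Measurable fun a => klDiv (κ a) (η a) := by
  classical
  simp_rw [klDiv_kernel_eq κ η]
  refine Measurable.ite (Kernel.measurableSet_absolutelyContinuous κ η) ?_ measurable_const
  exact Measurable.lintegral_kernel_prod_right'
    (f := fun p : α × β => ENNReal.ofReal (klFun (κ.rnDeriv η p.1 p.2).toReal)) (by fun_prop)

/-- With a common first marginal, the joint density is the fibrewise density. Absolute continuity of
the joint laws is equivalent to almost sure absolute continuity of the fibres, and if it fails both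
sides are infinite. -/
theorem klDiv_compProd_eq_lintegral [MeasurableSpace.CountablyGenerated β] (μ : Measure α)
    [IsFiniteMeasure μ] (κ η : Kernel α β) [IsFiniteKernel κ] [IsFiniteKernel η] :
    klDiv (μ ⊗ₘ κ) (μ ⊗ₘ η) = ∫⁻ a, klDiv (κ a) (η a) ∂μ := by
  by_cases h : ∀ᵐ a ∂μ, κ a ≪ η a
  · rw [klDiv_eq_lintegral_klFun_of_ac (Measure.AbsolutelyContinuous.compProd_right h)]
    have h2 : (fun p => ENNReal.ofReal (klFun ((μ ⊗ₘ κ).rnDeriv (μ ⊗ₘ η) p).toReal)) =ᵐ[μ ⊗ₘ η]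
        fun p => ENNReal.ofReal (klFun (κ.rnDeriv η p.1 p.2).toReal) := by
      filter_upwards [rnDeriv_compProd_eq_kernel_rnDeriv μ κ η h] with p hp
      rw [hp]
    rw [lintegral_congr_ae h2, Measure.lintegral_compProd (by fun_prop)]
    classical
    refine lintegral_congr_ae ?_
    filter_upwards [h] with a ha
    rw [klDiv_kernel_eq κ η, if_pos ha]
  · rw [klDiv_of_not_ac, eq_comm]
    · have h3 : μ {a | κ a ≪ η a}ᶜ ≠ 0 := h
      rw [eq_top_iff]
      calc ∞ = ∫⁻ a in {a | κ a ≪ η a}ᶜ, ∞ ∂μ := by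
            rw [setLIntegral_const, ENNReal.top_mul h3]
        _ = ∫⁻ a in {a | κ a ≪ η a}ᶜ, klDiv (κ a) (η a) ∂μ := by
            refine setLIntegral_congr_fun
              (Kernel.measurableSet_absolutelyContinuous κ η).compl fun a ha => ?_
            exact (klDiv_of_not_ac ha).symm
        _ ≤ _ := setLIntegral_le_lintegral _ _
    · rwa [Measure.absolutelyContinuous_compProd_right_iff]

theorem klDiv_map_equiv (μ ν : Measure α) [IsFiniteMeasure μ] [IsFiniteMeasure ν] (e : α ≃ᵐ β) :
    klDiv (μ.map e) (ν.map e) = klDiv μ ν := by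
  refine le_antisymm (klDiv_map_le μ ν e.measurable) ?_
  have h := klDiv_map_le (μ.map e) (ν.map e) e.symm.measurable
  simpa [Measure.map_map e.symm.measurable e.measurable] using h

/-- The chain rule with the second coordinate disintegrated first: the conditional terms are the
same for `q` and for the true marginal. Any guess `q` of the output law therefore gives an upper
bound for the information. -/
theorem klDiv_eq_mutualInfo_add [StandardBorelSpace S] [Nonempty S] (π : Measure (S × T))
    [IsProbabilityMeasure π] (q : Measure T) [IsProbabilityMeasure q] :
    klDiv π (π.fst.prod q) = mutualInfo π + klDiv π.snd q := by
  have hsw : ∀ r : Measure T, IsProbabilityMeasure r →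
      klDiv π (π.fst.prod r) = klDiv (π.map Prod.swap) (r ⊗ₘ Kernel.const T π.fst) := by
    intro r _
    rw [Measure.compProd_const, ← klDiv_map_equiv π _ MeasurableEquiv.prodComm]
    congr 1
    exact Measure.prod_swap
  have h0 : (π.map Prod.swap).fst ⊗ₘ (π.map Prod.swap).condKernel = π.map Prod.swap :=
    Measure.disintegrate _ _
  have hf : (π.map Prod.swap).fst = π.snd := Measure.fst_map_swap
  have : IsProbabilityMeasure (π.map Prod.swap) :=
    Measure.isProbabilityMeasure_map measurable_swap.aemeasurable
  unfold mutualInfo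
  rw [hsw q inferInstance, hsw π.snd inferInstance, ← h0, hf, klDiv_compProd_eq_add, add_comm]

theorem mutualInfo_le_klDiv [StandardBorelSpace S] [Nonempty S] (π : Measure (S × T))
    [IsProbabilityMeasure π] (q : Measure T) [IsProbabilityMeasure q] :
    mutualInfo π ≤ klDiv π (π.fst.prod q) := by
  rw [klDiv_eq_mutualInfo_add]
  exact le_self_add

/-- Data processing for the mutual information. -/
theorem mutualInfo_map_prodMap_le (π : Measure (S × T)) [IsFiniteMeasure π] {f : S → S'}
    {g : T → T'} (hf : Measurable f) (hg : Measurable g) :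
    mutualInfo (π.map (Prod.map f g)) ≤ mutualInfo π := by
  have hfg : Measurable (Prod.map f g) := hf.prodMap hg
  have h1 : (π.map (Prod.map f g)).fst = π.fst.map f := by
    rw [Measure.fst, Measure.fst, Measure.map_map measurable_fst hfg,
      Measure.map_map hf measurable_fst]
    rfl
  have h2 : (π.map (Prod.map f g)).snd = π.snd.map g := by
    rw [Measure.snd, Measure.snd, Measure.map_map measurable_snd hfg,
      Measure.map_map hg measurable_snd]
    rfl
  unfold mutualInfo
  rw [h1, h2, Measure.map_prod_map _ _ hf hg]
  exact klDiv_map_le _ _ hfg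

/-- The lower bound of Donsker and Varadhan. -/
theorem ofReal_integral_le_klDiv (π ρ : Measure α) [IsProbabilityMeasure π]
    [IsProbabilityMeasure ρ] {f : α → ℝ} (hf : Measurable f) (hfπ : Integrable f π)
    (hexp : ∫⁻ x, ENNReal.ofReal (Real.exp (f x)) ∂ρ ≤ 1) :
    ENNReal.ofReal (∫ x, f x ∂π) ≤ klDiv π ρ := by
  by_cases h : klDiv π ρ = ∞
  · simp [h]
  obtain ⟨hac, hint⟩ := klDiv_ne_top_iff.1 h
  have hexpi : Integrable (fun x => Real.exp (f x)) ρ := by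
    refine ⟨hf.exp.aestronglyMeasurable, ?_⟩
    rw [hasFiniteIntegral_iff_ofReal (ae_of_all _ fun x => (Real.exp_pos _).le)]
    exact hexp.trans_lt ENNReal.one_lt_top
  have hle : ∫ x, Real.exp (f x) ∂ρ ≤ 1 := by
    rw [integral_eq_lintegral_of_nonneg_ae (ae_of_all _ fun x => (Real.exp_pos _).le)
      hf.exp.aestronglyMeasurable]
    exact ENNReal.toReal_le_of_le_ofReal zero_le_one (by simpa using hexp)
  have hpos : 0 < ∫ x, Real.exp (f x) ∂ρ := integral_exp_pos hexpi
  -- Divergence from the tilted measure is nonnegative and differs from the divergence from `ρ` by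
  -- the mean of `f` and a log normalizer, which is nonpositive by `hexp`.
  have := isProbabilityMeasure_tilted hexpi
  have hac' : π ≪ ρ.tilted f := hac.trans (absolutelyContinuous_tilted hexpi)
  have h0 := integral_llr_add_sub_measure_univ_nonneg hac'
    (integrable_llr_tilted_right hac hfπ hint hexpi)
  rw [integral_llr_tilted_right hac hfπ hexpi hint] at h0
  simp only [probReal_univ] at h0
  rw [klDiv_of_ac_of_integrable hac hint]
  refine ENNReal.ofReal_le_ofReal ?_
  have := Real.log_nonpos hpos.le hle
  simp only [probReal_univ]
  linarith

/-- The equality case of the variational bound: the log-likelihood ratio is `f` itself. -/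
theorem klDiv_withDensity_exp (ρ : Measure α) [IsProbabilityMeasure ρ] {f : α → ℝ}
    (hf : Measurable f)
    [IsProbabilityMeasure (ρ.withDensity fun x => ENNReal.ofReal (Real.exp (f x)))]
    (hfi : Integrable f (ρ.withDensity fun x => ENNReal.ofReal (Real.exp (f x)))) :
    klDiv (ρ.withDensity fun x => ENNReal.ofReal (Real.exp (f x))) ρ
      = ENNReal.ofReal (∫ x, f x ∂(ρ.withDensity fun x => ENNReal.ofReal (Real.exp (f x)))) := by
  have hac := withDensity_absolutelyContinuous ρ fun x => ENNReal.ofReal (Real.exp (f x))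
  have hllr : llr (ρ.withDensity fun x => ENNReal.ofReal (Real.exp (f x))) ρ
      =ᵐ[ρ.withDensity fun x => ENNReal.ofReal (Real.exp (f x))] f := by
    refine hac.ae_le ?_
    filter_upwards [Measure.rnDeriv_withDensity ρ (hf.exp.ennreal_ofReal)] with x hx
    rw [llr, hx, ENNReal.toReal_ofReal (Real.exp_pos _).le, Real.log_exp]
  rw [klDiv_of_ac_of_integrable hac ((integrable_congr hllr).2 hfi), integral_congr_ae hllr]
  simp

/-- Joint convexity of the divergence. -/
theorem klDiv_convex_comb_le [MeasurableSpace.CountablyGenerated α] (a b : ℝ≥0)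
    (μ₁ μ₂ ν₁ ν₂ : Measure α) [IsProbabilityMeasure μ₁] [IsProbabilityMeasure μ₂]
    [IsProbabilityMeasure ν₁] [IsProbabilityMeasure ν₂] :
    klDiv (a • μ₁ + b • μ₂) (a • ν₁ + b • ν₂) ≤ a * klDiv μ₁ ν₁ + b * klDiv μ₂ ν₂ := by
  -- A mixture is the second marginal of a law with a hidden two-valued coordinate; forgetting that
  -- coordinate lowers the divergence, and the chain rule evaluates it before forgetting.
  let m : Measure Bool := a • Measure.dirac true + b • Measure.dirac false
  let κ : Kernel Bool α := ⟨fun i => if i then μ₁ else μ₂, measurable_of_countable _⟩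
  let η : Kernel Bool α := ⟨fun i => if i then ν₁ else ν₂, measurable_of_countable _⟩
  have : IsMarkovKernel κ := ⟨fun i => by
    cases i <;> simp only [κ, Kernel.coe_mk] <;> infer_instance⟩
  have : IsMarkovKernel η := ⟨fun i => by
    cases i <;> simp only [η, Kernel.coe_mk] <;> infer_instance⟩
  have hsnd : ∀ k : Kernel Bool α, IsMarkovKernel k →
      (m ⊗ₘ k).map Prod.snd = a • k true + b • k false := by
    intro k _
    ext s hs
    rw [Measure.map_apply measurable_snd hs, Measure.compProd_apply (measurable_snd hs)]
    simp only [m, lintegral_add_measure, lintegral_smul_measure, lintegral_dirac,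
      Measure.add_apply, Measure.smul_apply]
    rfl
  have h := klDiv_map_le (m ⊗ₘ κ) (m ⊗ₘ η) measurable_snd
  rw [hsnd κ inferInstance, hsnd η inferInstance, klDiv_compProd_eq_lintegral] at h
  rw [lintegral_add_measure, lintegral_smul_measure, lintegral_smul_measure, lintegral_dirac,
    lintegral_dirac] at h
  exact h

end KL

end GrayWyner

namespace GrayWyner

/-! ### Regular conditional laws and conditional data processing. -/

section CondDistrib

variable {Ω 𝕎 S T U : Type*} [MeasurableSpace Ω] [MeasurableSpace 𝕎] [MeasurableSpace S]
  [MeasurableSpace T] [MeasurableSpace U] [StandardBorelSpace S] [Nonempty S]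
  [StandardBorelSpace T] [Nonempty T] [StandardBorelSpace U] [Nonempty U]
  {P : Measure Ω} [IsProbabilityMeasure P]

/-- The conditional law of a function of `V` and of the conditioning variable `W`. -/
theorem condDistrib_map_fiber {V : Ω → S} {W : Ω → 𝕎} (hV : Measurable V) (hW : Measurable W)
    {g : 𝕎 × S → T} (hg : Measurable g) :
    ∀ᵐ w ∂(P.map W), condDistrib (fun ω => g (W ω, V ω)) W P w
      = (condDistrib V W P w).map fun v => g (w, v) := by
  let κ : Kernel 𝕎 T := (Kernel.id ×ₖ condDistrib V W P).map g
  have hκ : ∀ w, κ w = (condDistrib V W P w).map fun v => g (w, v) := by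
    intro w
    rw [Kernel.map_apply _ hg, Kernel.prod_apply, Kernel.id_apply, Measure.dirac_prod,
      Measure.map_map hg measurable_prodMk_left]
    rfl
  have : IsMarkovKernel κ := Kernel.IsMarkovKernel.map _ hg
  have h := condDistrib_ae_eq_of_measure_eq_compProd_of_measurable (μ := P) (κ := κ) hW
    (hg.comp (hW.prodMk hV)) ?_
  · filter_upwards [h] with w hw
    rw [← hκ w, ← hw]
    rfl
  · have hm : Measurable fun p : 𝕎 × S => (p.1, g p) := measurable_fst.prodMk hg
    have h1 : P.map (fun ω => (W ω, g (W ω, V ω)))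
        = (P.map fun ω => (W ω, V ω)).map fun p => (p.1, g p) := by
      rw [Measure.map_map hm (hW.prodMk hV)]
      rfl
    change P.map (fun ω => (W ω, g (W ω, V ω))) = _
    rw [h1, ← compProd_map_condDistrib hV.aemeasurable]
    ext s hs
    rw [Measure.map_apply hm hs, Measure.compProd_apply (hm hs), Measure.compProd_apply hs]
    refine lintegral_congr fun w => ?_
    have hgw : Measurable fun v => g (w, v) := hg.comp measurable_prodMk_left
    rw [hκ, Measure.map_apply hgw (measurable_prodMk_left hs)]
    rfl

theorem fst_condDistrib_prodMk {X : Ω → S} {Y : Ω → T} {W : Ω → 𝕎} (hX : Measurable X)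
    (hY : Measurable Y) (hW : Measurable W) :
    ∀ᵐ w ∂(P.map W), (condDistrib (fun ω => (X ω, Y ω)) W P w).fst = condDistrib X W P w := by
  filter_upwards [condDistrib_map_fiber (P := P) (hX.prodMk hY) hW
    (g := fun p : 𝕎 × S × T => p.2.1) (by fun_prop)] with w hw
  rw [hw]
  rfl

theorem condDistrib_of_indepFun {V : Ω → S} {W : Ω → 𝕎} (hV : Measurable V) (hW : Measurable W)
    (h : IndepFun V W P) : ∀ᵐ w ∂(P.map W), condDistrib V W P w = P.map V := by
  have h1 := condDistrib_ae_eq_of_measure_eq_compProd_of_measurable (μ := P)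
    (κ := Kernel.const 𝕎 (P.map V)) hW hV ?_
  · filter_upwards [h1] with w hw
    rw [hw, Kernel.const_apply]
  · rw [Measure.compProd_const]
    exact (indepFun_iff_map_prod_eq_prod_map_map hW.aemeasurable hV.aemeasurable).1 h.symm

/-- Conditional data processing: a reproduction that is a function of `Y` and `W` carries at most
the conditional information of `Y`. -/
theorem mutualInfoAt_comp_le {X : Ω → S} {Y : Ω → T} {W : Ω → 𝕎} (hX : Measurable X)
    (hY : Measurable Y) (hW : Measurable W) {f : T × 𝕎 → U} (hf : Measurable f) :
    ∀ᵐ w ∂(P.map W), mutualInfoAt X (fun ω => f (Y ω, W ω)) W P w ≤ mutualInfoAt X Y W P w := by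
  filter_upwards [condDistrib_map_fiber (P := P) (hX.prodMk hY) hW
    (g := fun p : 𝕎 × S × T => (p.2.1, f (p.2.2, p.1))) (by fun_prop)] with w hw
  unfold mutualInfoAt
  rw [hw]
  exact mutualInfo_map_prodMap_le _ measurable_id (hf.comp measurable_prodMk_right)

theorem measurable_mutualInfo_kernel (lam : Kernel 𝕎 (S × T)) [IsMarkovKernel lam] :
    Measurable fun w => mutualInfo (lam w) := by
  have h := measurable_klDiv_kernel lam (lam.fst ×ₖ lam.snd)
  simp_rw [Kernel.prod_apply, Kernel.fst_apply, Kernel.snd_apply] at h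
  exact h

/-- Equality holds at every `w`, since `condDistrib` is built from the joint law, which null sets do
not change. -/
theorem mutualInfoAt_congr {X X' : Ω → S} {Y Y' : Ω → T} {W : Ω → 𝕎} (hX : X =ᵐ[P] X')
    (hY : Y =ᵐ[P] Y') : mutualInfoAt X Y W P = mutualInfoAt X' Y' W P := by
  unfold mutualInfoAt
  rw [condDistrib_congr_left (hX.prodMk hY)]

theorem condMutualInfo_congr {X X' : Ω → S} {Y Y' : Ω → T} {W : Ω → 𝕎} (hX : X =ᵐ[P] X')
    (hY : Y =ᵐ[P] Y') : condMutualInfo X Y W P = condMutualInfo X' Y' W P := by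
  unfold condMutualInfo
  rw [mutualInfoAt_congr hX hY]

end CondDistrib

/-! ### Mean square error, conditional means, and the lower bounds for arbitrary `W`. -/

section Distortion

variable {Ω 𝕎 : Type*} [MeasurableSpace Ω] [MeasurableSpace 𝕎] {k : ℕ} {P : Measure Ω}
  [IsProbabilityMeasure P]

theorem mseAt_congr {X X' Y Y' : Ω → Euc k} {W : Ω → 𝕎} (hX : X =ᵐ[P] X')
    (hY : Y =ᵐ[P] Y') : mseAt X Y W P = mseAt X' Y' W P := by
  unfold mseAt
  rw [condDistrib_congr_left (hX.prodMk hY)]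

theorem mse_congr {X X' Y Y' : Ω → Euc k} (hX : X =ᵐ[P] X')
    (hY : Y =ᵐ[P] Y') : mse X Y P = mse X' Y' P := by
  refine lintegral_congr_ae ?_
  filter_upwards [hX, hY] with ω h1 h2
  rw [h1, h2]

theorem mse_map {α : Type*} [MeasurableSpace α] {μ : Measure α} {V : α → Ω} {X Y : Ω → Euc k}
    (hV : Measurable V) (hX : Measurable X) (hY : Measurable Y) :
    mse X Y (μ.map V) = mse (X ∘ V) (Y ∘ V) μ := by
  unfold mse
  rw [lintegral_map (by fun_prop) hV]
  rfl

theorem measurable_mseAt (X Y : Ω → Euc k) (W : Ω → 𝕎) : Measurable (mseAt X Y W P) :=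
  Measurable.lintegral_kernel (by fun_prop)

theorem mse_eq_lintegral_mseAt {X Y : Ω → Euc k} {W : Ω → 𝕎} (hX : Measurable X)
    (hY : Measurable Y) (hW : Measurable W) :
    mse X Y P = ∫⁻ w, mseAt X Y W P w ∂(P.map W) := by
  have hm : Measurable fun p : 𝕎 × Euc k × Euc k => ‖p.2.1 - p.2.2‖ₑ ^ 2 := by fun_prop
  have h1 : mse X Y P = ∫⁻ p, ‖p.2.1 - p.2.2‖ₑ ^ 2 ∂(P.map fun ω => (W ω, X ω, Y ω)) := by
    rw [lintegral_map hm (hW.prodMk (hX.prodMk hY))]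
    rfl
  rw [h1, ← compProd_map_condDistrib (hX.prodMk hY).aemeasurable, Measure.lintegral_compProd hm]
  rfl

theorem stronglyMeasurable_condMean {T : Type*} [MeasurableSpace T] (X : Ω → Euc k) (Y : Ω → T) :
    StronglyMeasurable[MeasurableSpace.comap Y inferInstance] (condMean X Y P) :=
  stronglyMeasurable_condExp

theorem exists_condMean_eq_comp {T : Type*} [MeasurableSpace T] (X : Ω → Euc k) (Y : Ω → T) :
    ∃ f : T → Euc k, Measurable f ∧ condMean X Y P = f ∘ Y := by
  obtain ⟨f, hf, h⟩ := (stronglyMeasurable_condMean (P := P) X Y).exists_eq_measurable_comp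
  exact ⟨f, hf.measurable, h⟩

theorem exists_cmRep_eq_comp (X Y : Ω → Euc k) (W : Ω → 𝕎) :
    ∃ f : Euc k × 𝕎 → Euc k, Measurable f ∧ cmRep X Y W P = fun ω => f (Y ω, W ω) :=
  exists_condMean_eq_comp X _

theorem measurable_cmRep (X : Ω → Euc k) {Y : Ω → Euc k} {W : Ω → 𝕎} (hY : Measurable Y)
    (hW : Measurable W) : Measurable (cmRep X Y W P) := by
  obtain ⟨f, hf, h⟩ := exists_cmRep_eq_comp (P := P) X Y W
  rw [h]
  exact hf.comp (hY.prodMk hW)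

theorem mse_eq_eLpNorm_sq (X Y : Ω → Euc k) : mse X Y P = eLpNorm (X - Y) 2 P ^ 2 := by
  rw [eLpNorm_eq_lintegral_rpow_enorm_toReal (by norm_num) (by norm_num)]
  simp only [ENNReal.toReal_ofNat, one_div]
  rw [← ENNReal.rpow_natCast, ← ENNReal.rpow_mul]
  simp [mse]

theorem memLp_of_mse_ne_top {X Y : Ω → Euc k} (hX : MemLp X 2 P) (hY : Measurable Y)
    (h : mse X Y P ≠ ∞) : MemLp Y 2 P := by
  have h1 : MemLp (X - Y) 2 P := by
    refine ⟨hX.1.sub hY.aestronglyMeasurable, ?_⟩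
    rw [mse_eq_eLpNorm_sq] at h
    rw [lt_top_iff_ne_top]
    rintro h2
    simp [h2] at h
  simpa using hX.sub h1

/-- The conditional mean minimizes the mean square error. -/
theorem mse_condMean_le {T : Type*} [MeasurableSpace T] {X : Ω → Euc k} {V : Ω → T}
    {Z : Ω → Euc k} (hX : MemLp X 2 P) (hV : Measurable V) (hZ : Measurable Z)
    (hZV : StronglyMeasurable[MeasurableSpace.comap V inferInstance] Z) :
    mse X (condMean X V P) P ≤ mse X Z P := by
  by_cases htop : mse X Z P = ∞
  · simp [htop]
  have hZ2 : MemLp Z 2 P := memLp_of_mse_ne_top hX hZ htop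
  have hm : MeasurableSpace.comap V inferInstance ≤ (inferInstance : MeasurableSpace Ω) :=
    hV.comap_le
  have hU : MemLp (X - Z) 2 P := hX.sub hZ2
  have h1 := hU.condExpL2_ae_eq_condExp (𝕜 := ℝ) hm
  have h2 : P[X - Z | MeasurableSpace.comap V inferInstance] =ᵐ[P] condMean X V P - Z := by
    refine (condExp_sub (hX.integrable one_le_two) (hZ2.integrable one_le_two) _).trans ?_
    rw [condExp_of_stronglyMeasurable hm hZV (hZ2.integrable one_le_two)]
    rfl
  -- Since `Z` is a function of `V`, the error of the conditional mean is the projection of `X - Z`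
  -- to the orthogonal complement of the `V`-measurable functions, so its norm is at most that of `X
  -- - Z`.
  have h3 : X - condMean X V P =ᵐ[P]
      ⇑(hU.toLp _ - (condExpL2 (Euc k) ℝ hm (hU.toLp _) : Lp (Euc k) 2 P)) := by
    filter_upwards [h1, h2, hU.coeFn_toLp, Lp.coeFn_sub (hU.toLp _)
      (condExpL2 (Euc k) ℝ hm (hU.toLp _) : Lp (Euc k) 2 P)] with ω a b c d
    rw [d, Pi.sub_apply, Pi.sub_apply, a, b, c]
    simp
  rw [mse_eq_eLpNorm_sq, mse_eq_eLpNorm_sq]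
  refine pow_le_pow_left' ?_ 2
  rw [eLpNorm_congr_ae h3, ← eLpNorm_congr_ae hU.coeFn_toLp, ← Lp.enorm_def, ← Lp.enorm_def]
  rw [enorm_le_iff_norm_le]
  have : Fact (MeasurableSpace.comap V inferInstance ≤ (inferInstance : MeasurableSpace Ω)) := ⟨hm⟩
  have h4 := Submodule.norm_starProjection_apply_le
    (lpMeas (Euc k) ℝ (MeasurableSpace.comap V inferInstance) 2 P)ᗮ (hU.toLp (X - Z))
  rw [Submodule.starProjection_orthogonal_val] at h4
  exact h4

theorem mse_cmRep_le {X Y : Ω → Euc k} {W : Ω → 𝕎} (hX : MemLp X 2 P) (hY : Measurable Y)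
    (hW : Measurable W) : mse X (cmRep X Y W P) P ≤ mse X Y P := by
  refine mse_condMean_le hX (hY.prodMk hW) hY ?_
  refine Measurable.stronglyMeasurable ?_
  exact measurable_fst.comp (comap_measurable fun ω => (Y ω, W ω))

theorem essInf_le_lintegral {α : Type*} [MeasurableSpace α] (μ : Measure α)
    [IsProbabilityMeasure μ] (f : α → ℝ≥0∞) : essInf f μ ≤ ∫⁻ a, f a ∂μ := by
  calc essInf f μ = ∫⁻ _, essInf f μ ∂μ := by simp
    _ ≤ ∫⁻ a, f a ∂μ := lintegral_mono_ae (ae_essInf_le)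

theorem essInf_eq_of_ae_eq_const {α : Type*} [MeasurableSpace α] (μ : Measure α)
    [IsProbabilityMeasure μ] {f : α → ℝ≥0∞} {c : ℝ≥0∞} (h : ∀ᵐ a ∂μ, f a = c) :
    essInf f μ = c := by
  rw [essInf_congr_ae (g := fun _ => c) h]
  exact essInf_const _ (NeZero.ne μ)

theorem lintegral_eq_of_ae_eq_const {α : Type*} [MeasurableSpace α] (μ : Measure α)
    [IsProbabilityMeasure μ] {f : α → ℝ≥0∞} {c : ℝ≥0∞} (h : ∀ᵐ a ∂μ, f a = c) :
    ∫⁻ a, f a ∂μ = c := by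
  rw [lintegral_congr_ae (g := fun _ => c) h]
  simp

theorem Structural.cmRep_eq {X Y : Ω → Euc k} {W : Ω → 𝕎} (h : Structural X Y W P) :
    cmRep X Y W P =ᵐ[P] Y :=
  h.1.trans h.2

/-- An almost everywhere constant function has the same integral and essential infimum. -/
theorem attainsLowerBounds_of_const {X Y : Ω → Euc k} {W : Ω → 𝕎} (hX : Measurable X)
    (hY : Measurable Y) (hW : Measurable W) (hS : Structural X Y W P)
    (hI : ∃ c, ∀ᵐ w ∂(P.map W), mutualInfoAt X (cmRep X Y W P) W P w = c)
    (hD : ∃ d, ∀ᵐ w ∂(P.map W), mseAt X (cmRep X Y W P) W P w = d) :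
    AttainsLowerBounds X Y W P := by
  have : IsProbabilityMeasure (P.map W) := Measure.isProbabilityMeasure_map hW.aemeasurable
  have e1 : condMutualInfo X Y W P = condMutualInfo X (cmRep X Y W P) W P :=
    (condMutualInfo_congr .rfl hS.cmRep_eq).symm
  have e2 : mse X Y P = mse X (cmRep X Y W P) P := (mse_congr .rfl hS.cmRep_eq).symm
  obtain ⟨c, hc⟩ := hI
  obtain ⟨d, hd⟩ := hD
  refine ⟨e1, e2, ?_, ?_⟩
  · rw [e1, essInf_eq_of_ae_eq_const _ hc]
    exact lintegral_eq_of_ae_eq_const _ hc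
  · rw [e2, essInf_eq_of_ae_eq_const _ hd, mse_eq_lintegral_mseAt hX (measurable_cmRep X hY hW) hW]
    exact lintegral_eq_of_ae_eq_const _ hd

theorem mutualInfoAt_cmRep_le {X Y : Ω → Euc k} {W : Ω → 𝕎} (hX : Measurable X)
    (hY : Measurable Y) (hW : Measurable W) :
    ∀ᵐ w ∂(P.map W), mutualInfoAt X (cmRep X Y W P) W P w ≤ mutualInfoAt X Y W P w := by
  obtain ⟨f, hf, h⟩ := exists_cmRep_eq_comp (P := P) X Y W
  rw [h]
  exact mutualInfoAt_comp_le hX hY hW hf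

theorem lower_bounds {X Y : Ω → Euc k} {W : Ω → 𝕎} (hX : Measurable X) (hX2 : MemLp X 2 P)
    (hY : Measurable Y) (hW : Measurable W) :
    condMutualInfo X (cmRep X Y W P) W P ≤ condMutualInfo X Y W P ∧
    mse X (cmRep X Y W P) P ≤ mse X Y P ∧
    (Structural X Y W P →
      condMutualInfo X Y W P = condMutualInfo X (cmRep X Y W P) W P ∧
      mse X Y P = mse X (cmRep X Y W P) P) ∧
    ∫⁻ w, mutualInfoAt X (cmRep X Y W P) W P w ∂(P.map W) ≤ condMutualInfo X Y W P ∧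
    essInf (mutualInfoAt X (cmRep X Y W P) W P) (P.map W)
      ≤ ∫⁻ w, mutualInfoAt X (cmRep X Y W P) W P w ∂(P.map W) ∧
    mse X Y P = ∫⁻ w, mseAt X Y W P w ∂(P.map W) ∧
    ∫⁻ w, mseAt X (cmRep X Y W P) W P w ∂(P.map W) ≤ ∫⁻ w, mseAt X Y W P w ∂(P.map W) ∧
    essInf (mseAt X (cmRep X Y W P) W P) (P.map W)
      ≤ ∫⁻ w, mseAt X (cmRep X Y W P) W P w ∂(P.map W) ∧
    (Structural X Y W P →
      (∃ c, ∀ᵐ w ∂(P.map W), mutualInfoAt X (cmRep X Y W P) W P w = c) →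
      (∃ d, ∀ᵐ w ∂(P.map W), mseAt X (cmRep X Y W P) W P w = d) →
      AttainsLowerBounds X Y W P) := by
  have : IsProbabilityMeasure (P.map W) := Measure.isProbabilityMeasure_map hW.aemeasurable
  have hI := lintegral_mono_ae (mutualInfoAt_cmRep_le (P := P) hX hY hW)
  have hD := mse_cmRep_le hX2 hY hW
  have hY' := mse_eq_lintegral_mseAt (P := P) hX hY hW
  refine ⟨hI, hD, fun hS => ⟨?_, ?_⟩, hI, essInf_le_lintegral _ _, hY', ?_,
    essInf_le_lintegral _ _, fun hS hc hd => attainsLowerBounds_of_const hX hY hW hS hc hd⟩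
  · exact (condMutualInfo_congr .rfl hS.cmRep_eq).symm
  · exact (mse_congr .rfl hS.cmRep_eq).symm
  -- Unlike the information, the distortion is compared only after averaging over `w`, through the
  -- unconditional projection inequality.
  · rwa [← hY', ← mse_eq_lintegral_mseAt hX (measurable_cmRep X hY hW) hW]

theorem rdf_le {ν : Measure (Euc k)} {D : ℝ≥0∞} {κ : Kernel (Euc k) (Euc k)} [hκ : IsMarkovKernel κ]
    (hD : mse Prod.fst Prod.snd (ν ⊗ₘ κ) ≤ D) : rdf ν D ≤ mutualInfo (ν ⊗ₘ κ) :=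
  (iInf₂_le κ hκ).trans (iInf_le _ hD)

/-- The rate distortion function is a lower bound for the information of every joint law. -/
theorem rdf_fst_le_mutualInfo (π : Measure (Euc k × Euc k)) [IsProbabilityMeasure π] {D : ℝ≥0∞}
    (hD : mse Prod.fst Prod.snd π ≤ D) : rdf π.fst D ≤ mutualInfo π := by
  have h : π.fst ⊗ₘ π.condKernel = π := Measure.disintegrate _ _
  have h' := rdf_le (ν := π.fst) (κ := π.condKernel) (D := D) (by rwa [h])
  rwa [h] at h'

theorem rdf_antitone (ν : Measure (Euc k)) : Antitone (rdf ν) := fun _ _ h =>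
  iInf_mono fun _ => iInf_mono fun _ => iInf_mono' fun h' => ⟨h'.trans h, le_rfl⟩

/-- Conditionally on `W = w`, the rate distortion function bounds the information from below. -/
theorem rdf_mseAt_le_mutualInfoAt {X Y : Ω → Euc k} {W : Ω → 𝕎} (hX : Measurable X)
    (hY : Measurable Y) (hW : Measurable W) :
    ∀ᵐ w ∂(P.map W), rdf (condDistrib X W P w) (mseAt X Y W P w) ≤ mutualInfoAt X Y W P w := by
  filter_upwards [fst_condDistrib_prodMk (P := P) hX hY hW] with w hw
  rw [← hw]
  exact rdf_fst_le_mutualInfo _ le_rfl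

end Distortion

end GrayWyner

namespace GrayWyner

/-! ### Test channels driven by a pair law, and the converse for distortion profiles. -/

section TestChannel

variable {Ω 𝕎 : Type*} [MeasurableSpace Ω] [MeasurableSpace 𝕎] {k : ℕ}
  {P : Measure Ω} [IsProbabilityMeasure P] {μ : Measure (Euc k × 𝕎)} [IsProbabilityMeasure μ]
  {κ : Kernel (Euc k × 𝕎) (Euc k)} [IsMarkovKernel κ]

theorem measurable_src : Measurable (src : (Euc k × 𝕎) × Euc k → Euc k) :=
  measurable_fst.comp measurable_fst

theorem measurable_side : Measurable (side : (Euc k × 𝕎) × Euc k → 𝕎) :=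
  measurable_snd.comp measurable_fst

theorem measurable_rep : Measurable (rep : (Euc k × 𝕎) × Euc k → Euc k) :=
  measurable_snd

theorem compProd_map_fst : (μ ⊗ₘ κ).map Prod.fst = μ := Measure.fst_compProd μ κ

theorem compProd_map_side : (μ ⊗ₘ κ).map side = μ.map Prod.snd := by
  conv_rhs => rw [← compProd_map_fst (μ := μ) (κ := κ)]
  rw [Measure.map_map measurable_snd measurable_fst]
  rfl

theorem condDistrib_src_side :
    condDistrib src side (μ ⊗ₘ κ) = condDistrib Prod.fst Prod.snd μ := by
  rw [condDistrib, condDistrib]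
  congr 1
  conv_rhs => rw [← compProd_map_fst (μ := μ) (κ := κ)]
  rw [Measure.map_map (measurable_snd.prodMk measurable_fst) measurable_fst]
  rfl

omit [IsProbabilityMeasure μ] in
theorem condDistrib_eq_of_pairLaw {X : Ω → Euc k} {W : Ω → 𝕎} (hX : Measurable X)
    (hW : Measurable W) :
    condDistrib X W P = condDistrib Prod.fst Prod.snd (pairLaw X W P) := by
  rw [condDistrib, condDistrib]
  congr 1
  rw [Measure.map_map (measurable_snd.prodMk measurable_fst) (hX.prodMk hW)]
  rfl

omit [IsProbabilityMeasure P] in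
theorem pairLaw_map_snd {X : Ω → Euc k} {W : Ω → 𝕎} (hX : Measurable X) (hW : Measurable W) :
    (pairLaw X W P).map Prod.snd = P.map W := by
  rw [pairLaw, Measure.map_map measurable_snd (hX.prodMk hW)]
  rfl

/-- On the fibre over `w` the test channel acts as its section at `w`, so a conditional problem
becomes a family of unconditional ones. -/
theorem condDistrib_src_rep :
    ∀ᵐ w ∂(μ.map Prod.snd), condDistrib (fun z => (src z, rep z)) side (μ ⊗ₘ κ) w
      = condDistrib Prod.fst Prod.snd μ w ⊗ₘ κ.sectL w := by
  have : IsProbabilityMeasure (μ.map Prod.snd) :=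
    Measure.isProbabilityMeasure_map measurable_snd.aemeasurable
  let κ' : Kernel (𝕎 × Euc k) (Euc k) := κ.comap Prod.swap measurable_swap
  let lam : Kernel 𝕎 (Euc k × Euc k) := condDistrib Prod.fst Prod.snd μ ⊗ₖ κ'
  have h := condDistrib_ae_eq_of_measure_eq_compProd_of_measurable (μ := μ ⊗ₘ κ) (κ := lam)
    measurable_side (measurable_src.prodMk measurable_rep) ?_
  · rw [compProd_map_side] at h
    filter_upwards [h] with w hw
    rw [hw]
    exact Kernel.compProd_apply_eq_compProd_sectR _ _ _
  · rw [compProd_map_side]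
    have hm : Measurable fun z : (Euc k × 𝕎) × Euc k => (side z, src z, rep z) :=
      measurable_side.prodMk (measurable_src.prodMk measurable_rep)
    ext s hs
    have hf : Measurable fun p : 𝕎 × Euc k => κ' p {y | (p.1, p.2, y) ∈ s} := by
      refine Kernel.measurable_kernel_prodMk_left (κ := κ') (t := {q | (q.1.1, q.1.2, q.2) ∈ s}) ?_
      exact (by fun_prop : Measurable fun q : (𝕎 × Euc k) × Euc k => (q.1.1, q.1.2, q.2)) hs
    rw [Measure.map_apply hm hs, Measure.compProd_apply (hm hs), Measure.compProd_apply hs]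
    have e1 : ∫⁻ a, κ a (Prod.mk a ⁻¹' ((fun z => (side z, src z, rep z)) ⁻¹' s)) ∂μ
        = ∫⁻ p, κ' p {y | (p.1, p.2, y) ∈ s} ∂(μ.map Prod.swap) := by
      rw [lintegral_map hf measurable_swap]
      rfl
    have e2 : μ.map Prod.swap = μ.map Prod.snd ⊗ₘ condDistrib Prod.fst Prod.snd μ := by
      rw [compProd_map_condDistrib measurable_fst.aemeasurable]
      rfl
    rw [e1, e2, Measure.lintegral_compProd hf]
    refine lintegral_congr fun w => ?_
    rw [Kernel.compProd_apply (measurable_prodMk_left hs)]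
    rfl

theorem condMutualInfo_compProd :
    condMutualInfo src rep side (μ ⊗ₘ κ) = ∫⁻ w, mutualInfo
      (condDistrib Prod.fst Prod.snd μ w ⊗ₘ κ.sectL w) ∂(μ.map Prod.snd) := by
  unfold condMutualInfo mutualInfoAt
  rw [compProd_map_side]
  refine lintegral_congr_ae ?_
  filter_upwards [condDistrib_src_rep (μ := μ) (κ := κ)] with w hw
  rw [hw]

theorem mse_compProd :
    mse src rep (μ ⊗ₘ κ) = ∫⁻ w, mse Prod.fst Prod.snd
      (condDistrib Prod.fst Prod.snd μ w ⊗ₘ κ.sectL w) ∂(μ.map Prod.snd) := by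
  rw [mse_eq_lintegral_mseAt measurable_src measurable_rep measurable_side, compProd_map_side]
  refine lintegral_congr_ae ?_
  filter_upwards [condDistrib_src_rep (μ := μ) (κ := κ)] with w hw
  rw [mseAt, hw]
  rfl

/-- The distortion profile of a test channel is itself an admissible `δ`. -/
theorem iInf_lintegral_rdf_le_condRDF (μ : Measure (Euc k × 𝕎)) [IsProbabilityMeasure μ]
    (Δ : ℝ≥0∞) :
    (⨅ (δ : 𝕎 → ℝ≥0∞) (_ : Measurable δ) (_ : ∫⁻ w, δ w ∂(μ.map Prod.snd) ≤ Δ),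
      ∫⁻ w, rdf (condDistrib Prod.fst Prod.snd μ w) (δ w) ∂(μ.map Prod.snd)) ≤ condRDF μ Δ := by
  refine le_iInf fun κ => le_iInf fun hκ => le_iInf fun hD => ?_
  refine (iInf_le _ (mseAt src rep side (μ ⊗ₘ κ))).trans ?_
  refine (iInf_le _ (measurable_mseAt _ _ _)).trans ?_
  refine (iInf_le _ ?_).trans ?_
  · rwa [← compProd_map_side (μ := μ) (κ := κ), ← mse_eq_lintegral_mseAt measurable_src
      measurable_rep measurable_side]
  · unfold condMutualInfo
    rw [← compProd_map_side (μ := μ) (κ := κ), ← condDistrib_src_side (μ := μ) (κ := κ)]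
    exact lintegral_mono_ae
      (rdf_mseAt_le_mutualInfoAt measurable_src measurable_rep measurable_side)

theorem lintegral_cmProfile (κ : Kernel (Euc k × 𝕎) (Euc k)) [IsMarkovKernel κ] :
    ∫⁻ w, cmProfile μ κ w ∂(μ.map Prod.snd) = mse src (cmRep src rep side (μ ⊗ₘ κ)) (μ ⊗ₘ κ) := by
  rw [mse_eq_lintegral_mseAt measurable_src (measurable_cmRep _ measurable_rep measurable_side)
    measurable_side, compProd_map_side]
  rfl

theorem memLp_src (h : MemLp Prod.fst 2 μ) : MemLp src 2 (μ ⊗ₘ κ) := by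
  have h' : MemLp Prod.fst 2 ((μ ⊗ₘ κ).map Prod.fst) := by rwa [compProd_map_fst]
  exact h'.comp_of_map measurable_fst.aemeasurable

/-- Replacing a reproduction by its conditional mean keeps the distortion constraint and, fibrewise,
does not raise the information; the new profile is therefore admissible and at most as costly. -/
theorem iInf_lintegral_rdf_cmProfile_le_condRDF (μ : Measure (Euc k × 𝕎)) [IsProbabilityMeasure μ]
    (hμ : MemLp Prod.fst 2 μ) (Δ : ℝ≥0∞) :
    (⨅ (κ : Kernel (Euc k × 𝕎) (Euc k)) (_ : IsMarkovKernel κ)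
      (_ : ∫⁻ w, cmProfile μ κ w ∂(μ.map Prod.snd) ≤ Δ),
      ∫⁻ w, rdf (condDistrib Prod.fst Prod.snd μ w) (cmProfile μ κ w) ∂(μ.map Prod.snd))
      ≤ condRDF μ Δ := by
  refine le_iInf fun κ => le_iInf fun hκ => le_iInf fun hD => ?_
  refine (iInf_le _ κ).trans ((iInf_le _ hκ).trans ((iInf_le _ ?_).trans ?_))
  · rw [lintegral_cmProfile (μ := μ)]
    exact (mse_cmRep_le (P := μ ⊗ₘ κ) (memLp_src (μ := μ) hμ) measurable_rep measurable_side).trans hD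
  · unfold condMutualInfo
    rw [← compProd_map_side (μ := μ) (κ := κ), ← condDistrib_src_side (μ := μ) (κ := κ)]
    refine lintegral_mono_ae ?_
    filter_upwards [rdf_mseAt_le_mutualInfoAt (P := μ ⊗ₘ κ) measurable_src
      (measurable_cmRep (P := μ ⊗ₘ κ) src measurable_rep measurable_side) measurable_side,
      mutualInfoAt_cmRep_le (P := μ ⊗ₘ κ) measurable_src measurable_rep measurable_side]
      with w h1 h2
    exact h1.trans h2

end TestChannel

end GrayWyner

namespace GrayWyner

/-! ### Densities of nondegenerate Gaussian laws. -/

section Density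

open Matrix
open scoped MatrixOrder RealInnerProductSpace

variable {k : ℕ}

/-- The quadratic form of the matrix `A`. -/
noncomputable def quadForm (A : Matrix (Fin k) (Fin k) ℝ) (u : Euc k) : ℝ :=
  u.ofLp ⬝ᵥ A *ᵥ u.ofLp

theorem continuous_quadForm (A : Matrix (Fin k) (Fin k) ℝ) : Continuous (quadForm A) := by
  unfold quadForm
  fun_prop

theorem quadForm_eq_sum (A : Matrix (Fin k) (Fin k) ℝ) (u : Euc k) :
    quadForm A u = ∑ i, ∑ j, A i j * (u i * u j) := by
  simp only [quadForm, dotProduct, mulVec, Finset.mul_sum]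
  refine Finset.sum_congr rfl fun i _ => Finset.sum_congr rfl fun j _ => ?_
  ring

/-- The two measures have the same characteristic function. -/
theorem stdGaussian_eq_withDensity :
    stdGaussian (Euc k) = (volume : Measure (Euc k)).withDensity fun x =>
      ENNReal.ofReal ((2 * Real.pi) ^ (-(k : ℝ) / 2) * Real.exp (-‖x‖ ^ 2 / 2)) := by
  have hc : 0 < (2 * Real.pi) ^ (-(k : ℝ) / 2) := by positivity
  have key : ∀ t : Euc k, ∫ x : Euc k, Complex.exp (⟪x, t⟫ * Complex.I)
      * (((2 * Real.pi) ^ (-(k : ℝ) / 2) * Real.exp (-‖x‖ ^ 2 / 2) : ℝ) : ℂ)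
      = Complex.exp (-‖t‖ ^ 2 / 2) := by
    intro t
    have h := GaussianFourier.integral_cexp_neg_mul_sq_norm_add (V := Euc k) (b := 1 / 2)
      (by norm_num) Complex.I t
    have h2 : ∀ x : Euc k, Complex.exp (⟪x, t⟫ * Complex.I)
        * (((2 * Real.pi) ^ (-(k : ℝ) / 2) * Real.exp (-‖x‖ ^ 2 / 2) : ℝ) : ℂ)
        = (((2 * Real.pi) ^ (-(k : ℝ) / 2) : ℝ) : ℂ)
          * Complex.exp (-(1 / 2) * ‖x‖ ^ 2 + Complex.I * ⟪t, x⟫) := by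
      intro x
      rw [real_inner_comm x t, Complex.exp_add]
      push_cast
      ring_nf
    simp_rw [h2]
    rw [integral_const_mul, h, ← mul_assoc, finrank_euclideanSpace_fin]
    have h3 : (((2 * Real.pi) ^ (-(k : ℝ) / 2) : ℝ) : ℂ) * (Real.pi / (1 / 2 : ℂ)) ^ ((k : ℂ) / 2)
        = 1 := by
      have : (Real.pi / (1 / 2 : ℂ)) ^ ((k : ℂ) / 2) = (((2 * Real.pi) ^ ((k : ℝ) / 2) : ℝ) : ℂ) := by
        rw [Complex.ofReal_cpow (by positivity)]
        push_cast
        congr 1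
        ring
      rw [this, ← Complex.ofReal_mul, ← Real.rpow_add (by positivity)]
      norm_num
      ring_nf
      simp
    rw [h3, one_mul, Complex.I_sq]
    congr 1
    ring
  have hmeas : Measurable fun x : Euc k =>
      (2 * Real.pi) ^ (-(k : ℝ) / 2) * Real.exp (-‖x‖ ^ 2 / 2) := by fun_prop
  have hint : Integrable fun x : Euc k =>
      (2 * Real.pi) ^ (-(k : ℝ) / 2) * Real.exp (-‖x‖ ^ 2 / 2) := by
    -- A nonintegrable function has integral `0` by convention, whereas `key 0` gives the value `1`.
    by_contra hn
    have h0 := key 0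
    have h1 : (fun x : Euc k => Complex.exp (⟪x, (0 : Euc k)⟫ * Complex.I)
      * (((2 * Real.pi) ^ (-(k : ℝ) / 2) * Real.exp (-‖x‖ ^ 2 / 2) : ℝ) : ℂ))
      = fun x => (((2 * Real.pi) ^ (-(k : ℝ) / 2) * Real.exp (-‖x‖ ^ 2 / 2) : ℝ) : ℂ) := by
      ext x; simp
    rw [h1, integral_complex_ofReal, integral_undef hn] at h0
    simp at h0
  have hfin : IsFiniteMeasure ((volume : Measure (Euc k)).withDensity fun x =>
      ENNReal.ofReal ((2 * Real.pi) ^ (-(k : ℝ) / 2) * Real.exp (-‖x‖ ^ 2 / 2))) :=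
    isFiniteMeasure_withDensity_ofReal hint.2
  refine Measure.ext_of_charFun ?_
  ext t
  rw [charFun_stdGaussian, charFun_apply, ← key t]
  rw [integral_withDensity_eq_integral_toReal_smul hmeas.ennreal_ofReal (ae_of_all _ fun x => by simp)]
  refine (integral_congr_ae (ae_of_all _ fun x => ?_)).symm
  rw [ENNReal.toReal_ofReal (by positivity), Complex.real_smul, mul_comm]

theorem map_equiv_withDensity {α β : Type*} [MeasurableSpace α] [MeasurableSpace β] (μ : Measure α)
    {f : α → ℝ≥0∞} (hf : Measurable f) (e : α ≃ᵐ β) :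
    (μ.withDensity f).map e = (μ.map e).withDensity (f ∘ e.symm) := by
  ext s hs
  rw [Measure.map_apply e.measurable hs, withDensity_apply _ (e.measurable hs),
    withDensity_apply _ hs, setLIntegral_map hs (hf.comp e.symm.measurable) e.measurable]
  simp

/-- The Gaussian density with mean `m` and covariance matrix `S`. -/
noncomputable def gaussDensity (m : Euc k) (S : Matrix (Fin k) (Fin k) ℝ) (x : Euc k) : ℝ :=
  (2 * Real.pi) ^ (-(k : ℝ) / 2) * (√S.det)⁻¹ * Real.exp (-quadForm S⁻¹ (x - m) / 2)

theorem det_toEuclideanLin (R : Matrix (Fin k) (Fin k) ℝ) :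
    LinearMap.det (toEuclideanLin R : Euc k →ₗ[ℝ] Euc k) = R.det := by
  change LinearMap.det (toLpLin 2 2 R) = R.det
  rw [toLpLin_eq_toLin, LinearMap.det_toLin]

theorem multivariateGaussian_eq_withDensity (m : Euc k) {S : Matrix (Fin k) (Fin k) ℝ}
    (hS : S.PosDef) :
    multivariateGaussian m S = (volume : Measure (Euc k)).withDensity fun x =>
      ENNReal.ofReal (gaussDensity m S x) := by
  -- `multivariateGaussian` is the image of the standard law under `x ↦ m + R x`; its density
  -- follows by change of variables, with Jacobian `det R = √det S`.
  set R := CFC.sqrt S with hR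
  have hRR : R * R = S := CFC.sqrt_mul_sqrt_self S hS.posSemidef.nonneg
  have hRdet : R.det = √S.det := by
    rw [hR, hS.posSemidef.det_sqrt, RCLike.sqrt_of_nonneg hS.posSemidef.det_nonneg]
    simp
  have hpos : 0 < R.det := by rw [hRdet]; exact Real.sqrt_pos.2 hS.det_pos
  have hRu : IsUnit R.det := isUnit_iff_ne_zero.2 hpos.ne'
  have hRs : R.IsHermitian := (CFC.sqrt_nonneg S).posSemidef.isHermitian
  have hRinv : R⁻¹.IsHermitian := hRs.inv
  have hRRinv : R⁻¹ * R⁻¹ = S⁻¹ := by rw [← hRR, Matrix.mul_inv_rev]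
  have l1 : ∀ x : Euc k, toEuclideanLin R⁻¹ (toEuclideanLin R x) = x := by
    intro x
    apply (WithLp.equiv 2 _).injective
    simp [Matrix.nonsing_inv_mul R hRu, toLpLin_apply]
  have l2 : ∀ x : Euc k, toEuclideanLin R (toEuclideanLin R⁻¹ x) = x := by
    intro x
    apply (WithLp.equiv 2 _).injective
    simp [Matrix.mul_nonsing_inv R hRu, toLpLin_apply]
  have c1 : Continuous (toEuclideanLin R : Euc k → Euc k) :=
    LinearMap.continuous_of_finiteDimensional _
  have c2 : Continuous (toEuclideanLin R⁻¹ : Euc k → Euc k) :=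
    LinearMap.continuous_of_finiteDimensional _
  let e : Euc k ≃ᵐ Euc k :=
    { toFun := fun x => m + toEuclideanLin R x
      invFun := fun x => toEuclideanLin R⁻¹ (x - m)
      left_inv := fun x => by simp [l1]
      right_inv := fun x => by simp [l2]
      measurable_toFun := (continuous_const.add c1).measurable
      measurable_invFun := (c2.comp (continuous_id.sub continuous_const)).measurable }
  have hg : Measurable fun x : Euc k => ENNReal.ofReal
      ((2 * Real.pi) ^ (-(k : ℝ) / 2) * Real.exp (-‖x‖ ^ 2 / 2)) := by fun_prop
  have hmap : multivariateGaussian m S = (stdGaussian (Euc k)).map e := rfl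
  have hvol : (volume : Measure (Euc k)).map e = ENNReal.ofReal (√S.det)⁻¹ • volume := by
    have : (e : Euc k → Euc k) = (fun x => m + x) ∘ (toEuclideanLin R : Euc k → Euc k) := rfl
    rw [this, ← Measure.map_map (measurable_const_add m) c1.measurable,
      Measure.map_linearMap_addHaar_eq_smul_addHaar _ (by
        rw [det_toEuclideanLin]; exact hpos.ne'), Measure.map_smul,
      map_add_left_eq_self, det_toEuclideanLin, hRdet, abs_of_pos]
    rw [← hRdet]
    positivity
  rw [hmap, stdGaussian_eq_withDensity, map_equiv_withDensity _ hg, hvol, withDensity_smul_measure,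
    ← withDensity_smul _ (hg.comp e.symm.measurable)]
  congr 1
  ext x
  -- The root is symmetric, so `‖R⁻¹ u‖² = uᵀ R⁻¹ R⁻¹ u`.
  have hn : ‖e.symm x‖ ^ 2 = quadForm S⁻¹ (x - m) := by
    change ‖toEuclideanLin R⁻¹ (x - m)‖ ^ 2 = _
    rw [EuclideanSpace.real_norm_sq_eq, quadForm, ← hRRinv, ← mulVec_mulVec, dotProduct_mulVec,
      ← mulVec_transpose]
    have : R⁻¹ᵀ = R⁻¹ := hRinv
    rw [this]
    simp [dotProduct, sq, toLpLin_apply]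
  simp only [Pi.smul_apply, Function.comp_apply, smul_eq_mul]
  rw [hn, ← ENNReal.ofReal_mul (by positivity), gaussDensity]
  congr 1
  ring

/-- The logarithm of the density of `N(y, S)` with respect to `N(0, Q)`. -/
noncomputable def logRatio (Q S : Matrix (Fin k) (Fin k) ℝ) (y x : Euc k) : ℝ :=
  1 / 2 * Real.log (Q.det / S.det) - 1 / 2 * quadForm S⁻¹ (x - y) + 1 / 2 * quadForm Q⁻¹ x

theorem measurable_logRatio (Q S : Matrix (Fin k) (Fin k) ℝ) :
    Measurable fun p : Euc k × Euc k => logRatio Q S p.1 p.2 := by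
  have h1 := (continuous_quadForm (k := k) S⁻¹).measurable
  have h2 := (continuous_quadForm (k := k) Q⁻¹).measurable
  unfold logRatio
  fun_prop

/-- Quotient of the two densities: the powers of `2π` cancel, and the determinants enter the
exponent through the logarithm. -/
theorem multivariateGaussian_eq_withDensity_exp {Q S : Matrix (Fin k) (Fin k) ℝ} (hQ : Q.PosDef)
    (hS : S.PosDef) (y : Euc k) :
    multivariateGaussian y S = (multivariateGaussian 0 Q).withDensity fun x =>
      ENNReal.ofReal (Real.exp (logRatio Q S y x)) := by
  have hm : ∀ (m : Euc k) (A : Matrix (Fin k) (Fin k) ℝ),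
      Measurable fun x => ENNReal.ofReal (gaussDensity m A x) := by
    intro m A
    have h1 := (continuous_quadForm (k := k) A⁻¹).measurable
    unfold gaussDensity
    fun_prop
  have hl : Measurable fun x => ENNReal.ofReal (Real.exp (logRatio Q S y x)) :=
    ((measurable_logRatio Q S).comp measurable_prodMk_left).exp.ennreal_ofReal
  rw [multivariateGaussian_eq_withDensity y hS, multivariateGaussian_eq_withDensity 0 hQ,
    ← withDensity_mul _ (hm _ _) hl]
  congr 1
  ext x
  have hQ' := hQ.det_pos
  have hS' := hS.det_pos
  rw [Pi.mul_apply, ← ENNReal.ofReal_mul (by unfold gaussDensity; positivity)]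
  congr 1
  have e1 : Real.exp (1 / 2 * Real.log (Q.det / S.det)) = √Q.det * (√S.det)⁻¹ := by
    rw [mul_comm, Real.exp_mul, Real.exp_log (div_pos hQ' hS'), ← Real.sqrt_eq_rpow,
      Real.sqrt_div hQ'.le, div_eq_mul_inv]
  have hq : √Q.det ≠ 0 := (Real.sqrt_pos.2 hQ').ne'
  have e2 : Real.exp (logRatio Q S y x) = √Q.det * (√S.det)⁻¹ *
      (Real.exp (-quadForm S⁻¹ (x - y) / 2) * Real.exp (quadForm Q⁻¹ x / 2)) := by
    rw [← e1, ← Real.exp_add, ← Real.exp_add, logRatio]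
    congr 1
    ring
  have e3 : Real.exp (-quadForm Q⁻¹ (x - 0) / 2) * Real.exp (quadForm Q⁻¹ x / 2) = 1 := by
    rw [← Real.exp_add, sub_zero]
    simp [neg_div]
  rw [e2]
  unfold gaussDensity
  calc _ = (2 * Real.pi) ^ (-(k : ℝ) / 2) * (√S.det)⁻¹ * Real.exp (-quadForm S⁻¹ (x - y) / 2)
        * ((√Q.det)⁻¹ * √Q.det) * (Real.exp (-quadForm Q⁻¹ (x - 0) / 2)
          * Real.exp (quadForm Q⁻¹ x / 2)) := by
        rw [inv_mul_cancel₀ hq, e3]; ring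
    _ = _ := by ring

end Density

end GrayWyner

namespace GrayWyner

/-! ### Gaussian noise channels and finiteness of the rate distortion functions. -/

section Noise

open Matrix
open scoped RealInnerProductSpace

variable {k : ℕ}

theorem multivariateGaussian_map_add (m : Euc k) (S : Matrix (Fin k) (Fin k) ℝ) :
    (multivariateGaussian 0 S).map (fun v => m + v) = multivariateGaussian m S := by
  unfold multivariateGaussian
  rw [Measure.map_map (by fun_prop) (by fun_prop)]
  congr 1
  ext1 x
  simp

theorem lintegral_enorm_sq_eq_sum (μ : Measure (Euc k)) :
    ∫⁻ x, ‖x‖ₑ ^ 2 ∂μ = ∑ i, ∫⁻ x, ENNReal.ofReal (x i ^ 2) ∂μ := by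
  rw [← lintegral_finsetSum _ (by fun_prop)]
  refine lintegral_congr fun x => ?_
  rw [← ENNReal.ofReal_sum_of_nonneg (fun i _ => sq_nonneg _), ← EuclideanSpace.real_norm_sq_eq,
    ← ofReal_norm, ENNReal.ofReal_pow (norm_nonneg _)]

theorem lintegral_enorm_sq_multivariateGaussian {S : Matrix (Fin k) (Fin k) ℝ}
    (hS : S.PosSemidef) :
    ∫⁻ x, ‖x‖ₑ ^ 2 ∂(multivariateGaussian (0 : Euc k) S) = ENNReal.ofReal S.trace := by
  rw [lintegral_enorm_sq_eq_sum, trace, ENNReal.ofReal_sum_of_nonneg fun i _ => show 0 ≤ S.diag i from hS.diag_nonneg]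
  refine Finset.sum_congr rfl fun i _ => ?_
  have hm : MemLp (fun x : Euc k => x i) 2 (multivariateGaussian (0 : Euc k) S) :=
    IsGaussian.memLp_dual _ (EuclideanSpace.proj i) 2 (by norm_num)
  have hmean : ∫ x : Euc k, x i ∂(multivariateGaussian (0 : Euc k) S) = 0 := by
    have := (EuclideanSpace.proj (𝕜 := ℝ) i).integral_comp_comm
      (IsGaussian.integrable_id (μ := multivariateGaussian (0 : Euc k) S))
    simpa using this
  rw [← ofReal_integral_eq_lintegral_ofReal hm.integrable_sq (ae_of_all _ fun x => sq_nonneg _),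
    diag_apply, ← variance_eval_multivariateGaussian (μ := 0) hS i, variance_eq_integral hm.1.aemeasurable,
    hmean]
  simp

/-- The channel adding Gaussian noise with covariance matrix `S`. -/
noncomputable def noiseChannel (S : Matrix (Fin k) (Fin k) ℝ) : Kernel (Euc k) (Euc k) :=
  (Kernel.id ×ₖ Kernel.const (Euc k) (multivariateGaussian 0 S)).map fun p => p.1 + p.2

instance (S : Matrix (Fin k) (Fin k) ℝ) : IsMarkovKernel (noiseChannel S) :=
  Kernel.IsMarkovKernel.map _ (by fun_prop)

theorem noiseChannel_apply (S : Matrix (Fin k) (Fin k) ℝ) (x : Euc k) :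
    noiseChannel S x = multivariateGaussian x S := by
  rw [noiseChannel, Kernel.map_apply _ (by fun_prop), Kernel.prod_apply, Kernel.id_apply,
    Kernel.const_apply, Measure.dirac_prod, Measure.map_map (by fun_prop) (by fun_prop)]
  exact multivariateGaussian_map_add x S

theorem mse_noiseChannel (ν : Measure (Euc k)) [IsProbabilityMeasure ν]
    {S : Matrix (Fin k) (Fin k) ℝ} (hS : S.PosSemidef) :
    mse Prod.fst Prod.snd (ν ⊗ₘ noiseChannel S) = ENNReal.ofReal S.trace := by
  unfold mse
  rw [Measure.lintegral_compProd (by fun_prop)]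
  have : ∀ x, ∫⁻ y, ‖x - y‖ₑ ^ 2 ∂(noiseChannel S x) = ENNReal.ofReal S.trace := by
    intro x
    rw [noiseChannel_apply, ← multivariateGaussian_map_add, lintegral_map (by fun_prop) (by fun_prop),
      ← lintegral_enorm_sq_multivariateGaussian hS]
    simp
  simp [this]

theorem klDiv_of_eq_withDensity_exp {α : Type*} [MeasurableSpace α] {γ ρ : Measure α}
    [IsProbabilityMeasure γ] [IsProbabilityMeasure ρ] {f : α → ℝ}
    (h : γ = ρ.withDensity fun x => ENNReal.ofReal (Real.exp (f x))) (hf : Measurable f)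
    (hfi : Integrable f γ) : klDiv γ ρ = ENNReal.ofReal (∫ x, f x ∂γ) := by
  subst h
  exact klDiv_withDensity_exp ρ hf hfi

theorem measurable_logRatio_right (Q S : Matrix (Fin k) (Fin k) ℝ) (y : Euc k) :
    Measurable (logRatio Q S y) := by
  have h1 := (continuous_quadForm (k := k) S⁻¹).measurable
  have h2 := (continuous_quadForm (k := k) Q⁻¹).measurable
  unfold logRatio
  fun_prop

/-- With equal covariances the quadratic terms in `x` cancel, so the log ratio is affine and only
the mean of the law matters. -/
theorem klDiv_multivariateGaussian_of_inv_eq_smul {S : Matrix (Fin k) (Fin k) ℝ} (hS : S.PosDef)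
    {c : ℝ} (hinv : S⁻¹ = c • 1) (y : Euc k) :
    klDiv (multivariateGaussian y S) (multivariateGaussian 0 S)
      = ENNReal.ofReal (c * ‖y‖ ^ 2 / 2) := by
  have hlr : ∀ x : Euc k, logRatio S S y x = c * ⟪y, x⟫ - c * ‖y‖ ^ 2 / 2 := by
    intro x
    have hq : ∀ u : Euc k, quadForm (c • (1 : Matrix (Fin k) (Fin k) ℝ)) u = c * ‖u‖ ^ 2 := by
      intro u
      rw [quadForm, smul_mulVec, one_mulVec, dotProduct_smul, EuclideanSpace.real_norm_sq_eq]
      simp [dotProduct, sq]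
    rw [logRatio, hinv, hq, hq, div_self hS.det_pos.ne', Real.log_one, norm_sub_sq_real,
      real_inner_comm]
    ring
  have hint : Integrable (fun x : Euc k => ⟪y, x⟫) (multivariateGaussian y S) :=
    IsGaussian.integrable_dual _ (innerSL ℝ y)
  have hmean : ∫ x : Euc k, ⟪y, x⟫ ∂(multivariateGaussian y S) = ‖y‖ ^ 2 := by
    have := (innerSL ℝ y).integral_comp_comm
      (IsGaussian.integrable_id (μ := multivariateGaussian y S))
    simpa using this
  rw [klDiv_of_eq_withDensity_exp (multivariateGaussian_eq_withDensity_exp hS hS y)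
    (measurable_logRatio_right S S y)]
  · simp only [hlr]
    rw [integral_sub (hint.const_mul _) (integrable_const _), integral_const_mul, hmean]
    congr 1
    simp
    ring
  · rw [show logRatio S S y = fun x => c * ⟪y, x⟫ - c * ‖y‖ ^ 2 / 2 from funext hlr]
    exact (hint.const_mul _).sub (integrable_const _)

theorem klDiv_multivariateGaussian_smul_one {σ : ℝ} (hσ : 0 < σ) (y : Euc k) :
    klDiv (multivariateGaussian y (σ • (1 : Matrix (Fin k) (Fin k) ℝ)))
      (multivariateGaussian 0 (σ • 1)) = ENNReal.ofReal (σ⁻¹ * ‖y‖ ^ 2 / 2) := by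
  refine klDiv_multivariateGaussian_of_inv_eq_smul (PosDef.one.smul hσ) ?_ y
  refine Matrix.inv_eq_left_inv ?_
  rw [smul_mul_smul_comm, inv_mul_cancel₀ hσ.ne']
  simp

/-- The true output law is replaced by `N(0, σ I)`. The bound is finite for every source with finite
second moment, which gives finite rate at every positive distortion. -/
theorem mutualInfo_noiseChannel_le (ν : Measure (Euc k)) [IsProbabilityMeasure ν] {σ : ℝ}
    (hσ : 0 < σ) :
    mutualInfo (ν ⊗ₘ noiseChannel (σ • (1 : Matrix (Fin k) (Fin k) ℝ)))
      ≤ ENNReal.ofReal (1 / (2 * σ)) * ∫⁻ x, ‖x‖ₑ ^ 2 ∂ν := by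
  refine (mutualInfo_le_klDiv _ (multivariateGaussian 0 (σ • 1))).trans ?_
  rw [Measure.fst_compProd, ← Measure.compProd_const, klDiv_compProd_eq_lintegral,
    ← lintegral_const_mul _ (by fun_prop)]
  refine lintegral_mono fun x => ?_
  rw [noiseChannel_apply, Kernel.const_apply, klDiv_multivariateGaussian_smul_one hσ, ← ofReal_norm,
    ← ENNReal.ofReal_pow (norm_nonneg _), ← ENNReal.ofReal_mul (by positivity)]
  refine le_of_eq ?_
  congr 1
  ring

theorem exists_noise_trace_le {D : ℝ≥0∞} (hD : 0 < D) :
    ∃ σ : ℝ, 0 < σ ∧ ENNReal.ofReal (σ • (1 : Matrix (Fin k) (Fin k) ℝ)).trace ≤ D := by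
  have hD' : 0 < (min D 1).toReal := ENNReal.toReal_pos (by simp [hD.ne']) (by simp)
  -- Truncation at `1` covers `D = ∞`, and `k + 1` avoids division by zero in dimension `0`.
  refine ⟨(min D 1).toReal / (k + 1), by positivity, ?_⟩
  refine le_trans ?_ (min_le_left D 1)
  refine ENNReal.ofReal_le_of_le_toReal ?_
  rw [trace_smul, trace_one, Fintype.card_fin, smul_eq_mul, div_mul_eq_mul_div, div_le_iff₀ (by positivity)]
  nlinarith

theorem rdf_lt_top (ν : Measure (Euc k)) [IsProbabilityMeasure ν] (hν : ∫⁻ x, ‖x‖ₑ ^ 2 ∂ν ≠ ∞)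
    {D : ℝ≥0∞} (hD : 0 < D) : rdf ν D < ∞ := by
  obtain ⟨σ, hσ, htr⟩ := exists_noise_trace_le (k := k) hD
  refine (rdf_le (κ := noiseChannel (σ • (1 : Matrix (Fin k) (Fin k) ℝ))) ?_).trans_lt
    ((mutualInfo_noiseChannel_le ν hσ).trans_lt (ENNReal.mul_lt_top ENNReal.ofReal_lt_top hν.lt_top))
  rwa [mse_noiseChannel ν (PosSemidef.one.smul hσ.le)]

theorem lintegral_lintegral_condDistrib_fst {𝕎 : Type*} [MeasurableSpace 𝕎]
    (μ : Measure (Euc k × 𝕎)) [IsProbabilityMeasure μ] :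
    ∫⁻ w, ∫⁻ x, ‖x‖ₑ ^ 2 ∂(condDistrib Prod.fst Prod.snd μ w) ∂(μ.map Prod.snd)
      = ∫⁻ p, ‖p.1‖ₑ ^ 2 ∂μ := by
  have : IsProbabilityMeasure (μ.map Prod.snd) :=
    Measure.isProbabilityMeasure_map measurable_snd.aemeasurable
  have hm : Measurable fun p : 𝕎 × Euc k => ‖p.2‖ₑ ^ 2 := by fun_prop
  rw [← Measure.lintegral_compProd (f := fun p : 𝕎 × Euc k => ‖p.2‖ₑ ^ 2) hm,
    compProd_map_condDistrib measurable_fst.aemeasurable,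
    lintegral_map hm (measurable_snd.prodMk measurable_fst)]

theorem lintegral_enorm_sq_ne_top {α : Type*} [MeasurableSpace α] {μ : Measure α} {f : α → Euc k}
    (hf : MemLp f 2 μ) : ∫⁻ a, ‖f a‖ₑ ^ 2 ∂μ ≠ ∞ := by
  have h := lintegral_rpow_enorm_lt_top_of_eLpNorm_lt_top (by norm_num) (by norm_num) hf.2
  simpa using h.ne

theorem ae_condDistrib_lintegral_ne_top {𝕎 : Type*} [MeasurableSpace 𝕎]
    {μ : Measure (Euc k × 𝕎)} [IsProbabilityMeasure μ] (hμ : MemLp Prod.fst 2 μ) :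
    ∀ᵐ w ∂(μ.map Prod.snd), ∫⁻ x, ‖x‖ₑ ^ 2 ∂(condDistrib Prod.fst Prod.snd μ w) ≠ ∞ := by
  have h := lintegral_lintegral_condDistrib_fst μ
  have h2 : ∫⁻ p, ‖p.1‖ₑ ^ 2 ∂μ ≠ ∞ := lintegral_enorm_sq_ne_top hμ
  rw [← h] at h2
  filter_upwards [ae_lt_top (Measurable.lintegral_kernel (by fun_prop)) h2] with w hw
  exact hw.ne

/-- One noise channel that ignores `w` serves all fibres; its average information is controlled by
the second moment of the source. -/
theorem condRDF_lt_top {𝕎 : Type*} [MeasurableSpace 𝕎]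
    (μ : Measure (Euc k × 𝕎)) [IsProbabilityMeasure μ] (hμ : MemLp Prod.fst 2 μ) {Δ : ℝ≥0∞}
    (hΔ : 0 < Δ) : condRDF μ Δ < ∞ := by
  have : IsProbabilityMeasure (μ.map Prod.snd) :=
    Measure.isProbabilityMeasure_map measurable_snd.aemeasurable
  obtain ⟨σ, hσ, htr⟩ := exists_noise_trace_le (k := k) hΔ
  let κ : Kernel (Euc k × 𝕎) (Euc k) :=
    (noiseChannel (σ • (1 : Matrix (Fin k) (Fin k) ℝ))).comap Prod.fst measurable_fst
  have hκ : ∀ w, κ.sectL w = noiseChannel (σ • (1 : Matrix (Fin k) (Fin k) ℝ)) := fun w => rfl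
  have hκM : IsMarkovKernel κ := inferInstanceAs (IsMarkovKernel (Kernel.comap _ _ _))
  refine lt_of_le_of_lt ((iInf₂_le κ hκM).trans (iInf_le _ ?_)) ?_
  · rw [mse_compProd]
    simp_rw [hκ]
    simp only [mse_noiseChannel _ (PosSemidef.one.smul hσ.le), lintegral_const, measure_univ, mul_one]
    exact htr
  · rw [condMutualInfo_compProd]
    simp_rw [hκ]
    refine (lintegral_mono fun w => mutualInfo_noiseChannel_le _ hσ).trans_lt ?_
    rw [lintegral_const_mul _ (Measurable.lintegral_kernel (by fun_prop)),
      lintegral_lintegral_condDistrib_fst]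
    exact ENNReal.mul_lt_top ENNReal.ofReal_lt_top (lintegral_enorm_sq_ne_top hμ).lt_top

end Noise

end GrayWyner

namespace GrayWyner

/-! ### Convex combinations of channels. -/

section Mixing

variable {S T S' : Type*} [MeasurableSpace S] [MeasurableSpace T] [MeasurableSpace S']

theorem isProbabilityMeasure_convex_comb {α : Type*} [MeasurableSpace α] {a b : ℝ≥0}
    (hab : a + b = 1) (μ₁ μ₂ : Measure α) [IsProbabilityMeasure μ₁] [IsProbabilityMeasure μ₂] :
    IsProbabilityMeasure (a • μ₁ + b • μ₂) := by
  constructor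
  rw [Measure.add_apply, Measure.coe_nnreal_smul_apply, Measure.coe_nnreal_smul_apply, measure_univ,
    measure_univ, mul_one, mul_one]
  exact_mod_cast hab

theorem fst_convex_comb {a b : ℝ≥0} (hab : a + b = 1) {π₁ π₂ : Measure (S × T)}
    (h : π₁.fst = π₂.fst) : (a • π₁ + b • π₂).fst = π₁.fst := by
  have : (a • π₁ + b • π₂).fst = a • π₁.fst + b • π₂.fst := by
    rw [Measure.fst, Measure.map_add _ _ measurable_fst, Measure.map_smul, Measure.map_smul]
    rfl
  rw [this, ← h, ← add_smul, hab, one_smul]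

/-- The mutual information is convex in the channel. -/
theorem mutualInfo_convex_comb_le [StandardBorelSpace S] [Nonempty S] [StandardBorelSpace T]
    [Nonempty T] {a b : ℝ≥0} (hab : a + b = 1)
    (π₁ π₂ : Measure (S × T)) [IsProbabilityMeasure π₁] [IsProbabilityMeasure π₂]
    (h : π₁.fst = π₂.fst) :
    mutualInfo (a • π₁ + b • π₂) ≤ a * mutualInfo π₁ + b * mutualInfo π₂ := by
  have h2 : (a • π₁ + b • π₂).snd = a • π₁.snd + b • π₂.snd := by
    rw [Measure.snd, Measure.map_add _ _ measurable_snd, Measure.map_smul, Measure.map_smul]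
    rfl
  unfold mutualInfo
  rw [fst_convex_comb hab h, h2]
  have h3 : π₁.fst.prod (a • π₁.snd + b • π₂.snd)
      = a • (π₁.fst.prod π₁.snd) + b • (π₂.fst.prod π₂.snd) := by
    rw [Measure.prod_add, ← h]
    simp only [Measure.prod_smul_right]
  rw [h3]
  exact klDiv_convex_comb_le a b _ _ _ _

theorem mse_convex_comb {k : ℕ} {α : Type*} [MeasurableSpace α] (a b : ℝ≥0) (μ₁ μ₂ : Measure α)
    (X Y : α → Euc k) :
    mse X Y (a • μ₁ + b • μ₂) = a * mse X Y μ₁ + b * mse X Y μ₂ := by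
  unfold mse
  rw [lintegral_add_measure, lintegral_smul_measure, lintegral_smul_measure]
  rfl

theorem exists_convex_coeff {I ε : ℝ≥0∞} (hI : I ≠ ∞) (hε : ε ≠ 0) :
    ∃ a b : ℝ≥0, a + b = 1 ∧ 0 < b ∧ b * I ≤ ε := by
  obtain ⟨n, hn, h⟩ := ENNReal.exists_nnreal_pos_mul_lt hI hε
  refine ⟨1 - min n 1, min n 1, tsub_add_cancel_of_le (min_le_right _ _), by positivity, ?_⟩
  refine le_trans ?_ h.le
  gcongr
  exact_mod_cast min_le_left _ _

/-- Near-optimal joint laws with strict inequality in the distortion constraint. -/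
theorem exists_mse_lt {k : ℕ} (ν : Measure (Euc k)) [IsProbabilityMeasure ν]
    (hν : ∫⁻ x, ‖x‖ₑ ^ 2 ∂ν ≠ ∞) {D : ℝ≥0∞} (hD : 0 < D) (hD' : D ≠ ∞) {ε : ℝ≥0∞} (hε : ε ≠ 0) :
    ∃ π : Measure (Euc k × Euc k), IsProbabilityMeasure π ∧ π.fst = ν ∧
      mse Prod.fst Prod.snd π < D ∧ mutualInfo π ≤ rdf ν D + ε := by
  have hε2 : ε / 2 ≠ 0 := by simp [hε]
  -- A channel nearly optimal at `D` is mixed with one of distortion at most `D / 2`. A positive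
  -- weight on the latter makes the distortion strictly smaller than `D`, and a small weight costs
  -- at most `ε / 2` of information.
  have h1 : rdf ν D < rdf ν D + ε / 2 := ENNReal.lt_add_right (rdf_lt_top ν hν hD).ne hε2
  have h2 : rdf ν (D / 2) < ∞ := rdf_lt_top ν hν (ENNReal.half_pos hD.ne')
  unfold rdf at h1 h2
  simp only [iInf_lt_iff] at h2
  obtain ⟨κ₂, hκ₂, hm₂, hI₂⟩ := h2
  rw [iInf_lt_iff] at h1
  obtain ⟨κ₁, h1⟩ := h1
  simp only [iInf_lt_iff] at h1
  obtain ⟨hκ₁, hm₁, hI₁⟩ := h1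
  obtain ⟨a, b, hab, hb, hbI⟩ := exists_convex_coeff hI₂.ne hε2
  have hfst : (ν ⊗ₘ κ₁).fst = (ν ⊗ₘ κ₂).fst := by simp
  refine ⟨a • (ν ⊗ₘ κ₁) + b • (ν ⊗ₘ κ₂), isProbabilityMeasure_convex_comb hab _ _, ?_, ?_, ?_⟩
  · rw [fst_convex_comb hab hfst]
    simp
  · rw [mse_convex_comb]
    have hab' : (a : ℝ≥0∞) + b = 1 := by exact_mod_cast hab
    calc a * mse Prod.fst Prod.snd (ν ⊗ₘ κ₁) + b * mse Prod.fst Prod.snd (ν ⊗ₘ κ₂)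
        ≤ a * D + b * (D / 2) := by gcongr
      _ < a * D + b * D := by
        refine ENNReal.add_lt_add_left (ENNReal.mul_ne_top (by simp) hD') ?_
        refine ENNReal.mul_lt_mul_right (by simpa using hb.ne') (by simp)
          (ENNReal.half_lt_self hD.ne' hD')
      _ = D := by rw [← add_mul, hab', one_mul]
  · refine (mutualInfo_convex_comb_le hab _ _ hfst).trans ?_
    have ha : (a : ℝ≥0∞) ≤ 1 := by
      have : a ≤ 1 := by rw [← hab]; exact le_self_add
      exact_mod_cast this
    calc _ ≤ 1 * (rdf ν D + ε / 2) + ε / 2 := by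
          gcongr
          exact hI₁.le
      _ = rdf ν D + ε := by rw [one_mul, add_assoc, ENNReal.add_halves]

theorem mutualInfo_compProd [StandardBorelSpace T] [Nonempty T] (μ : Measure S)
    [IsProbabilityMeasure μ] (κ : Kernel S T) [IsMarkovKernel κ] :
    mutualInfo (μ ⊗ₘ κ) = ∫⁻ x, klDiv (κ x) (μ ⊗ₘ κ).snd ∂μ := by
  rw [mutualInfo, Measure.fst_compProd, ← Measure.compProd_const, klDiv_compProd_eq_lintegral]
  rfl

theorem map_compProd_comap (μ : Measure S) [IsProbabilityMeasure μ] (κ : Kernel S' T)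
    [IsMarkovKernel κ] {f : S → S'} (hf : Measurable f) :
    (μ ⊗ₘ κ.comap f hf).map (Prod.map f id) = μ.map f ⊗ₘ κ := by
  have : IsProbabilityMeasure (μ.map f) := Measure.isProbabilityMeasure_map hf.aemeasurable
  refine Measure.ext_of_lintegral _ fun g hg => ?_
  rw [lintegral_map hg (hf.prodMap measurable_id), Measure.lintegral_compProd (by fun_prop),
    Measure.lintegral_compProd hg, lintegral_map (hg.lintegral_kernel_prod_right') hf]
  rfl

/-- A channel that sees its input only through `f` carries exactly the information about `f`: both
sides average the divergence of the same rows from the same output law. -/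
theorem mutualInfo_compProd_comap [StandardBorelSpace T] [Nonempty T] (μ : Measure S)
    [IsProbabilityMeasure μ] (κ : Kernel S' T) [IsMarkovKernel κ] {f : S → S'} (hf : Measurable f) :
    mutualInfo (μ ⊗ₘ κ.comap f hf) = mutualInfo (μ.map f ⊗ₘ κ) := by
  have : IsProbabilityMeasure (μ.map f) := Measure.isProbabilityMeasure_map hf.aemeasurable
  have hs : (μ ⊗ₘ κ.comap f hf).snd = (μ.map f ⊗ₘ κ).snd := by
    rw [← map_compProd_comap μ κ hf, Measure.snd, Measure.snd,
      Measure.map_map measurable_snd (hf.prodMap measurable_id)]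
    rfl
  rw [mutualInfo_compProd, mutualInfo_compProd, hs, lintegral_map _ hf]
  · rfl
  · exact measurable_klDiv_kernel κ (Kernel.const S' (μ.map f ⊗ₘ κ).snd)

end Mixing

/-! ### Rational laws with full support on a finite alphabet. -/

section Finite

/-- The probability measure on a finite type with weights proportional to `c j + 1`. -/
noncomputable def countMeasure {m : ℕ} (c : Fin m → ℕ) : Measure (Fin m) :=
  ∑ j, ((c j + 1 : ℝ≥0) / ∑ l, (c l + 1 : ℝ≥0)) • Measure.dirac j

theorem isProbabilityMeasure_sum_smul_dirac {m : ℕ} {q : Fin m → ℝ≥0} (hq : ∑ j, q j = 1) :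
    IsProbabilityMeasure (∑ j, q j • Measure.dirac j : Measure (Fin m)) := by
  constructor
  rw [Measure.finsetSum_apply]
  simp only [Measure.coe_nnreal_smul_apply, measure_univ, mul_one]
  exact_mod_cast hq

theorem sum_pos_count {m : ℕ} (c : Fin (m + 1) → ℕ) : 0 < ∑ l, (c l + 1 : ℝ≥0) :=
  Finset.sum_pos (fun _ _ => by positivity) Finset.univ_nonempty

theorem sum_count_div {m : ℕ} (c : Fin (m + 1) → ℕ) :
    ∑ j, ((c j + 1 : ℝ≥0) / ∑ l, (c l + 1 : ℝ≥0)) = 1 := by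
  rw [← Finset.sum_div, div_self (sum_pos_count c).ne']

instance {m : ℕ} (c : Fin (m + 1) → ℕ) : IsProbabilityMeasure (countMeasure c) :=
  isProbabilityMeasure_sum_smul_dirac (sum_count_div c)

theorem eq_sum_smul_dirac {m : ℕ} (ρ : Measure (Fin m)) [IsFiniteMeasure ρ] :
    ρ = ∑ j, (ρ {j}).toNNReal • Measure.dirac j := by
  refine Measure.ext_of_singleton fun i => ?_
  rw [Measure.finsetSum_apply]
  simp only [Measure.coe_nnreal_smul_apply, ENNReal.coe_toNNReal (measure_ne_top _ _)]
  rw [Finset.sum_eq_single i] <;> simp +contextual [Set.indicator]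

/-- Every law on a finite type is, up to a small mixing coefficient, of the form `countMeasure c`. -/
theorem exists_countMeasure_eq {m : ℕ} (M : ℕ) (ρ : Measure (Fin (m + 1))) [IsProbabilityMeasure ρ] :
    ∃ (c : Fin (m + 1) → ℕ) (R : Measure (Fin (m + 1))), IsProbabilityMeasure R ∧
      countMeasure c = ((M : ℝ≥0) / (M + (m + 1))) • ρ + ((m + 1 : ℝ≥0) / (M + (m + 1))) • R := by
  set q : Fin (m + 1) → ℝ≥0 := fun j => (ρ {j}).toNNReal with hq
  have hρ : ρ = ∑ j, q j • Measure.dirac j := eq_sum_smul_dirac ρ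
  have hq1 : ∑ j, q j = 1 := by
    have h : ρ Set.univ = 1 := measure_univ
    rw [hρ, Measure.finsetSum_apply] at h
    simp only [Measure.coe_nnreal_smul_apply, measure_univ, mul_one] at h
    exact_mod_cast h
  -- Rounding gives `c j + 1 ≥ M q j` and total weight at most `M + (m + 1)`. The normalized weights
  -- thus dominate `a q`, and the excess, of mass `b`, is normalized to give `R`. The coefficients
  -- depend only on `M`.
  let c : Fin (m + 1) → ℕ := fun j => ⌊(M : ℝ≥0) * q j⌋₊
  let a : ℝ≥0 := (M : ℝ≥0) / (M + (m + 1))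
  let b : ℝ≥0 := (m + 1 : ℝ≥0) / (M + (m + 1))
  let v : Fin (m + 1) → ℝ≥0 := fun j => (c j + 1 : ℝ≥0) / ∑ l, (c l + 1 : ℝ≥0)
  have hb : 0 < b := by positivity
  have hab : a + b = 1 := by
    rw [← add_div, div_self (by positivity)]
  have hs : ∑ l, (c l + 1 : ℝ≥0) ≤ M + (m + 1) := by
    rw [Finset.sum_add_distrib]
    refine add_le_add ?_ (by simp)
    calc ∑ l, (c l : ℝ≥0) ≤ ∑ l, (M : ℝ≥0) * q l :=
          Finset.sum_le_sum fun l _ => Nat.floor_le (by positivity)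
      _ = M := by rw [← Finset.mul_sum, hq1, mul_one]
  have hle : ∀ j, a * q j ≤ v j := by
    intro j
    calc a * q j = (M * q j) / (M + (m + 1)) := by simp only [a]; ring
      _ ≤ (c j + 1) / (M + (m + 1)) := by
        gcongr
        exact (Nat.lt_floor_add_one _).le
      _ ≤ v j := by
        refine div_le_div_of_nonneg_left (by positivity) (sum_pos_count c) hs
  have hr : ∑ j, (v j - a * q j) / b = 1 := by
    rw [← Finset.sum_div, div_eq_one_iff_eq hb.ne']
    have h1 : ∑ j, (v j - a * q j) + ∑ j, a * q j = b + ∑ j, a * q j := by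
      rw [← Finset.sum_add_distrib, ← Finset.mul_sum, hq1, mul_one, add_comm b, hab,
        ← sum_count_div c]
      exact Finset.sum_congr rfl fun j _ => tsub_add_cancel_of_le (hle j)
    exact add_right_cancel h1
  refine ⟨c, ∑ j, ((v j - a * q j) / b) • Measure.dirac j, isProbabilityMeasure_sum_smul_dirac hr,
    ?_⟩
  change ∑ j, v j • Measure.dirac j = a • ρ + b • _
  rw [hρ, Finset.smul_sum, Finset.smul_sum, ← Finset.sum_add_distrib]
  refine Finset.sum_congr rfl fun j _ => ?_
  rw [smul_smul, smul_smul, ← add_smul, mul_div_cancel₀ _ hb.ne', add_tsub_cancel_of_le (hle j)]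

/-- Laws on a finite type have bounded divergence from the uniform law. -/
theorem exists_klDiv_countMeasure_le (m : ℕ) : ∃ C : ℝ≥0, ∀ ρ : Measure (Fin (m + 1)),
    IsProbabilityMeasure ρ → klDiv ρ (countMeasure fun _ => 0) ≤ C := by
  have hu : ∀ j : Fin (m + 1), countMeasure (fun _ => 0) {j} = (m + 1 : ℝ≥0∞)⁻¹ := by
    intro j
    rw [countMeasure, Measure.finsetSum_apply]
    simp only [Measure.coe_nnreal_smul_apply]
    rw [Finset.sum_eq_single j]
    · simp
    · simp +contextual [Set.indicator]
    · simp
  -- The uniform law gives each point mass `1 / (m + 1)`, so every density with respect to it lies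
  -- in `[0, m + 1]`, where `klFun` is bounded.
  obtain ⟨B, hB⟩ := (isCompact_Icc (a := (0 : ℝ)) (b := m + 1)).bddAbove_image
    continuous_klFun.continuousOn
  refine ⟨B.toNNReal, fun ρ hρ => ?_⟩
  have hac : ρ ≪ countMeasure fun _ => 0 := by
    intro s hs
    have : s = ∅ := by
      by_contra hne
      obtain ⟨j, hj⟩ := Set.nonempty_iff_ne_empty.2 hne
      have h1 := measure_mono (μ := countMeasure fun _ : Fin (m + 1) => 0)
        (Set.singleton_subset_iff.2 hj)
      rw [hs, hu] at h1
      simp at h1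
    simp [this]
  rw [klDiv_eq_lintegral_klFun_of_ac hac]
  calc _ ≤ ∫⁻ _, (B.toNNReal : ℝ≥0∞) ∂(countMeasure fun _ : Fin (m + 1) => 0) := by
        refine lintegral_mono fun j => ?_
        refine ENNReal.ofReal_le_ofReal (hB ⟨_, ⟨ENNReal.toReal_nonneg, ?_⟩, rfl⟩)
        have h1 := Measure.setLIntegral_rnDeriv_le (μ := ρ) (ν := countMeasure fun _ => 0) {j}
        rw [lintegral_singleton, hu] at h1
        have h2 := h1.trans prob_le_one
        rw [← div_eq_mul_inv] at h2
        have h3 := ENNReal.div_le_iff_le_mul (by simp) (by simp) |>.1 h2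
        rw [one_mul] at h3
        exact ENNReal.toReal_le_of_le_ofReal (by positivity) (h3.trans (le_of_eq (by
          rw [ENNReal.ofReal_add (by positivity) (by positivity)]; simp)))
    _ = B.toNNReal := by simp

end Finite

end GrayWyner

namespace GrayWyner

/-! ### Quantization, and a countable family of near-optimal channels. -/

section Quantization

open Filter Topology

variable {k : ℕ}

/-- A dense sequence of `ℝᵏ` starting at `0`. -/
noncomputable def grid (k : ℕ) : ℕ → Euc k :=
  fun n => Nat.casesOn n 0 (Subtype.val ∘ TopologicalSpace.denseSeq (Set.univ : Set (Euc k)))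

/-- The first `N + 1` points of the grid. -/
noncomputable def gridPt (k : ℕ) {N : ℕ} (j : Fin (N + 1)) : Euc k := grid k j

@[fun_prop]
theorem measurable_gridPt {N : ℕ} : Measurable (gridPt k (N := N)) := measurable_of_countable _

/-- The index of the point nearest to `x` among the first `N + 1` points of the grid. -/
noncomputable def cellIdx (N : ℕ) (x : Euc k) : Fin (N + 1) :=
  Fin.ofNat (N + 1) (SimpleFunc.nearestPtInd (grid k) N x)

@[fun_prop]
theorem measurable_cellIdx (N : ℕ) : Measurable (cellIdx (k := k) N) :=
  (measurable_from_nat (f := Fin.ofNat (N + 1))).comp (SimpleFunc.measurable _)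

theorem tendsto_eLpNorm_grid {α : Type*} [MeasurableSpace α] {μ : Measure α} {f : α → Euc k}
    (hf : Measurable f) (h : MemLp f 2 μ) :
    Tendsto (fun N => eLpNorm (fun a => gridPt k (cellIdx N (f a)) - f a) 2 μ) atTop (𝓝 0) := by
  have := SimpleFunc.tendsto_approxOn_Lp_eLpNorm (p := 2) hf (s := Set.univ) (y₀ := 0)
    (Set.mem_univ _) (by norm_num) (μ := μ) (by simp) (by simpa using h.2)
  refine this.congr fun N => eLpNorm_congr_ae (ae_of_all _ fun a => ?_)
  have hlt : SimpleFunc.nearestPtInd (grid k) N (f a) < N + 1 :=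
    Nat.lt_succ_of_le (SimpleFunc.nearestPtInd_le _ _ _)
  simp only [gridPt, cellIdx, Fin.val_ofNat, Nat.mod_eq_of_lt hlt]
  -- `grid` is, by its definition, the sequence of points used by `SimpleFunc.approxOn`; the bound
  -- on the index makes the reduction modulo `N + 1` harmless.
  rfl

/-- The channel quantizing its input and then choosing a grid point according to `K`. -/
noncomputable def quantChannel (k N : ℕ) (K : Kernel (Fin (N + 1)) (Fin (N + 1))) :
    Kernel (Euc k) (Euc k) :=
  (K.comap (cellIdx N) (measurable_cellIdx N)).map (gridPt k)

variable {N : ℕ}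

instance (K : Kernel (Fin (N + 1)) (Fin (N + 1))) [IsMarkovKernel K] :
    IsMarkovKernel (quantChannel k N K) :=
  Kernel.IsMarkovKernel.map _ (measurable_of_countable _)

theorem compProd_quantChannel (ν : Measure (Euc k)) [IsProbabilityMeasure ν]
    (K : Kernel (Fin (N + 1)) (Fin (N + 1))) [IsMarkovKernel K] :
    ν ⊗ₘ quantChannel k N K = (ν ⊗ₘ K.comap (cellIdx N) (measurable_cellIdx N)).map
      (Prod.map id (gridPt k)) :=
  Measure.compProd_map (measurable_of_countable _)

theorem mutualInfo_quantChannel_le (ν : Measure (Euc k)) [IsProbabilityMeasure ν]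
    (K : Kernel (Fin (N + 1)) (Fin (N + 1))) [IsMarkovKernel K] :
    mutualInfo (ν ⊗ₘ quantChannel k N K) ≤ mutualInfo (ν.map (cellIdx N) ⊗ₘ K) := by
  rw [compProd_quantChannel, ← mutualInfo_compProd_comap ν K (measurable_cellIdx N)]
  exact mutualInfo_map_prodMap_le _ measurable_id (measurable_of_countable _)

/-- Minkowski's inequality: the quantization error of the input, plus the distance between the grid
points of input and output. -/
theorem mse_quantChannel_le (ν : Measure (Euc k)) [IsProbabilityMeasure ν]
    (K : Kernel (Fin (N + 1)) (Fin (N + 1))) [IsMarkovKernel K] :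
    mse Prod.fst Prod.snd (ν ⊗ₘ quantChannel k N K)
      ≤ (eLpNorm (fun x => gridPt k (cellIdx N x) - x) 2 ν
        + eLpNorm (fun p : Fin (N + 1) × Fin (N + 1) => gridPt k p.1 - gridPt k p.2) 2
          (ν.map (cellIdx N) ⊗ₘ K)) ^ 2 := by
  have hT := measurable_cellIdx (k := k) N
  have hg := measurable_gridPt (k := k) (N := N)
  rw [compProd_quantChannel, mse_map (by fun_prop) measurable_fst measurable_snd,
    mse_eq_eLpNorm_sq, ← map_compProd_comap ν K hT]
  gcongr
  rw [eLpNorm_map_measure (Measurable.aestronglyMeasurable (by fun_prop)) (by fun_prop)]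
  set π := ν ⊗ₘ K.comap (cellIdx N) hT with hπ
  have h1 : eLpNorm (fun x => gridPt k (cellIdx N x) - x) 2 ν
      = eLpNorm (fun p : Euc k × Fin (N + 1) => p.1 - gridPt k (cellIdx N p.1)) 2 π := by
    have hfst : π.map Prod.fst = ν := Measure.fst_compProd _ _
    conv_lhs => rw [← hfst]
    rw [eLpNorm_map_measure (Measurable.aestronglyMeasurable (by fun_prop)) (by fun_prop), ← eLpNorm_neg]
    congr 1
    ext1 p
    simp
  rw [h1]
  refine le_trans (le_of_eq ?_) (eLpNorm_add_le
    (f := fun p : Euc k × Fin (N + 1) => p.1 - gridPt k (cellIdx N p.1))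
    (g := fun p : Euc k × Fin (N + 1) => gridPt k (cellIdx N p.1) - gridPt k p.2)
    (Measurable.aestronglyMeasurable (by fun_prop)) (Measurable.aestronglyMeasurable (by fun_prop))
    (by norm_num))
  congr 1
  ext1 p
  simp

/-- Both components of a near-optimal pair are quantized, and `K` is the conditional kernel of the
quantized pair. Information drops by data processing; distortion converges in L², so the strict
inequality survives for some `N`. -/
theorem exists_quantChannel (ν : Measure (Euc k)) [IsProbabilityMeasure ν] (hν : MemLp id 2 ν)
    (π : Measure (Euc k × Euc k)) [IsProbabilityMeasure π] (hfst : π.fst = ν) {D : ℝ≥0∞}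
    (hD : mse Prod.fst Prod.snd π < D) :
    ∃ (N : ℕ) (K : Kernel (Fin (N + 1)) (Fin (N + 1))), IsMarkovKernel K ∧
      mse Prod.fst Prod.snd (ν ⊗ₘ quantChannel k N K) < D ∧
      mutualInfo (ν.map (cellIdx N) ⊗ₘ K) ≤ mutualInfo π := by
  have hX : MemLp Prod.fst 2 π := by
    rw [← hfst] at hν
    exact hν.comp_of_map measurable_fst.aemeasurable
  have hY : MemLp Prod.snd 2 π := memLp_of_mse_ne_top hX measurable_snd (hD.trans_le le_top).ne
  have h1 := tendsto_eLpNorm_grid measurable_fst hX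
  have h2 := tendsto_eLpNorm_grid measurable_snd hY
  -- The quantization error of the source is counted twice: once for the channel input and once
  -- inside the distance between the two grid points.
  have h3 : Tendsto (fun N => (eLpNorm (fun p : Euc k × Euc k => gridPt k (cellIdx N p.1) - p.1) 2 π
      + (eLpNorm (fun p : Euc k × Euc k => gridPt k (cellIdx N p.1) - p.1) 2 π
        + eLpNorm (Prod.fst - Prod.snd : Euc k × Euc k → Euc k) 2 π
        + eLpNorm (fun p : Euc k × Euc k => gridPt k (cellIdx N p.2) - p.2) 2 π)) ^ 2) atTop
      (𝓝 ((0 + (0 + eLpNorm (Prod.fst - Prod.snd : Euc k × Euc k → Euc k) 2 π + 0)) ^ 2)) :=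
    ((ENNReal.continuous_pow 2).tendsto _).comp (h1.add ((h1.add tendsto_const_nhds).add h2))
  rw [mse_eq_eLpNorm_sq] at hD
  simp only [zero_add, add_zero] at h3
  obtain ⟨N, hN⟩ := (h3.eventually (gt_mem_nhds hD)).exists
  have hT := measurable_cellIdx (k := k) N
  have hg := measurable_gridPt (k := k) (N := N)
  let π' := π.map (Prod.map (cellIdx N) (cellIdx N))
  have hπ' : IsProbabilityMeasure π' := Measure.isProbabilityMeasure_map (by fun_prop)
  have hfst' : π'.fst = ν.map (cellIdx N) := by
    rw [← hfst, Measure.fst, Measure.fst, Measure.map_map measurable_fst (by fun_prop),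
      Measure.map_map hT measurable_fst]
    rfl
  have hdis : ν.map (cellIdx N) ⊗ₘ π'.condKernel = π' := by
    rw [← hfst']
    exact Measure.disintegrate _ _
  refine ⟨N, π'.condKernel, inferInstance, ?_, ?_⟩
  · refine (mse_quantChannel_le ν π'.condKernel).trans_lt (lt_of_le_of_lt ?_ hN)
    rw [hdis]
    have e1 : eLpNorm (fun x => gridPt k (cellIdx N x) - x) 2 ν
        = eLpNorm (fun p : Euc k × Euc k => gridPt k (cellIdx N p.1) - p.1) 2 π := by
      rw [← hfst, Measure.fst, eLpNorm_map_measure (Measurable.aestronglyMeasurable (by fun_prop)) (by fun_prop)]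
      rfl
    rw [e1]
    gcongr
    rw [eLpNorm_map_measure (Measurable.aestronglyMeasurable (by fun_prop)) (by fun_prop)]
    have m1 : Measurable fun p : Euc k × Euc k => gridPt k (cellIdx N p.1) - p.1 := by fun_prop
    have m2 : Measurable fun p : Euc k × Euc k => gridPt k (cellIdx N p.2) - p.2 := by fun_prop
    have m3 : Measurable (Prod.fst - Prod.snd : Euc k × Euc k → Euc k) := by fun_prop
    refine le_trans (le_of_eq ?_) ((eLpNorm_sub_le (p := 2) (μ := π) (m1.add m3).aestronglyMeasurable
      m2.aestronglyMeasurable (by norm_num)).trans ?_)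
    · congr 1
      ext1 p
      simp only [Function.comp_apply, Prod.map_fst, Prod.map_snd, Pi.add_apply, Pi.sub_apply]
      abel
    · gcongr
      exact eLpNorm_add_le m1.aestronglyMeasurable m3.aestronglyMeasurable (by norm_num)
  · rw [hdis]
    exact mutualInfo_map_prodMap_le _ hT hT

theorem compProd_quantChannel_convex_comb (ν : Measure (Euc k)) [IsProbabilityMeasure ν]
    {L K R : Kernel (Fin (N + 1)) (Fin (N + 1))} [IsMarkovKernel L] [IsMarkovKernel K]
    [IsMarkovKernel R] {a b : ℝ≥0} (h : ∀ i, L i = a • K i + b • R i) :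
    ν ⊗ₘ quantChannel k N L = a • (ν ⊗ₘ quantChannel k N K) + b • (ν ⊗ₘ quantChannel k N R) := by
  have hg := measurable_gridPt (k := k) (N := N)
  refine Measure.ext_of_lintegral _ fun f hf => ?_
  rw [lintegral_add_measure, lintegral_smul_measure, lintegral_smul_measure,
    Measure.lintegral_compProd hf, Measure.lintegral_compProd hf, Measure.lintegral_compProd hf,
    ENNReal.smul_def, ENNReal.smul_def, smul_eq_mul, smul_eq_mul,
    ← lintegral_const_mul _ (by fun_prop), ← lintegral_const_mul _ (by fun_prop),
    ← lintegral_add_left (by fun_prop)]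
  refine lintegral_congr fun x => ?_
  have hfx : Measurable fun y => f (x, y) := by fun_prop
  simp only [quantChannel, Kernel.map_apply _ hg, Kernel.comap_apply]
  rw [lintegral_map hfx hg, lintegral_map hfx hg, lintegral_map hfx hg, h, lintegral_add_measure,
    lintegral_smul_measure, lintegral_smul_measure]
  rfl

/-- The channel on a finite alphabet with rows `countMeasure (c i)`. -/
noncomputable def countKernel {m : ℕ} (c : Fin (m + 1) → Fin (m + 1) → ℕ) :
    Kernel (Fin (m + 1)) (Fin (m + 1)) :=
  ⟨fun i => countMeasure (c i), measurable_of_countable _⟩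

instance {m : ℕ} (c : Fin (m + 1) → Fin (m + 1) → ℕ) : IsMarkovKernel (countKernel c) :=
  ⟨fun i => inferInstanceAs (IsProbabilityMeasure (countMeasure (c i)))⟩

/-- A bound independent of `K`, used to control the distortion caused by the remainder in rational
approximation. -/
theorem mse_quantChannel_le_sum (ν : Measure (Euc k)) [IsProbabilityMeasure ν]
    (K : Kernel (Fin (N + 1)) (Fin (N + 1))) [IsMarkovKernel K] :
    mse Prod.fst Prod.snd (ν ⊗ₘ quantChannel k N K)
      ≤ ∑ j : Fin (N + 1), ∫⁻ x, ‖x - gridPt k j‖ₑ ^ 2 ∂ν := by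
  have hg := measurable_gridPt (k := k) (N := N)
  rw [mse, Measure.lintegral_compProd (by fun_prop), ← lintegral_finsetSum _ (by fun_prop)]
  refine lintegral_mono fun x => ?_
  rw [quantChannel, Kernel.map_apply _ hg, lintegral_map (by fun_prop) hg]
  calc _ ≤ ∫⁻ _, ∑ j : Fin (N + 1), ‖x - gridPt k j‖ₑ ^ 2
        ∂(K.comap (cellIdx N) (measurable_cellIdx N) x) :=
        lintegral_mono fun j => Finset.single_le_sum (f := fun j : Fin (N + 1) =>
          ‖x - gridPt k j‖ₑ ^ 2) (fun _ _ => zero_le) (Finset.mem_univ j)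
    _ = _ := by simp

/-- Each rational row is the given row mixed with an uncontrolled remainder, of the same small
weight for all rows. By convexity the remainder costs at most its weight times a constant, in
distortion and in information. -/
theorem exists_countKernel (ν : Measure (Euc k)) [IsProbabilityMeasure ν] (hν : MemLp id 2 ν)
    (K : Kernel (Fin (N + 1)) (Fin (N + 1))) [IsMarkovKernel K] {D : ℝ≥0∞}
    (hD : mse Prod.fst Prod.snd (ν ⊗ₘ quantChannel k N K) < D) {ε : ℝ≥0∞} (hε : ε ≠ 0) :
    ∃ c, mse Prod.fst Prod.snd (ν ⊗ₘ quantChannel k N (countKernel c)) ≤ D ∧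
      mutualInfo (ν ⊗ₘ quantChannel k N (countKernel c))
        ≤ mutualInfo (ν.map (cellIdx N) ⊗ₘ K) + ε := by
  have hT := measurable_cellIdx (k := k) N
  have : IsProbabilityMeasure (ν.map (cellIdx N)) :=
    Measure.isProbabilityMeasure_map hT.aemeasurable
  obtain ⟨C, hC⟩ := exists_klDiv_countMeasure_le N
  set B : ℝ≥0∞ := ∑ j : Fin (N + 1), ∫⁻ x, ‖x - gridPt k j‖ₑ ^ 2 ∂ν with hB
  have hBtop : B ≠ ∞ := by
    refine (ENNReal.sum_lt_top.2 fun j _ => ?_).ne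
    exact (lintegral_enorm_sq_ne_top (hν.sub (memLp_const (gridPt k j)))).lt_top
  have hgap : D - mse Prod.fst Prod.snd (ν ⊗ₘ quantChannel k N K) ≠ 0 := (tsub_pos_of_lt hD).ne'
  -- The weight of the remainder must fit the slack in the distortion constraint (`b₁`) and the
  -- information budget `ε` (`b₂`); `M` is taken large enough for both.
  obtain ⟨b₁, hb₁, h₁⟩ := ENNReal.exists_nnreal_pos_mul_lt hBtop hgap
  obtain ⟨b₂, hb₂, h₂⟩ := ENNReal.exists_nnreal_pos_mul_lt (a := (C : ℝ≥0∞)) (by simp) hε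
  have hmin : 0 < min b₁ b₂ := lt_min hb₁ hb₂
  obtain ⟨M, hM⟩ := exists_nat_ge ((N + 1 : ℝ≥0) / min b₁ b₂)
  have hb : (N + 1 : ℝ≥0) / (M + (N + 1)) ≤ min b₁ b₂ := by
    rw [div_le_iff₀ hmin] at hM
    rw [div_le_iff₀ (by positivity), mul_comm]
    refine hM.trans ?_
    gcongr
    exact le_self_add
  choose c R hR hc using fun i => exists_countMeasure_eq M (K i)
  set a : ℝ≥0 := (M : ℝ≥0) / (M + (N + 1)) with ha
  set b : ℝ≥0 := (N + 1 : ℝ≥0) / (M + (N + 1)) with hbdef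
  have hab : a + b = 1 := by
    rw [ha, hbdef, ← add_div, div_self (by positivity)]
  have ha1 : (a : ℝ≥0∞) ≤ 1 := by
    have : a ≤ 1 := by rw [← hab]; exact le_self_add
    exact_mod_cast this
  let R' : Kernel (Fin (N + 1)) (Fin (N + 1)) := ⟨R, measurable_of_countable _⟩
  have hR' : IsMarkovKernel R' := ⟨hR⟩
  have hmix := compProd_quantChannel_convex_comb ν (L := countKernel c) (K := K) (R := R') hc
  refine ⟨c, ?_, ?_⟩
  · rw [hmix, mse_convex_comb]
    calc _ ≤ 1 * mse Prod.fst Prod.snd (ν ⊗ₘ quantChannel k N K) + b₁ * B := by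
          gcongr
          · exact hb.trans (min_le_left _ _)
          · exact mse_quantChannel_le_sum ν R'
      _ ≤ mse Prod.fst Prod.snd (ν ⊗ₘ quantChannel k N K)
          + (D - mse Prod.fst Prod.snd (ν ⊗ₘ quantChannel k N K)) := by
        rw [one_mul]
        gcongr
      _ = D := add_tsub_cancel_of_le hD.le
  · rw [hmix]
    refine (mutualInfo_convex_comb_le hab _ _ (by simp)).trans ?_
    calc _ ≤ 1 * mutualInfo (ν.map (cellIdx N) ⊗ₘ K) + b₂ * C := by
          gcongr
          · exact mutualInfo_quantChannel_le ν K
          · exact hb.trans (min_le_right _ _)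
          · refine (mutualInfo_quantChannel_le ν R').trans
              ((mutualInfo_le_klDiv _ (countMeasure fun _ => 0)).trans ?_)
            rw [Measure.fst_compProd, ← Measure.compProd_const, klDiv_compProd_eq_lintegral]
            calc _ ≤ ∫⁻ _, (C : ℝ≥0∞) ∂(ν.map (cellIdx N)) :=
                  lintegral_mono fun i => hC (R i) (hR i)
              _ = C := by simp
      _ ≤ _ := by
        rw [one_mul]
        gcongr

/-- A countable family of channels, optimal for every source with finite second moment. -/
noncomputable def channelFamily (k : ℕ) :
    Option (Σ N : ℕ, Fin (N + 1) → Fin (N + 1) → ℕ) → Kernel (Euc k) (Euc k)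
  | none => Kernel.id
  | some c => quantChannel k c.1 (countKernel c.2)

instance (i : Option (Σ N : ℕ, Fin (N + 1) → Fin (N + 1) → ℕ)) :
    IsMarkovKernel (channelFamily k i) := by
  cases i <;> (unfold channelFamily; infer_instance)

theorem mse_compProd_id (ν : Measure (Euc k)) [IsProbabilityMeasure ν] :
    mse Prod.fst Prod.snd (ν ⊗ₘ Kernel.id) = 0 := by
  rw [mse, Measure.lintegral_compProd (by fun_prop)]
  simp [Kernel.id_apply]

/-- Zero distortion forces `Y = X` almost surely. This is the only case not reached by quantizers,
and the reason for the identity in the countable family. -/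
theorem compProd_eq_of_mse_eq_zero (ν : Measure (Euc k)) [IsProbabilityMeasure ν]
    (κ : Kernel (Euc k) (Euc k)) [IsMarkovKernel κ]
    (h : mse Prod.fst Prod.snd (ν ⊗ₘ κ) = 0) : ν ⊗ₘ κ = ν ⊗ₘ Kernel.id := by
  rw [mse, lintegral_eq_zero_iff (by fun_prop)] at h
  have h1 : (fun p : Euc k × Euc k => (p.1, p.2)) =ᵐ[ν ⊗ₘ κ] fun p => (p.1, p.1) := by
    filter_upwards [h] with p hp
    have : p.1 = p.2 := by simpa [sub_eq_zero] using hp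
    rw [this]
  have h2 : (ν ⊗ₘ κ).map (fun p : Euc k × Euc k => (p.1, p.2))
      = (ν ⊗ₘ κ).map fun p => (p.1, p.1) := Measure.map_congr h1
  rw [Measure.compProd_id]
  have h3 : (ν ⊗ₘ κ).map (fun p : Euc k × Euc k => (p.1, p.2)) = ν ⊗ₘ κ := Measure.map_id
  rw [← h3, h2]
  have h4 : (ν ⊗ₘ κ).map Prod.fst = ν := Measure.fst_compProd _ _
  conv_rhs => rw [← h4]
  rw [Measure.map_map (by fun_prop) measurable_fst]
  rfl

/-- For `D > 0`, slack in the distortion is gained by mixing and then spent on quantization and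
rounding. The family depends neither on `ν` nor on `D`, so it can serve all fibres at once. -/
theorem exists_channelFamily (ν : Measure (Euc k)) [IsProbabilityMeasure ν]
    (hν : ∫⁻ x, ‖x‖ₑ ^ 2 ∂ν ≠ ∞) {D : ℝ≥0∞} (hD : D ≠ ∞) {ε : ℝ≥0∞} (hε : ε ≠ 0) :
    ∃ i, mse Prod.fst Prod.snd (ν ⊗ₘ channelFamily k i) ≤ D ∧
      mutualInfo (ν ⊗ₘ channelFamily k i) ≤ rdf ν D + ε := by
  rcases eq_or_ne D 0 with rfl | hD0
  · refine ⟨none, (mse_compProd_id ν).le, le_add_right ?_⟩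
    refine le_iInf fun κ => le_iInf fun hκ => le_iInf fun h => ?_
    rw [compProd_eq_of_mse_eq_zero ν κ (nonpos_iff_eq_zero.1 h)]
    rfl
  · have hε2 : ε / 2 ≠ 0 := by simp [hε]
    have hν2 : MemLp id 2 ν := by
      refine ⟨aestronglyMeasurable_id, ?_⟩
      rw [eLpNorm_lt_top_iff_lintegral_rpow_enorm_lt_top (by norm_num) (by norm_num)]
      simpa using hν.lt_top
    obtain ⟨π, hπ, hfst, hm, hI⟩ := exists_mse_lt ν hν (pos_iff_ne_zero.2 hD0) hD hε2
    obtain ⟨N, K, hK, hm2, hI2⟩ := exists_quantChannel ν hν2 π hfst hm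
    obtain ⟨c, hm3, hI3⟩ := exists_countKernel ν hν2 K hm2 hε2
    refine ⟨some ⟨N, c⟩, hm3, hI3.trans ?_⟩
    calc _ ≤ rdf ν D + ε / 2 + ε / 2 := by gcongr; exact hI2.trans hI
      _ = rdf ν D + ε := by rw [add_assoc, ENNReal.add_halves]

end Quantization

/-! ### Measurable selection of channels and the profile formula. -/

section Selection

variable {𝕎 : Type*} [MeasurableSpace 𝕎] {k : ℕ}

theorem measurable_mutualInfo_compProd (lam : Kernel 𝕎 (Euc k)) [IsMarkovKernel lam]
    (κ : Kernel (Euc k) (Euc k)) [IsMarkovKernel κ] :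
    Measurable fun w => mutualInfo (lam w ⊗ₘ κ) := by
  have h := measurable_mutualInfo_kernel (lam ⊗ₖ κ.prodMkLeft 𝕎)
  simp_rw [Kernel.compProd_apply_eq_compProd_sectR] at h
  exact h

theorem measurable_mse_compProd (lam : Kernel 𝕎 (Euc k)) [IsMarkovKernel lam]
    (κ : Kernel (Euc k) (Euc k)) [IsMarkovKernel κ] :
    Measurable fun w => mse Prod.fst Prod.snd (lam w ⊗ₘ κ) := by
  have : Measurable fun w => ∫⁻ p, ‖p.1 - p.2‖ₑ ^ 2 ∂((lam ⊗ₖ κ.prodMkLeft 𝕎) w) :=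
    Measurable.lintegral_kernel (by fun_prop)
  simp_rw [Kernel.compProd_apply_eq_compProd_sectR] at this
  exact this

/-- A distortion profile `δ` can be realized by a test channel, at the cost of the averaged rate
distortion functions of the conditional laws. -/
theorem condRDF_le_lintegral_rdf (μ : Measure (Euc k × 𝕎)) [IsProbabilityMeasure μ]
    (hμ : MemLp Prod.fst 2 μ) {Δ : ℝ≥0∞} (hΔ : Δ ≠ ∞) {δ : 𝕎 → ℝ≥0∞} (hδ : Measurable δ)
    (h : ∫⁻ w, δ w ∂(μ.map Prod.snd) ≤ Δ) :
    condRDF μ Δ ≤ ∫⁻ w, rdf (condDistrib Prod.fst Prod.snd μ w) (δ w) ∂(μ.map Prod.snd) := by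
  classical
  have hsnd : IsProbabilityMeasure (μ.map Prod.snd) :=
    Measure.isProbabilityMeasure_map measurable_snd.aemeasurable
  set lam := condDistrib Prod.fst Prod.snd μ with hlam
  obtain ⟨enum, henum⟩ := exists_surjective_nat (Option (Σ N : ℕ, Fin (N + 1) → Fin (N + 1) → ℕ))
  let D : ℕ → 𝕎 → ℝ≥0∞ := fun n w => mse Prod.fst Prod.snd (lam w ⊗ₘ channelFamily k (enum n))
  let I : ℕ → 𝕎 → ℝ≥0∞ := fun n w => mutualInfo (lam w ⊗ₘ channelFamily k (enum n))
  have hD : ∀ n, Measurable (D n) := fun n => measurable_mse_compProd lam _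
  have hI : ∀ n, Measurable (I n) := fun n => measurable_mutualInfo_compProd lam _
  -- A countable infimum, hence a measurable stand-in for `w ↦ rdf (lam w) (δ w)`, whose
  -- measurability is never used.
  let g : 𝕎 → ℝ≥0∞ := fun w => ⨅ n, if D n w ≤ δ w then I n w else ∞
  have hg : Measurable g := Measurable.iInf fun n =>
    Measurable.ite (measurableSet_le (hD n) hδ) (hI n) measurable_const
  have hgood : ∀ᵐ w ∂(μ.map Prod.snd), δ w ≠ ∞ ∧ ∫⁻ x, ‖x‖ₑ ^ 2 ∂(lam w) ≠ ∞ := by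
    filter_upwards [ae_lt_top hδ (h.trans_lt hΔ.lt_top).ne, ae_condDistrib_lintegral_ne_top hμ]
      with w h1 h2 using ⟨h1.ne, h2⟩
  have hgle : ∀ᵐ w ∂(μ.map Prod.snd), g w ≤ rdf (lam w) (δ w) := by
    filter_upwards [hgood] with w hw
    refine ENNReal.le_of_forall_pos_le_add fun ε hε _ => ?_
    obtain ⟨i, h1, h2⟩ := exists_channelFamily (lam w) hw.2 hw.1 (ε := ε) (by simpa using hε.ne')
    obtain ⟨n, rfl⟩ := henum i
    refine (iInf_le _ n).trans ?_
    rw [if_pos h1]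
    exact h2
  refine ENNReal.le_of_forall_pos_le_add fun ε hε _ => ?_
  let S : ℕ → Set 𝕎 := fun n => {w | D n w ≤ δ w ∧ I n w ≤ g w + ε}
  have hS : ∀ n, MeasurableSet (S n) := fun n =>
    (measurableSet_le (hD n) hδ).inter (measurableSet_le (hI n) (hg.add_const _))
  -- The second alternative, relevant only on a null set, makes the least index defined everywhere.
  have hex : ∀ w, ∃ n, w ∈ S n ∨ w ∉ ⋃ m, S m := by
    intro w
    by_cases hw : w ∈ ⋃ m, S m
    · obtain ⟨m, hm⟩ := Set.mem_iUnion.1 hw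
      exact ⟨m, Or.inl hm⟩
    · exact ⟨0, Or.inr hw⟩
  let sel : 𝕎 → ℕ := fun w => Nat.find (hex w)
  have hsel : Measurable sel :=
    measurable_find hex fun n => (hS n).union (MeasurableSet.iUnion hS).compl
  have hsel' : ∀ᵐ w ∂(μ.map Prod.snd), w ∈ S (sel w) := by
    filter_upwards [hgood] with w hw
    have hmem : w ∈ ⋃ m, S m := by
      -- If `g w = ∞`, the information constraint is void and any index meeting the distortion
      -- constraint will do.
      rcases eq_or_ne (g w) ∞ with htop | htop
      · obtain ⟨i, h1, -⟩ := exists_channelFamily (lam w) hw.2 hw.1 (ε := 1) one_ne_zero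
        obtain ⟨n, rfl⟩ := henum i
        exact Set.mem_iUnion.2 ⟨n, h1, by simp [htop]⟩
      · have hlt : g w < g w + ε := ENNReal.lt_add_right htop (by simpa using hε.ne')
        obtain ⟨n, hn⟩ := iInf_lt_iff.1 hlt
        by_cases hc : D n w ≤ δ w
        · rw [if_pos hc] at hn
          exact Set.mem_iUnion.2 ⟨n, hc, hn.le⟩
        · rw [if_neg hc] at hn
          exact absurd hn (by simp)
    exact (Nat.find_spec (hex w)).resolve_right fun hn => hn hmem
  -- With the index as an extra input from a countable space, joint measurability reduces to that of
  -- each channel.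
  let fam : Kernel (ℕ × Euc k) (Euc k) :=
    ⟨fun p => channelFamily k (enum p.1) p.2,
      measurable_from_prod_countable_right fun n => (channelFamily k (enum n)).measurable⟩
  have hfam : IsMarkovKernel fam := ⟨fun p =>
    inferInstanceAs (IsProbabilityMeasure (channelFamily k (enum p.1) p.2))⟩
  have hmeas : Measurable fun p : Euc k × 𝕎 => (sel p.2, p.1) := by fun_prop
  let κ : Kernel (Euc k × 𝕎) (Euc k) := fam.comap (fun p => (sel p.2, p.1)) hmeas
  have hκM : IsMarkovKernel κ := inferInstanceAs (IsMarkovKernel (Kernel.comap _ _ _))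
  have hκ : ∀ w, κ.sectL w = channelFamily k (enum (sel w)) := fun w => rfl
  refine ((iInf₂_le κ hκM).trans (iInf_le _ ?_)).trans ?_
  · rw [mse_compProd]
    refine le_trans (lintegral_mono_ae ?_) h
    filter_upwards [hsel'] with w hw
    rw [hκ]
    exact hw.1
  · rw [condMutualInfo_compProd]
    calc _ ≤ ∫⁻ w, (g w + ε) ∂(μ.map Prod.snd) := by
          refine lintegral_mono_ae ?_
          filter_upwards [hsel'] with w hw
          rw [hκ]
          exact hw.2
      _ = ∫⁻ w, g w ∂(μ.map Prod.snd) + ε := by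
          rw [lintegral_add_left hg]
          simp
      _ ≤ _ := by
          gcongr 1
          exact lintegral_mono_ae hgle

theorem condRDF_eq_iInf_lintegral_rdf (μ : Measure (Euc k × 𝕎)) [IsProbabilityMeasure μ]
    (hμ : MemLp Prod.fst 2 μ) {Δ : ℝ≥0∞} (hΔ : Δ ≠ ∞) :
    condRDF μ Δ = ⨅ (δ : 𝕎 → ℝ≥0∞) (_ : Measurable δ) (_ : ∫⁻ w, δ w ∂(μ.map Prod.snd) ≤ Δ),
      ∫⁻ w, rdf (condDistrib Prod.fst Prod.snd μ w) (δ w) ∂(μ.map Prod.snd) :=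
  le_antisymm
    (le_iInf fun _ => le_iInf fun hδ => le_iInf fun h => condRDF_le_lintegral_rdf μ hμ hΔ hδ h)
    (iInf_lintegral_rdf_le_condRDF μ Δ)

end Selection

end GrayWyner

namespace GrayWyner

/-! ### Second moment matrices. -/

section Moments

open Matrix
open scoped RealInnerProductSpace

variable {Ω : Type*} [MeasurableSpace Ω] {P : Measure Ω} {k : ℕ}

/-- The matrix of second moments of a random vector. -/
noncomputable def momentMat (U : Ω → Euc k) (P : Measure Ω) : Matrix (Fin k) (Fin k) ℝ :=
  Matrix.of fun i j => ∫ ω, U ω i * U ω j ∂P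

theorem memLp_eval {U : Ω → Euc k} (hU : MemLp U 2 P) (i : Fin k) : MemLp (fun ω => U ω i) 2 P :=
  (EuclideanSpace.proj (𝕜 := ℝ) i).comp_memLp' hU

theorem integrable_eval_mul {U : Ω → Euc k} (hU : MemLp U 2 P) (i j : Fin k) :
    Integrable (fun ω => U ω i * U ω j) P :=
  (memLp_eval hU i).integrable_mul (memLp_eval hU j)

theorem integrable_quadForm {U : Ω → Euc k} (hU : MemLp U 2 P) (A : Matrix (Fin k) (Fin k) ℝ) :
    Integrable (fun ω => quadForm A (U ω)) P := by
  simp_rw [quadForm_eq_sum]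
  exact integrable_finsetSum _ fun i _ => integrable_finsetSum _ fun j _ =>
    (integrable_eval_mul hU i j).const_mul _

theorem momentMat_isSymm (U : Ω → Euc k) : (momentMat U P)ᵀ = momentMat U P := by
  ext i j
  simp only [momentMat, transpose_apply, of_apply, mul_comm]

theorem integral_quadForm {U : Ω → Euc k} (hU : MemLp U 2 P) (A : Matrix (Fin k) (Fin k) ℝ) :
    ∫ ω, quadForm A (U ω) ∂P = (A * momentMat U P).trace := by
  have h : ∀ i j, Integrable (fun ω => A i j * (U ω i * U ω j)) P := fun i j =>
    (integrable_eval_mul hU i j).const_mul _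
  simp only [quadForm_eq_sum, trace, diag_apply, mul_apply]
  rw [integral_finsetSum]
  · refine Finset.sum_congr rfl fun i _ => ?_
    rw [integral_finsetSum]
    · refine Finset.sum_congr rfl fun j _ => ?_
      rw [integral_const_mul, ← momentMat_isSymm]
      rfl
    · exact fun j _ => h i j
  · exact fun i _ => integrable_finsetSum _ fun j _ => h i j

theorem quadForm_vecMulVec (v u : Euc k) :
    quadForm (vecMulVec v.ofLp v.ofLp) u = ⟪v, u⟫ ^ 2 := by
  rw [quadForm_eq_sum, PiLp.inner_apply, sq, Finset.sum_mul_sum]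
  refine Finset.sum_congr rfl fun i _ => Finset.sum_congr rfl fun j _ => ?_
  simp [vecMulVec_apply]
  ring

theorem integral_inner_sq {U : Ω → Euc k} (hU : MemLp U 2 P) (v : Euc k) :
    ∫ ω, ⟪v, U ω⟫ ^ 2 ∂P = quadForm (momentMat U P) v := by
  simp_rw [← quadForm_vecMulVec]
  rw [integral_quadForm hU, vecMulVec_mul, trace_vecMulVec, ← mulVec_transpose, momentMat_isSymm,
    quadForm]

theorem posSemidef_iff_quadForm {A : Matrix (Fin k) (Fin k) ℝ} (hA : Aᵀ = A) :
    A.PosSemidef ↔ ∀ v : Euc k, 0 ≤ quadForm A v := by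
  rw [posSemidef_iff_dotProduct_mulVec]
  refine ⟨fun h v => by simpa [quadForm] using h.2 v.ofLp, fun h => ⟨?_, fun v => ?_⟩⟩
  · rwa [IsHermitian, conjTranspose_eq_transpose_of_trivial]
  · simpa [quadForm] using h (WithLp.toLp 2 v)

theorem posSemidef_momentMat {U : Ω → Euc k} (hU : MemLp U 2 P) : (momentMat U P).PosSemidef := by
  rw [posSemidef_iff_quadForm (momentMat_isSymm U)]
  intro v
  rw [← integral_inner_sq hU]
  exact integral_nonneg fun ω => sq_nonneg _

theorem quadForm_one (u : Euc k) : quadForm 1 u = ‖u‖ ^ 2 := by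
  rw [quadForm, one_mulVec, EuclideanSpace.real_norm_sq_eq]
  simp [dotProduct, sq]

theorem mse_eq_ofReal_trace {X Y : Ω → Euc k} (h : MemLp (fun ω => X ω - Y ω) 2 P) :
    mse X Y P = ENNReal.ofReal (momentMat (fun ω => X ω - Y ω) P).trace := by
  rw [← one_mul (momentMat _ P), ← integral_quadForm h, ofReal_integral_eq_lintegral_ofReal
    (integrable_quadForm h 1) (ae_of_all _ fun ω => by
      simp only [quadForm_one, Pi.zero_apply]; positivity), mse]
  refine lintegral_congr fun ω => ?_
  rw [quadForm_one, ← ofReal_norm, ENNReal.ofReal_pow (norm_nonneg _)]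

theorem momentMat_map {α : Type*} [MeasurableSpace α] {μ : Measure α} {f : α → Ω} {U : Ω → Euc k}
    (hf : AEMeasurable f μ) (hU : AEStronglyMeasurable U (μ.map f)) :
    momentMat U (μ.map f) = momentMat (U ∘ f) μ := by
  ext i j
  simp only [momentMat, of_apply]
  rw [integral_map hf]
  · rfl
  · have h : ∀ i, AEStronglyMeasurable (fun ω => U ω i) (μ.map f) := fun i =>
      (EuclideanSpace.proj (𝕜 := ℝ) i).continuous.comp_aestronglyMeasurable hU
    exact (h i).mul (h j)

theorem memLp_id_multivariateGaussian (S : Matrix (Fin k) (Fin k) ℝ) (m : Euc k) :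
    MemLp id 2 (multivariateGaussian m S) :=
  IsGaussian.memLp_two_id

theorem momentMat_multivariateGaussian {S : Matrix (Fin k) (Fin k) ℝ} (hS : S.PosSemidef) :
    momentMat id (multivariateGaussian (0 : Euc k) S) = S := by
  ext i j
  have hmean : ∀ i, ∫ x : Euc k, x i ∂(multivariateGaussian (0 : Euc k) S) = 0 := by
    intro i
    have := (EuclideanSpace.proj (𝕜 := ℝ) i).integral_comp_comm
      (IsGaussian.integrable_id (μ := multivariateGaussian (0 : Euc k) S))
    simpa using this
  rw [← covariance_eval_multivariateGaussian (μ := 0) hS i j, covariance, hmean, hmean]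
  simp [momentMat]

theorem momentMat_of_map_eq {U : Ω → Euc k} (hU : AEMeasurable U P) {S : Matrix (Fin k) (Fin k) ℝ}
    (hS : S.PosSemidef) (h : P.map U = multivariateGaussian 0 S) : momentMat U P = S := by
  rw [← momentMat_multivariateGaussian hS, ← h, momentMat_map hU aestronglyMeasurable_id]
  rfl

theorem memLp_of_map_eq {U : Ω → Euc k} (hU : AEMeasurable U P) {S : Matrix (Fin k) (Fin k) ℝ}
    (h : P.map U = multivariateGaussian 0 S) : MemLp U 2 P := by
  have := memLp_id_multivariateGaussian S (0 : Euc k)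
  rw [← h] at this
  exact this.comp_of_map hU

end Moments

/-! ### Gaussian rates and the Gaussian converse. -/

section Rate

open Matrix

variable {k : ℕ}

/-- Truncating the determinant ratio at `1` is the truncation of its logarithm at `0` that
`ENNReal.ofReal` already performs. -/
theorem gaussianRate_eq {Q S : Matrix (Fin k) (Fin k) ℝ} (hQ : Q.PosDef) (hS : S.PosDef) :
    gaussianRate Q S = ENNReal.ofReal (1 / 2 * Real.log (Q.det / S.det)) := by
  unfold gaussianRate
  rcases le_total 1 (Q.det / S.det) with h | h
  · rw [max_eq_right h]
  · rw [max_eq_left h, Real.log_one, mul_zero, ENNReal.ofReal_zero, eq_comm, ENNReal.ofReal_eq_zero]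
    have := Real.log_nonpos (div_pos hQ.det_pos hS.det_pos).le h
    linarith

theorem integrable_logRatio {α : Type*} [MeasurableSpace α] {π : Measure α}
    [IsProbabilityMeasure π] {X Y : α → Euc k} (hX : MemLp X 2 π)
    (hE : MemLp (fun a => X a - Y a) 2 π) (Q S : Matrix (Fin k) (Fin k) ℝ) :
    Integrable (fun a => logRatio Q S (Y a) (X a)) π :=
  ((integrable_const _).sub ((integrable_quadForm hE _).const_mul _)).add
    ((integrable_quadForm hX _).const_mul _)

/-- Only second moments of the source and of the error enter, so this applies to joint laws that are
not Gaussian. -/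
theorem integral_logRatio {α : Type*} [MeasurableSpace α] {π : Measure α}
    [IsProbabilityMeasure π] {X Y : α → Euc k} (hX : MemLp X 2 π)
    (hE : MemLp (fun a => X a - Y a) 2 π) (Q S : Matrix (Fin k) (Fin k) ℝ) :
    ∫ a, logRatio Q S (Y a) (X a) ∂π = 1 / 2 * Real.log (Q.det / S.det)
      - 1 / 2 * (S⁻¹ * momentMat (fun a => X a - Y a) π).trace
      + 1 / 2 * (Q⁻¹ * momentMat X π).trace := by
  have h1 := (integrable_quadForm hE S⁻¹).const_mul (1 / 2)
  have h2 := (integrable_quadForm hX Q⁻¹).const_mul (1 / 2)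
  have h3 : Integrable (fun a => 1 / 2 * Real.log (Q.det / S.det)
      - 1 / 2 * quadForm S⁻¹ (X a - Y a)) π := (integrable_const _).sub h1
  simp only [logRatio]
  rw [integral_add h3 h2, integral_sub (integrable_const _) h1,
    integral_const, integral_const_mul, integral_const_mul, integral_quadForm hE,
    integral_quadForm hX]
  simp

theorem measurable_logRatio_comp {α : Type*} [MeasurableSpace α] (Q S : Matrix (Fin k) (Fin k) ℝ)
    {f g : α → Euc k} (hf : Measurable f) (hg : Measurable g) :
    Measurable fun a => logRatio Q S (f a) (g a) := by
  have h1 := (continuous_quadForm (k := k) S⁻¹).measurable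
  have h2 := (continuous_quadForm (k := k) Q⁻¹).measurable
  unfold logRatio
  fun_prop

/-- Holds for every input law `ρ`: each row of the channel has a density with respect to the fixed
reference `N(0, Q)`. -/
theorem compProd_noiseChannel_eq_withDensity (ρ : Measure (Euc k)) [IsProbabilityMeasure ρ]
    {Q S : Matrix (Fin k) (Fin k) ℝ} (hQ : Q.PosDef) (hS : S.PosDef) :
    ρ ⊗ₘ noiseChannel S = (ρ.prod (multivariateGaussian 0 Q)).withDensity fun p =>
      ENNReal.ofReal (Real.exp (logRatio Q S p.1 p.2)) := by
  have hm : Measurable fun p : Euc k × Euc k => ENNReal.ofReal (Real.exp (logRatio Q S p.1 p.2)) :=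
    (measurable_logRatio Q S).exp.ennreal_ofReal
  refine Measure.ext_of_lintegral _ fun g hg => ?_
  rw [lintegral_withDensity_eq_lintegral_mul _ hm hg, lintegral_prod _ (hm.mul hg).aemeasurable,
    Measure.lintegral_compProd hg]
  refine lintegral_congr fun y => ?_
  have hm' : Measurable fun x : Euc k => ENNReal.ofReal (Real.exp (logRatio Q S y x)) :=
    (measurable_logRatio_right Q S y).exp.ennreal_ofReal
  rw [noiseChannel_apply, multivariateGaussian_eq_withDensity_exp hQ hS y,
    lintegral_withDensity_eq_lintegral_mul _ hm' (by fun_prop)]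
  rfl

theorem mutualInfo_swap {S T : Type*} [MeasurableSpace S] [MeasurableSpace T]
    (π : Measure (S × T)) [IsFiniteMeasure π] : mutualInfo (π.map Prod.swap) = mutualInfo π := by
  unfold mutualInfo
  have h1 : (π.map Prod.swap).fst = π.snd := by
    rw [Measure.fst, Measure.map_map measurable_fst measurable_swap]
    rfl
  have h2 : (π.map Prod.swap).snd = π.fst := by
    rw [Measure.snd, Measure.map_map measurable_snd measurable_swap]
    rfl
  rw [h1, h2, ← Measure.prod_swap]
  exact klDiv_map_equiv π _ MeasurableEquiv.prodComm

/-- The mutual information between `Y` and `Y` plus independent Gaussian noise, if the sum is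
Gaussian. -/
theorem mutualInfo_compProd_noiseChannel (ρ : Measure (Euc k)) [IsProbabilityMeasure ρ]
    {Q S : Matrix (Fin k) (Fin k) ℝ} (hQ : Q.PosDef) (hS : S.PosDef)
    (hsnd : (ρ ⊗ₘ noiseChannel S).snd = multivariateGaussian 0 Q) :
    mutualInfo (ρ ⊗ₘ noiseChannel S) = gaussianRate Q S := by
  have hX : MemLp Prod.snd 2 (ρ ⊗ₘ noiseChannel S) :=
    memLp_of_map_eq measurable_snd.aemeasurable hsnd
  have hnoise : (ρ ⊗ₘ noiseChannel S).map (fun p => p.2 - p.1) = multivariateGaussian 0 S := by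
    refine Measure.ext_of_lintegral _ fun g hg => ?_
    rw [lintegral_map hg (by fun_prop), Measure.lintegral_compProd (by fun_prop)]
    have : ∀ y, ∫⁻ x, g (x - y) ∂(noiseChannel S y) = ∫⁻ x, g x ∂(multivariateGaussian 0 S) := by
      intro y
      rw [noiseChannel_apply, ← multivariateGaussian_map_add, lintegral_map (by fun_prop)
        (by fun_prop)]
      simp
    simp [this]
  have hE : MemLp (fun p => p.2 - p.1) 2 (ρ ⊗ₘ noiseChannel S) :=
    memLp_of_map_eq (by fun_prop) hnoise
  have e1 : momentMat (fun p => p.2 - p.1) (ρ ⊗ₘ noiseChannel S) = S :=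
    momentMat_of_map_eq (by fun_prop) hS.posSemidef hnoise
  have e2 : momentMat Prod.snd (ρ ⊗ₘ noiseChannel S) = Q :=
    momentMat_of_map_eq measurable_snd.aemeasurable hQ.posSemidef hsnd
  have hinv : ∀ {A : Matrix (Fin k) (Fin k) ℝ}, A.PosDef → A⁻¹ * A = 1 := fun h =>
    Matrix.nonsing_inv_mul _ (isUnit_iff_ne_zero.2 h.det_pos.ne')
  -- The information is the mean of the log ratio; the two trace terms are traces of the identity
  -- and cancel.
  rw [mutualInfo, hsnd, Measure.fst_compProd, klDiv_of_eq_withDensity_exp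
    (compProd_noiseChannel_eq_withDensity ρ hQ hS) (measurable_logRatio Q S)
    (integrable_logRatio hX hE Q S), gaussianRate_eq hQ hS, integral_logRatio hX hE, e1, e2,
    hinv hQ, hinv hS]
  simp

theorem quadForm_sub (A B : Matrix (Fin k) (Fin k) ℝ) (v : Euc k) :
    quadForm (A - B) v = quadForm A v - quadForm B v := by
  simp [quadForm, sub_mulVec, dotProduct_sub]

open scoped RealInnerProductSpace in
/-- The error of the conditional mean has a smaller second moment matrix. -/
theorem posSemidef_momentMat_sub {Ω T : Type*} [MeasurableSpace Ω] [MeasurableSpace T]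
    {P : Measure Ω} [IsProbabilityMeasure P] {X : Ω → Euc k} {V : Ω → T} (hX : MemLp X 2 P)
    (hV : Measurable V) :
    (momentMat X P - momentMat (fun ω => X ω - condMean X V P ω) P).PosSemidef := by
  have hM : MemLp (condMean X V P) 2 P := hX.condExp one_le_two
  have hE : MemLp (fun ω => X ω - condMean X V P ω) 2 P := hX.sub hM
  rw [posSemidef_iff_quadForm (by rw [transpose_sub, momentMat_isSymm, momentMat_isSymm])]
  intro v
  rw [quadForm_sub, ← integral_inner_sq hX, ← integral_inner_sq hE, sub_nonneg]
  let e : Euc 1 := EuclideanSpace.single 0 1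
  have he : ‖e‖ = 1 := by simp [e]
  -- Projecting on a direction `v` reduces the matrix inequality to the minimality of a
  -- one-dimensional conditional mean, compared with the constant `0`.
  let L : Euc k →L[ℝ] Euc 1 := (innerSL ℝ v).smulRight e
  have hL : ∀ x, L x = ⟪v, x⟫ • e := fun x => rfl
  have hmse : ∀ {U : Ω → Euc k}, MemLp U 2 P →
      ∫⁻ ω, ‖L (U ω)‖ₑ ^ 2 ∂P = ENNReal.ofReal (∫ ω, ⟪v, U ω⟫ ^ 2 ∂P) := by
    intro U hU
    have hi : Integrable (fun ω => ⟪v, U ω⟫ ^ 2) P := ((innerSL ℝ v).comp_memLp' hU).integrable_sq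
    rw [ofReal_integral_eq_lintegral_ofReal hi (ae_of_all _ fun ω => sq_nonneg _)]
    refine lintegral_congr fun ω => ?_
    rw [hL, ← ofReal_norm, norm_smul, he, mul_one, ← ENNReal.ofReal_pow (norm_nonneg _),
      Real.norm_eq_abs, sq_abs]
  have hLX : MemLp (fun ω => L (X ω)) 2 P := L.comp_memLp' hX
  have h1 : condMean (fun ω => L (X ω)) V P =ᵐ[P] fun ω => L (condMean X V P ω) :=
    (L.comp_condExp_comm (hX.integrable one_le_two)).symm
  have h2 := mse_condMean_le hLX hV (Z := fun _ => 0) measurable_const stronglyMeasurable_const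
  rw [mse_congr (ae_eq_refl _) h1] at h2
  unfold mse at h2
  simp only [← map_sub, sub_zero] at h2
  rwa [hmse hE, hmse hX, ENNReal.ofReal_le_ofReal_iff (integral_nonneg fun _ => sq_nonneg _)] at h2

/-- A Gaussian upper bound on the test channel: every joint law with Gaussian source dominates the
rate of some error covariance matrix. -/
theorem exists_gaussianRate_le {Q : Matrix (Fin k) (Fin k) ℝ} (hQ : Q.PosDef)
    (π : Measure (Euc k × Euc k)) [IsProbabilityMeasure π]
    (hfst : π.fst = multivariateGaussian 0 Q) {D : ℝ≥0} (hD : mse Prod.fst Prod.snd π ≤ D)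
    (hI : mutualInfo π ≠ ∞) :
    ∃ QE : Matrix (Fin k) (Fin k) ℝ, QE.PosDef ∧ (Q - QE).PosSemidef ∧ QE.trace ≤ D ∧
      gaussianRate Q QE ≤ mutualInfo π := by
  have hX : MemLp Prod.fst 2 π := memLp_of_map_eq measurable_fst.aemeasurable hfst
  obtain ⟨h, hh, hM⟩ := exists_condMean_eq_comp (P := π) (Prod.fst : Euc k × Euc k → Euc k) Prod.snd
  have hM2 : MemLp (condMean (Prod.fst : Euc k × Euc k → Euc k) Prod.snd π) 2 π :=
    hX.condExp one_le_two
  rw [hM] at hM2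
  have hE2 : MemLp (fun p : Euc k × Euc k => p.1 - h p.2) 2 π := hX.sub hM2
  set E := momentMat (fun p : Euc k × Euc k => p.1 - h p.2) π with hE
  have hEpsd : E.PosSemidef := posSemidef_momentMat hE2
  have hmX : momentMat Prod.fst π = Q :=
    momentMat_of_map_eq measurable_fst.aemeasurable hQ.posSemidef hfst
  have hdiff : (Q - E).PosSemidef := by
    have := posSemidef_momentMat_sub hX (V := (Prod.snd : Euc k × Euc k → Euc k)) measurable_snd
    rwa [hmX, hM] at this
  have htr : E.trace ≤ D := by
    have h1 := mse_condMean_le hX (V := (Prod.snd : Euc k × Euc k → Euc k)) measurable_snd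
      (Z := Prod.snd) measurable_snd (comap_measurable _).stronglyMeasurable
    rw [hM, mse_eq_ofReal_trace (by exact hE2)] at h1
    have h2 := h1.trans hD
    rw [ENNReal.ofReal_le_coe] at h2
    exact h2
  have hinv : ∀ {A : Matrix (Fin k) (Fin k) ℝ}, A.PosDef → A⁻¹ * A = 1 := fun h =>
    Matrix.nonsing_inv_mul _ (isUnit_iff_ne_zero.2 h.det_pos.ne')
  -- The error covariance `E` of the conditional mean may still be singular here, so it is
  -- regularized. The trial function is the log density of `N(h y, S)` relative to `N(0, Q)`; its
  -- exponential has integral `1` under the product of the marginals.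
  have key : ∀ ε : ℝ, 0 < ε → 1 / 2 * Real.log (Q.det / (E + ε • 1).det) ≤ (mutualInfo π).toReal := by
    intro ε hε
    set S := E + ε • (1 : Matrix (Fin k) (Fin k) ℝ) with hSdef
    have hS : S.PosDef := PosDef.posSemidef_add hEpsd (PosDef.one.smul hε)
    have hm : Measurable fun p : Euc k × Euc k => logRatio Q S (h p.2) p.1 :=
      measurable_logRatio_comp Q S (hh.comp measurable_snd) measurable_fst
    have hdv := ofReal_integral_le_klDiv π (π.fst.prod π.snd) hm (integrable_logRatio hX hE2 Q S) ?_
    · rw [integral_logRatio hX hE2, hmX, hinv hQ, ← hE] at hdv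
      -- The trace terms then leave the surplus `½ ε tr S⁻¹ ≥ 0`, which is dropped.
      have hSE : S⁻¹ * E = 1 - ε • S⁻¹ := by
        rw [← hinv hS, hSdef, mul_add]
        simp
      have htr2 : 0 ≤ S⁻¹.trace := hS.inv.posSemidef.trace_nonneg
      rw [hSE, trace_sub, trace_smul, smul_eq_mul] at hdv
      have h3 := (ENNReal.ofReal_le_iff_le_toReal hI).1 hdv
      have h4 : 0 ≤ ε * S⁻¹.trace := by positivity
      linarith
    · have hm' : Measurable fun p : Euc k × Euc k =>
          ENNReal.ofReal (Real.exp (logRatio Q S (h p.2) p.1)) := hm.exp.ennreal_ofReal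
      rw [lintegral_prod_symm _ hm'.aemeasurable, hfst]
      have : ∀ y, ∫⁻ x, ENNReal.ofReal (Real.exp (logRatio Q S (h y) x))
          ∂(multivariateGaussian 0 Q) = 1 := by
        intro y
        rw [← setLIntegral_univ, ← withDensity_apply _ MeasurableSet.univ,
          ← multivariateGaussian_eq_withDensity_exp hQ hS, measure_univ]
      simp [this]
  have hcont : Filter.Tendsto (fun ε : ℝ => (E + ε • (1 : Matrix (Fin k) (Fin k) ℝ)).det)
      (nhdsWithin 0 (Set.Ioi 0)) (nhds E.det) := by
    have : Continuous fun ε : ℝ => (E + ε • (1 : Matrix (Fin k) (Fin k) ℝ)).det := by fun_prop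
    have h := this.tendsto 0
    simp only [zero_smul, add_zero] at h
    exact h.mono_left nhdsWithin_le_nhds
  -- In exponential form the limit `ε → 0` needs no logarithm of `det E`; as `det Q > 0`, it forces
  -- `det E > 0`.
  have key2 : Q.det ≤ Real.exp (2 * (mutualInfo π).toReal) * E.det := by
    refine ge_of_tendsto (hcont.const_mul _) ?_
    filter_upwards [self_mem_nhdsWithin] with ε hε
    have hS : (E + ε • (1 : Matrix (Fin k) (Fin k) ℝ)).PosDef :=
      PosDef.posSemidef_add hEpsd (PosDef.one.smul hε)
    have h1 := key ε hε
    rw [← div_le_iff₀ hS.det_pos, ← Real.log_le_iff_le_exp (div_pos hQ.det_pos hS.det_pos)]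
    linarith
  have hEdet : 0 < E.det := by
    by_contra hneg
    have := mul_nonpos_of_nonneg_of_nonpos (Real.exp_pos (2 * (mutualInfo π).toReal)).le
      (not_lt.1 hneg)
    linarith [hQ.det_pos]
  have hEpd : E.PosDef := hEpsd.posDef_iff_det_ne_zero.2 hEdet.ne'
  refine ⟨E, hEpd, hdiff, htr, ?_⟩
  rw [gaussianRate_eq hQ hEpd]
  refine ENNReal.ofReal_le_of_le_toReal ?_
  rw [← div_le_iff₀ hEdet, ← Real.log_le_iff_le_exp (div_pos hQ.det_pos hEdet)] at key2
  linarith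

end Rate

end GrayWyner

namespace GrayWyner

/-! ### Cross-covariances, Gaussian independence and linear regression. -/

section CrossCov

open Matrix
open scoped RealInnerProductSpace

variable {Ω : Type*} [MeasurableSpace Ω] {P : Measure Ω} [IsProbabilityMeasure P] {k l m : ℕ}

omit [IsProbabilityMeasure P] in
theorem crossCov_transpose (U : Ω → Euc k) (V : Ω → Euc l) :
    (crossCov U V P)ᵀ = crossCov V U P := by
  ext i j
  simp only [crossCov, transpose_apply, of_apply]
  exact covariance_comm _ _

theorem crossCov_add_left {U U' : Ω → Euc k} {V : Ω → Euc l} (hU : MemLp U 2 P) (hU' : MemLp U' 2 P)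
    (hV : MemLp V 2 P) :
    crossCov (fun ω => U ω + U' ω) V P = crossCov U V P + crossCov U' V P := by
  ext i j
  exact covariance_add_left (memLp_eval hU i) (memLp_eval hU' i) (memLp_eval hV j)

theorem crossCov_sub_left {U U' : Ω → Euc k} {V : Ω → Euc l} (hU : MemLp U 2 P) (hU' : MemLp U' 2 P)
    (hV : MemLp V 2 P) :
    crossCov (fun ω => U ω - U' ω) V P = crossCov U V P - crossCov U' V P := by
  ext i j
  exact covariance_sub_left (memLp_eval hU i) (memLp_eval hU' i) (memLp_eval hV j)

theorem crossCov_add_right {U : Ω → Euc k} {V V' : Ω → Euc l} (hU : MemLp U 2 P) (hV : MemLp V 2 P)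
    (hV' : MemLp V' 2 P) :
    crossCov U (fun ω => V ω + V' ω) P = crossCov U V P + crossCov U V' P := by
  ext i j
  exact covariance_add_right (memLp_eval hU i) (memLp_eval hV j) (memLp_eval hV' j)

theorem crossCov_const_left (c : Euc k) (V : Ω → Euc l) : crossCov (fun _ => c) V P = 0 := by
  ext i j
  exact covariance_const_left _

theorem memLp_toEuclideanLin (A : Matrix (Fin l) (Fin k) ℝ) {U : Ω → Euc k} (hU : MemLp U 2 P) :
    MemLp (fun ω => toEuclideanLin A (U ω)) 2 P :=
  (LinearMap.toContinuousLinearMap (toEuclideanLin A : Euc k →ₗ[ℝ] Euc l)).comp_memLp' hU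

theorem crossCov_toEuclideanLin_left (A : Matrix (Fin m) (Fin k) ℝ) {U : Ω → Euc k} {V : Ω → Euc l}
    (hU : MemLp U 2 P) (hV : MemLp V 2 P) :
    crossCov (fun ω => toEuclideanLin A (U ω)) V P = A * crossCov U V P := by
  ext i j
  have h : (fun ω => toEuclideanLin A (U ω) i) = fun ω => ∑ a, A i a * U ω a := by
    ext ω
    simp [toLpLin_apply, mulVec, dotProduct]
  simp only [crossCov, of_apply, mul_apply, h]
  rw [covariance_fun_sum_left (fun a => (memLp_eval hU a).const_mul _) (memLp_eval hV j)]
  simp [covariance_const_mul_left]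

theorem crossCov_toEuclideanLin_right (A : Matrix (Fin m) (Fin l) ℝ) {U : Ω → Euc k}
    {V : Ω → Euc l} (hU : MemLp U 2 P) (hV : MemLp V 2 P) :
    crossCov U (fun ω => toEuclideanLin A (V ω)) P = crossCov U V P * Aᵀ := by
  rw [← crossCov_transpose, crossCov_toEuclideanLin_left A hV hU, transpose_mul, crossCov_transpose]

theorem crossCov_eq_zero_of_indepFun {U : Ω → Euc k} {V : Ω → Euc l} (hU : MemLp U 2 P)
    (hV : MemLp V 2 P) (h : IndepFun U V P) : crossCov U V P = 0 := by
  ext i j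
  have h' : IndepFun (fun ω => U ω i) (fun ω => V ω j) P :=
    h.comp (φ := fun x : Euc k => x i) (ψ := fun x : Euc l => x j) (by fun_prop) (by fun_prop)
  exact h'.covariance_eq_zero (memLp_eval hU i) (memLp_eval hV j)

theorem covMat_eq_momentMat {U : Ω → Euc k} (hU : Integrable U P) (h0 : ∫ ω, U ω ∂P = 0) :
    covMat U P = momentMat U P := by
  have hz : ∀ i, ∫ ω, U ω i ∂P = 0 := by
    intro i
    have := (EuclideanSpace.proj (𝕜 := ℝ) i).integral_comp_comm hU
    rw [h0] at this
    simpa using this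
  ext i j
  simp [covMat, crossCov, momentMat, covariance, hz]

theorem variance_inner {U : Ω → Euc k} (hU : MemLp U 2 P) (t : Euc k) :
    Var[fun ω => ⟪t, U ω⟫; P] = quadForm (covMat U P) t := by
  have h : (fun ω => ⟪t, U ω⟫) = fun ω => ∑ a, t a * U ω a := by
    ext ω
    simp [PiLp.inner_apply, mul_comm]
  have hm : ∀ a, MemLp (fun ω => t a * U ω a) 2 P := fun a => (memLp_eval hU a).const_mul _
  rw [h, ← covariance_self (memLp_finsetSum _ fun a _ => hm a).1.aemeasurable,
    covariance_fun_sum_fun_sum hm hm, quadForm_eq_sum]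
  refine Finset.sum_congr rfl fun i _ => Finset.sum_congr rfl fun j _ => ?_
  rw [covariance_const_mul_left, covariance_const_mul_right, covMat, crossCov, of_apply]
  ring

theorem posSemidef_covMat {U : Ω → Euc k} (hU : MemLp U 2 P) : (covMat U P).PosSemidef := by
  rw [posSemidef_iff_quadForm (show (covMat U P)ᵀ = covMat U P from crossCov_transpose U U)]
  intro v
  rw [← variance_inner hU]
  exact variance_nonneg _ _

/-- A centred Gaussian vector has the Gaussian law given by its covariance matrix. -/
theorem map_eq_multivariateGaussian {U : Ω → Euc k} (hU : HasGaussianLaw U P)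
    (h0 : ∫ ω, U ω ∂P = 0) : P.map U = multivariateGaussian 0 (covMat U P) := by
  refine Measure.ext_of_charFun ?_
  ext t
  have h1 : ∫ ω, ⟪t, U ω⟫ ∂P = 0 := by
    rw [integral_inner hU.integrable, h0, inner_zero_right]
  rw [hU.charFun_map_eq, charFun_multivariateGaussian (posSemidef_covMat hU.memLp_two), h1,
    variance_inner hU.memLp_two]
  simp [quadForm]

/-- A component uncorrelated with the two others is independent of them. -/
theorem indepFun_of_crossCov_eq_zero {U : Ω → Euc k} {Y : Ω → Euc l} {W : Ω → Euc m}
    (h : HasGaussianLaw (fun ω => (U ω, Y ω, W ω)) P) (hY : crossCov U Y P = 0)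
    (hW : crossCov U W P = 0) : IndepFun U (fun ω => (Y ω, W ω)) P := by
  have hU2 := h.fst.memLp_two
  have hY2 := h.snd.fst.memLp_two
  have hW2 := h.snd.snd.memLp_two
  have key : ∀ {d : ℕ} {Z : Ω → Euc d}, MemLp Z 2 P → crossCov U Z P = 0 →
      ∀ (L₁ : StrongDual ℝ (Euc k)) (L₂ : StrongDual ℝ (Euc d)), cov[L₁ ∘ U, L₂ ∘ Z; P] = 0 := by
    intro d Z hZ2 hZ L₁ L₂
    have hexp : ∀ {d : ℕ} (L : StrongDual ℝ (Euc d)) (Z : Ω → Euc d),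
        L ∘ Z = fun ω => ∑ a, L (EuclideanSpace.single a 1) * Z ω a := by
      intro d L Z
      ext ω
      have hz : Z ω = ∑ a, Z ω a • EuclideanSpace.single a (1 : ℝ) := by
        ext i
        simp [Finset.sum_apply, Pi.single_apply]
      conv_lhs => rw [Function.comp_apply, hz, map_sum]
      simp [mul_comm]
    rw [hexp L₁ U, hexp L₂ Z, covariance_fun_sum_fun_sum
      (fun a => (memLp_eval hU2 a).const_mul _) (fun a => (memLp_eval hZ2 a).const_mul _)]
    refine Finset.sum_eq_zero fun i _ => Finset.sum_eq_zero fun j _ => ?_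
    have : cov[fun ω => U ω i, fun ω => Z ω j; P] = 0 := congrFun (congrFun hZ i) j
    rw [covariance_const_mul_left, covariance_const_mul_right, this]
    simp
  refine h.indepFun_of_covariance_strongDual fun L₁ L₂ => ?_
  have hsplit : L₂ ∘ (fun ω => (Y ω, W ω))
      = (L₂ ∘L (.inl ℝ (Euc l) (Euc m))) ∘ Y + (L₂ ∘L (.inr ℝ (Euc l) (Euc m))) ∘ W := by
    ext ω
    simp [← map_add]
  rw [hsplit, covariance_add_right (L₁.comp_memLp' hU2) (ContinuousLinearMap.comp_memLp' _ hY2)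
    (ContinuousLinearMap.comp_memLp' _ hW2), key hY2 hY, key hW2 hW, add_zero]

omit [IsProbabilityMeasure P] in
-- Row by row: a functional vanishing on the common kernel of finitely many functionals is a
-- combination of them. It replaces inverses of possibly singular covariance matrices, in regression
-- and in the choice of `H`.
theorem exists_mul_eq_of_ker_le {A : Matrix (Fin m) (Fin l) ℝ} {B : Matrix (Fin k) (Fin l) ℝ}
    (h : ∀ v, A *ᵥ v = 0 → B *ᵥ v = 0) : ∃ G : Matrix (Fin k) (Fin m) ℝ, G * A = B := by
  have hrow : ∀ i, ∃ g : Fin m → ℝ, g ᵥ* A = B i := by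
    intro i
    let L : Fin m → (Fin l → ℝ) →ₗ[ℝ] ℝ := fun j => LinearMap.proj j ∘ₗ A.mulVecLin
    have hmem := mem_span_of_iInf_ker_le_ker (L := L) (K := LinearMap.proj i ∘ₗ B.mulVecLin) (by
      intro v hv
      simp only [Submodule.mem_iInf, LinearMap.mem_ker] at hv
      have h0 : A *ᵥ v = 0 := funext fun j => hv j
      exact congrFun (h v h0) i)
    obtain ⟨g, hg⟩ := (Submodule.mem_span_range_iff_exists_fun ℝ).1 hmem
    refine ⟨g, funext fun j => ?_⟩
    have := LinearMap.congr_fun hg (Pi.single j 1)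
    simpa [L, vecMul, dotProduct] using this
  choose g hg using hrow
  refine ⟨Matrix.of g, ?_⟩
  ext i j
  exact congrFun (hg i) j

/-- Linear regression of `X` on `W`, for a possibly singular covariance matrix. -/
theorem exists_crossCov_eq_mul {X : Ω → Euc k} {W : Ω → Euc l} (hX : MemLp X 2 P)
    (hW : MemLp W 2 P) :
    ∃ G : Matrix (Fin k) (Fin l) ℝ, crossCov X W P = G * covMat W P := by
  obtain ⟨G, hG⟩ := exists_mul_eq_of_ker_le (A := covMat W P) (B := crossCov X W P) (by
    intro v hv
    -- A vector in the kernel of the covariance of `W` gives an almost surely constant functional of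
    -- `W`, which is uncorrelated with everything.
    have hvar : Var[fun ω => ⟪WithLp.toLp 2 v, W ω⟫; P] = 0 := by
      rw [variance_inner hW, quadForm]
      simp [hv]
    have hWv : MemLp (fun ω => ⟪WithLp.toLp 2 v, W ω⟫) 2 P :=
      (innerSL ℝ (WithLp.toLp 2 v)).comp_memLp' hW
    ext i
    have h1 : (crossCov X W P *ᵥ v) i
        = cov[fun ω => X ω i, fun ω => ⟪WithLp.toLp 2 v, W ω⟫; P] := by
      have h : (fun ω => ⟪WithLp.toLp 2 v, W ω⟫) = fun ω => ∑ a, v a * W ω a := by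
        ext ω
        simp [PiLp.inner_apply, mul_comm]
      rw [h, covariance_fun_sum_right (fun a => (memLp_eval hW a).const_mul _) (memLp_eval hX i)]
      simp [mulVec, dotProduct, crossCov, covariance_const_mul_right, mul_comm]
    rw [h1]
    have h2 := ae_eq_integral_of_variance_eq_zero hWv hvar
    rw [covariance]
    refine integral_eq_zero_of_ae ?_
    filter_upwards [h2] with ω hω
    simp [hω])
  exact ⟨G, hG.symm⟩

end CrossCov

end GrayWyner

namespace GrayWyner

/-! ### Translation invariance. -/

section Shift

variable {k l : ℕ}

/-- Translations are invertible, so data processing applies in both directions. -/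
theorem mutualInfo_map_add (π : Measure (Euc k × Euc l)) [IsFiniteMeasure π] (a : Euc k)
    (b : Euc l) : mutualInfo (π.map fun p => (a + p.1, b + p.2)) = mutualInfo π := by
  have hm : ∀ (a : Euc k) (b : Euc l), Measurable fun p : Euc k × Euc l => (a + p.1, b + p.2) :=
    fun a b => by fun_prop
  refine le_antisymm
    (mutualInfo_map_prodMap_le π (measurable_const_add a) (measurable_const_add b)) ?_
  have h := mutualInfo_map_prodMap_le (π.map fun p => (a + p.1, b + p.2))
    (measurable_const_add (-a)) (measurable_const_add (-b))
  have e : (π.map fun p => (a + p.1, b + p.2)).map (Prod.map (-a + ·) (-b + ·)) = π := by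
    rw [Measure.map_map ((measurable_const_add _).prodMap (measurable_const_add _)) (hm a b)]
    have : Prod.map (-a + ·) (-b + ·) ∘ (fun p : Euc k × Euc l => (a + p.1, b + p.2)) = id := by
      ext1 p
      simp
    rw [this, Measure.map_id]
  rwa [e] at h

theorem rdf_map_add_le (ν : Measure (Euc k)) [IsProbabilityMeasure ν] (c : Euc k) (D : ℝ≥0∞) :
    rdf (ν.map (c + ·)) D ≤ rdf ν D := by
  refine le_iInf fun κ => le_iInf fun hκ => le_iInf fun hD => ?_
  have hm : Measurable fun p : Euc k × Euc k => (c + p.1, c + p.2) := by fun_prop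
  have : IsProbabilityMeasure ((ν ⊗ₘ κ).map fun p => (c + p.1, c + p.2)) :=
    Measure.isProbabilityMeasure_map hm.aemeasurable
  have hfst : ((ν ⊗ₘ κ).map fun p => (c + p.1, c + p.2)).fst = ν.map (c + ·) := by
    conv_rhs => rw [← Measure.fst_compProd ν κ]
    rw [Measure.fst, Measure.fst, Measure.map_map measurable_fst hm,
      Measure.map_map (measurable_const_add c) measurable_fst]
    rfl
  rw [← mutualInfo_map_add (ν ⊗ₘ κ) c c, ← hfst]
  refine rdf_fst_le_mutualInfo _ ?_
  rw [mse_map hm measurable_fst measurable_snd]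
  refine le_trans (le_of_eq ?_) hD
  simp [mse]

theorem rdf_map_add (ν : Measure (Euc k)) [IsProbabilityMeasure ν] (c : Euc k) (D : ℝ≥0∞) :
    rdf (ν.map (c + ·)) D = rdf ν D := by
  refine le_antisymm (rdf_map_add_le ν c D) ?_
  have : IsProbabilityMeasure (ν.map (c + ·)) :=
    Measure.isProbabilityMeasure_map (measurable_const_add c).aemeasurable
  have h := rdf_map_add_le (ν.map (c + ·)) (-c) D
  rw [Measure.map_map (measurable_const_add _) (measurable_const_add _)] at h
  have e : (-c + ·) ∘ (c + ·) = (id : Euc k → Euc k) := by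
    ext1 x
    simp
  rwa [e, Measure.map_id] at h

end Shift

theorem indepFun_map_iff {Ω α β γ : Type*} [MeasurableSpace Ω] [MeasurableSpace α]
    [MeasurableSpace β] [MeasurableSpace γ] {P : Measure Ω} [IsProbabilityMeasure P] {V : Ω → α}
    {f : α → β} {g : α → γ} (hV : Measurable V) (hf : Measurable f) (hg : Measurable g) :
    IndepFun f g (P.map V) ↔ IndepFun (fun ω => f (V ω)) (fun ω => g (V ω)) P := by
  have : IsProbabilityMeasure (P.map V) := Measure.isProbabilityMeasure_map hV.aemeasurable
  change _ ↔ IndepFun (f ∘ V) (g ∘ V) P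
  rw [indepFun_iff_map_prod_eq_prod_map_map hf.aemeasurable hg.aemeasurable,
    indepFun_iff_map_prod_eq_prod_map_map (hf.comp hV).aemeasurable (hg.comp hV).aemeasurable,
    Measure.map_map (hf.prodMk hg) hV, Measure.map_map hf hV, Measure.map_map hg hV]
  rfl

/-! ### Sources that are a function of the side information plus an independent term. -/

section Independence

variable {Ω 𝕎 : Type*} [MeasurableSpace Ω] [MeasurableSpace 𝕎] {k : ℕ} {P : Measure Ω}
  [IsProbabilityMeasure P] {X Y : Ω → Euc k} {W : Ω → 𝕎} {a : 𝕎 → Euc k}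

theorem condDistrib_of_sub_indepFun (hX : Measurable X) (hW : Measurable W) (ha : Measurable a)
    (h : IndepFun (fun ω => X ω - a (W ω)) W P) :
    ∀ᵐ w ∂(P.map W), condDistrib X W P w = (P.map fun ω => X ω - a (W ω)).map (a w + ·) := by
  have hm : Measurable fun ω => X ω - a (W ω) := hX.sub (ha.comp hW)
  have e : X = fun ω => a (W ω) + (X ω - a (W ω)) := by
    ext1 ω
    simp
  have h1 := condDistrib_map_fiber (P := P) hm hW (g := fun p : 𝕎 × Euc k => a p.1 + p.2)
    (by fun_prop)
  filter_upwards [h1, condDistrib_of_indepFun hm hW h] with w hw1 hw2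
  rw [← hw2, ← hw1]
  congr 2

/-- Given `W = w`, source and reproduction are a fixed pair translated by the same vector `a w`;
translation-invariant quantities are therefore constant in `w`. -/
theorem condDistrib_prodMk_of_sub_indepFun (hX : Measurable X) (hY : Measurable Y)
    (hW : Measurable W) (ha : Measurable a)
    (h : IndepFun (fun ω => (X ω - a (W ω), Y ω - a (W ω))) W P) :
    ∀ᵐ w ∂(P.map W), condDistrib (fun ω => (X ω, Y ω)) W P w
      = (P.map fun ω => (X ω - a (W ω), Y ω - a (W ω))).map
        fun p => (a w + p.1, a w + p.2) := by
  have hm : Measurable fun ω => (X ω - a (W ω), Y ω - a (W ω)) :=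
    (hX.sub (ha.comp hW)).prodMk (hY.sub (ha.comp hW))
  have e : (fun ω => (X ω, Y ω))
      = fun ω => (a (W ω) + (X ω - a (W ω)), a (W ω) + (Y ω - a (W ω))) := by
    ext1 ω
    simp
  have h1 := condDistrib_map_fiber (P := P) hm hW
    (g := fun p : 𝕎 × Euc k × Euc k => (a p.1 + p.2.1, a p.1 + p.2.2)) (by fun_prop)
  filter_upwards [h1, condDistrib_of_indepFun hm hW h] with w hw1 hw2
  rw [← hw2, ← hw1, e]

theorem mutualInfoAt_of_sub_indepFun (hX : Measurable X) (hY : Measurable Y)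
    (hW : Measurable W) (ha : Measurable a)
    (h : IndepFun (fun ω => (X ω - a (W ω), Y ω - a (W ω))) W P) :
    ∀ᵐ w ∂(P.map W), mutualInfoAt X Y W P w
      = mutualInfo (P.map fun ω => (X ω - a (W ω), Y ω - a (W ω))) := by
  filter_upwards [condDistrib_prodMk_of_sub_indepFun hX hY hW ha h] with w hw
  rw [mutualInfoAt, hw, mutualInfo_map_add]

theorem condMutualInfo_of_sub_indepFun (hX : Measurable X) (hY : Measurable Y)
    (hW : Measurable W) (ha : Measurable a)
    (h : IndepFun (fun ω => (X ω - a (W ω), Y ω - a (W ω))) W P) :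
    condMutualInfo X Y W P = mutualInfo (P.map fun ω => (X ω - a (W ω), Y ω - a (W ω))) := by
  have : IsProbabilityMeasure (P.map W) := Measure.isProbabilityMeasure_map hW.aemeasurable
  exact lintegral_eq_of_ae_eq_const _ (mutualInfoAt_of_sub_indepFun hX hY hW ha h)

theorem mseAt_of_sub_indepFun (hX : Measurable X) (hY : Measurable Y)
    (hW : Measurable W) (ha : Measurable a)
    (h : IndepFun (fun ω => (X ω - a (W ω), Y ω - a (W ω))) W P) :
    ∀ᵐ w ∂(P.map W), mseAt X Y W P w = mse X Y P := by
  have hm : Measurable fun ω => (X ω - a (W ω), Y ω - a (W ω)) :=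
    (hX.sub (ha.comp hW)).prodMk (hY.sub (ha.comp hW))
  filter_upwards [condDistrib_prodMk_of_sub_indepFun hX hY hW ha h] with w hw
  rw [mseAt, hw, lintegral_map (by fun_prop) (by fun_prop), lintegral_map (by fun_prop) hm]
  simp [mse]

/-- Information about a source independent of the side information does not decrease by
conditioning. -/
theorem mutualInfo_le_condMutualInfo_of_indepFun (hX : Measurable X) (hY : Measurable Y)
    (hW : Measurable W) (h : IndepFun X W P) :
    mutualInfo (P.map fun ω => (X ω, Y ω)) ≤ condMutualInfo X Y W P := by
  have hXY : Measurable fun ω => (X ω, Y ω) := hX.prodMk hY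
  have : IsProbabilityMeasure (P.map W) := Measure.isProbabilityMeasure_map hW.aemeasurable
  have : IsProbabilityMeasure (P.map X) := Measure.isProbabilityMeasure_map hX.aemeasurable
  set lam := condDistrib (fun ω => (X ω, Y ω)) W P with hlam
  -- As `X` is independent of `W`, the fibrewise product law is `P_X × P_{Y|W=w}`. The conditional
  -- information is thus one divergence on triples; forgetting `W` turns the reference into `P_X ×
  -- P_Y`, and data processing concludes.
  have h1 : condMutualInfo X Y W P
      = klDiv (P.map W ⊗ₘ lam) (P.map W ⊗ₘ (Kernel.const 𝕎 (P.map X) ×ₖ lam.snd)) := by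
    rw [klDiv_compProd_eq_lintegral, condMutualInfo]
    refine lintegral_congr_ae ?_
    filter_upwards [fst_condDistrib_prodMk (P := P) hX hY hW, condDistrib_of_indepFun hX hW h]
      with w hw1 hw2
    rw [mutualInfoAt, mutualInfo, hw1, hw2, Kernel.prod_apply, Kernel.const_apply,
      Kernel.snd_apply]
    rfl
  have hjoint : (P.map W ⊗ₘ lam).map Prod.snd = P.map fun ω => (X ω, Y ω) := by
    rw [hlam, compProd_map_condDistrib hXY.aemeasurable,
      Measure.map_map measurable_snd (hW.prodMk hXY)]
    rfl
  have hsnd : P.map W ⊗ₘ lam.snd = P.map fun ω => (W ω, Y ω) := by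
    refine Measure.ext_of_lintegral _ fun f hf => ?_
    have e : ∫⁻ p, f (p.1, p.2.2) ∂(P.map W ⊗ₘ lam) = ∫⁻ ω, f (W ω, Y ω) ∂P := by
      rw [hlam, compProd_map_condDistrib hXY.aemeasurable,
        lintegral_map (by fun_prop) (hW.prodMk hXY)]
    rw [lintegral_map hf (hW.prodMk hY), ← e, Measure.lintegral_compProd hf,
      Measure.lintegral_compProd (by fun_prop)]
    refine lintegral_congr fun w => ?_
    rw [Kernel.snd_apply, lintegral_map (by fun_prop) measurable_snd]
  have hprod : (P.map W ⊗ₘ (Kernel.const 𝕎 (P.map X) ×ₖ lam.snd)).map Prod.snd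
      = (P.map X).prod (P.map Y) := by
    refine Measure.ext_of_lintegral _ fun f hf => ?_
    rw [lintegral_map hf measurable_snd, Measure.lintegral_compProd (by fun_prop)]
    have e : ∀ w, ∫⁻ q, f q ∂((Kernel.const 𝕎 (P.map X) ×ₖ lam.snd) w)
        = ∫⁻ y, ∫⁻ x, f (x, y) ∂(P.map X) ∂(lam.snd w) := by
      intro w
      rw [Kernel.prod_apply, Kernel.const_apply, lintegral_prod_symm _ hf.aemeasurable]
    have hF : Measurable fun y => ∫⁻ x, f (x, y) ∂(P.map X) := by
      exact Measurable.lintegral_prod_left' hf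
    simp only [e]
    have hF' : Measurable fun p : 𝕎 × Euc k => ∫⁻ x, f (x, p.2) ∂(P.map X) :=
      hF.comp measurable_snd
    have e2 := Measure.lintegral_compProd (μ := P.map W) (κ := lam.snd) hF'
    rw [← e2, hsnd, lintegral_map hF' (hW.prodMk hY),
      lintegral_prod_symm _ hf.aemeasurable, lintegral_map hF hY]
  have h2 := klDiv_map_le (μ := P.map W ⊗ₘ lam)
    (ν := P.map W ⊗ₘ (Kernel.const 𝕎 (P.map X) ×ₖ lam.snd)) measurable_snd
  rw [h1, mutualInfo]
  rw [hjoint, hprod] at h2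
  convert h2 using 2
  rw [Measure.fst, Measure.snd, Measure.map_map measurable_fst hXY,
    Measure.map_map measurable_snd hXY]
  rfl

theorem condMutualInfo_sub (hX : Measurable X) (hY : Measurable Y) (hW : Measurable W)
    (ha : Measurable a) :
    condMutualInfo (fun ω => X ω - a (W ω)) (fun ω => Y ω - a (W ω)) W P
      = condMutualInfo X Y W P := by
  refine lintegral_congr_ae ?_
  filter_upwards [condDistrib_map_fiber (P := P) (hX.prodMk hY) hW
    (g := fun p : 𝕎 × Euc k × Euc k => (-a p.1 + p.2.1, -a p.1 + p.2.2)) (by fun_prop)] with w hw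
  rw [mutualInfoAt, mutualInfoAt, ← mutualInfo_map_add (condDistrib (fun ω => (X ω, Y ω)) W P w)
    (-a w) (-a w), ← hw]
  simp only [neg_add_eq_sub]

/-- After subtracting `a W` from source and reproduction the source is independent of `W`, and the
conditional information dominates the unconditional one. The error is unchanged. -/
theorem rdf_le_condMutualInfo_of_sub_indepFun (hX : Measurable X) (hY : Measurable Y)
    (hW : Measurable W) (ha : Measurable a) (h : IndepFun (fun ω => X ω - a (W ω)) W P)
    {D : ℝ≥0∞} (hD : mse X Y P ≤ D) :
    rdf (P.map fun ω => X ω - a (W ω)) D ≤ condMutualInfo X Y W P := by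
  have hX' : Measurable fun ω => X ω - a (W ω) := hX.sub (ha.comp hW)
  have hY' : Measurable fun ω => Y ω - a (W ω) := hY.sub (ha.comp hW)
  have : IsProbabilityMeasure (P.map fun ω => (X ω - a (W ω), Y ω - a (W ω))) :=
    Measure.isProbabilityMeasure_map (hX'.prodMk hY').aemeasurable
  rw [← condMutualInfo_sub hX hY hW ha]
  refine le_trans ?_ (mutualInfo_le_condMutualInfo_of_indepFun hX' hY' hW h)
  have hfst : (P.map fun ω => (X ω - a (W ω), Y ω - a (W ω))).fst
      = P.map fun ω => X ω - a (W ω) := by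
    rw [Measure.fst, Measure.map_map measurable_fst (hX'.prodMk hY')]
    rfl
  rw [← hfst]
  refine rdf_fst_le_mutualInfo _ ?_
  rw [mse_map (hX'.prodMk hY') measurable_fst measurable_snd]
  refine le_trans (le_of_eq ?_) hD
  simp [mse]

theorem rdf_condDistrib_of_sub_indepFun (hX : Measurable X) (hW : Measurable W)
    (ha : Measurable a) (h : IndepFun (fun ω => X ω - a (W ω)) W P) :
    ∀ᵐ w ∂(P.map W), ∀ D, rdf (condDistrib X W P w) D = rdf (P.map fun ω => X ω - a (W ω)) D := by
  have : IsProbabilityMeasure (P.map fun ω => X ω - a (W ω)) :=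
    Measure.isProbabilityMeasure_map (hX.sub (ha.comp hW)).aemeasurable
  filter_upwards [condDistrib_of_sub_indepFun hX hW ha h] with w hw D
  rw [hw, rdf_map_add]

/-- If the source is a function of the side information plus an independent term, then the
conditional rate distortion function is the rate distortion function of that term. -/
theorem condRDF_pairLaw_of_sub_indepFun (hX : Measurable X) (hX2 : MemLp X 2 P) (hW : Measurable W)
    (ha : Measurable a) (h : IndepFun (fun ω => X ω - a (W ω)) W P) {Δ : ℝ≥0∞} (hΔ : Δ ≠ ∞) :
    condRDF (pairLaw X W P) Δ = rdf (P.map fun ω => X ω - a (W ω)) Δ := by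
  have hXW : Measurable fun ω => (X ω, W ω) := hX.prodMk hW
  have : IsProbabilityMeasure (P.map W) := Measure.isProbabilityMeasure_map hW.aemeasurable
  have : IsProbabilityMeasure (pairLaw X W P) :=
    Measure.isProbabilityMeasure_map hXW.aemeasurable
  refine le_antisymm ?_ ?_
  · have hmem : MemLp Prod.fst 2 (pairLaw X W P) :=
      (memLp_map_measure_iff (Measurable.aestronglyMeasurable (by fun_prop))
        hXW.aemeasurable).2 hX2
    -- A constant profile suffices, since the fibrewise rate distortion functions agree for almost
    -- every `w`.
    have h1 := condRDF_le_lintegral_rdf (pairLaw X W P) hmem hΔ (δ := fun _ => Δ)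
      measurable_const (by rw [pairLaw_map_snd hX hW]; simp)
    refine h1.trans (le_of_eq ?_)
    rw [pairLaw_map_snd hX hW, ← condDistrib_eq_of_pairLaw hX hW]
    refine lintegral_eq_of_ae_eq_const _ ?_
    filter_upwards [rdf_condDistrib_of_sub_indepFun hX hW ha h] with w hw
    exact hw Δ
  · refine le_iInf fun κ => le_iInf fun hκ => le_iInf fun hD => ?_
    set R := pairLaw X W P ⊗ₘ κ with hR
    have hm : Measurable fun p : Euc k × 𝕎 => p.1 - a p.2 := by fun_prop
    have hmap : R.map (fun z => src z - a (side z)) = P.map fun ω => X ω - a (W ω) := by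
      have : (fun z : (Euc k × 𝕎) × Euc k => src z - a (side z))
        = (fun p : Euc k × 𝕎 => p.1 - a p.2) ∘ Prod.fst := rfl
      rw [this, ← Measure.map_map hm measurable_fst, hR, compProd_map_fst,
        Measure.map_map hm hXW]
      rfl
    rw [← hmap]
    refine rdf_le_condMutualInfo_of_sub_indepFun measurable_src measurable_rep measurable_side ha
      ?_ hD
    have h1 : IndepFun (fun p : Euc k × 𝕎 => p.1 - a p.2) Prod.snd (R.map Prod.fst) := by
      rw [hR, compProd_map_fst]
      exact (indepFun_map_iff hXW hm measurable_snd).2 h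
    exact (indepFun_map_iff measurable_fst hm measurable_snd).1 h1

end Independence

/-! ### The structural property: a criterion and its consequences for covariances. -/

section StructuralCriterion

theorem condExp_ae_eq_of_indep {Ω : Type*} {m mΩ : MeasurableSpace Ω} {k : ℕ} {P : Measure Ω}
    [IsProbabilityMeasure P] {X Z : Ω → Euc k} (hle : m ≤ mΩ) (hX : Integrable X P)
    (hZ : Integrable Z P) (hZm : StronglyMeasurable[m] Z) (hD : Measurable fun ω => X ω - Z ω)
    (h : Indep (MeasurableSpace.comap (fun ω => X ω - Z ω) inferInstance) m P)
    (h0 : ∫ ω, (X ω - Z ω) ∂P = 0) : P[X | m] =ᵐ[P] Z := by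
  have h1 : P[fun ω => X ω - Z ω | m] =ᵐ[P] fun _ => ∫ ω, (X ω - Z ω) ∂P :=
    condExp_indep_eq hD.comap_le hle (comap_measurable _).stronglyMeasurable h
  have h2 : P[fun ω => X ω - Z ω | m] =ᵐ[P] P[X | m] - P[Z | m] := condExp_sub hX hZ m
  rw [condExp_of_stronglyMeasurable hle hZm hZ] at h2
  filter_upwards [h1, h2] with ω e1 e2
  rw [e1, h0, Pi.sub_apply] at e2
  exact sub_eq_zero.1 e2.symm

theorem condExp_sub_ae_eq_zero {Ω : Type*} {m mΩ : MeasurableSpace Ω} {k : ℕ} {P : Measure Ω}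
    [IsProbabilityMeasure P] {X Z : Ω → Euc k} (hle : m ≤ mΩ) (hX : Integrable X P)
    (hZ : Integrable Z P) (hZm : StronglyMeasurable[m] Z) (h : P[X | m] =ᵐ[P] Z) :
    P[fun ω => X ω - Z ω | m] =ᵐ[P] 0 := by
  have h2 : P[fun ω => X ω - Z ω | m] =ᵐ[P] P[X | m] - P[Z | m] := condExp_sub hX hZ m
  rw [condExp_of_stronglyMeasurable hle hZm hZ] at h2
  filter_upwards [h2, h] with ω e2 e3
  rw [e2, Pi.sub_apply, Pi.zero_apply, sub_eq_zero, e3]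

theorem covariance_eq_zero_of_condExp_eq_zero {Ω : Type*} {m mΩ : MeasurableSpace Ω} {k : ℕ}
    {P : Measure Ω} [IsProbabilityMeasure P] {D : Ω → Euc k} {f : Ω → ℝ} (hle : m ≤ mΩ)
    (hD : MemLp D 2 P) (hf : MemLp f 2 P) (hfm : StronglyMeasurable[m] f)
    (h : P[D | m] =ᵐ[P] 0) (i : Fin k) : cov[fun ω => D ω i, f; P] = 0 := by
  have hDi : Integrable D P := hD.integrable (by norm_num)
  have hz : P[fun ω => D ω i | m] =ᵐ[P] 0 := by
    have h1 := (EuclideanSpace.proj (𝕜 := ℝ) i : Euc k →L[ℝ] ℝ).comp_condExp_comm (m := m) hDi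
    refine h1.symm.trans ?_
    filter_upwards [h] with ω e2
    simp [e2]
  have hint : ∫ ω, D ω i ∂P = 0 := by
    rw [← integral_condExp hle, integral_congr_ae hz]
    simp
  have hmul : ∫ ω, ((fun ω => D ω i) * f) ω ∂P = 0 := by
    have h1 := condExp_mul_of_stronglyMeasurable_right (μ := P) (f := fun ω => D ω i) hfm
      ((memLp_eval hD i).integrable_mul hf) ((memLp_eval hD i).integrable (by norm_num))
    rw [← integral_condExp hle, integral_congr_ae h1]
    refine integral_eq_zero_of_ae ?_
    filter_upwards [hz] with ω e
    simp [e]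
  rw [covariance_eq_sub (memLp_eval hD i) hf, hint, hmul]
  simp

variable {Ω 𝕎 : Type*} [MeasurableSpace Ω] [MeasurableSpace 𝕎] {k : ℕ} {P : Measure Ω}
  [IsProbabilityMeasure P] {X Y : Ω → Euc k} {W : Ω → 𝕎}

theorem condMean_ae_eq_of_indepFun {T : Type*} [MeasurableSpace T] {V : Ω → T} {f : T → Euc k}
    (hX : Integrable X P) (hXm : Measurable X) (hV : Measurable V) (hf : Measurable f)
    (hfV : Integrable (fun ω => f (V ω)) P) (h : IndepFun (fun ω => X ω - f (V ω)) V P)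
    (h0 : ∫ ω, (X ω - f (V ω)) ∂P = 0) : condMean X V P =ᵐ[P] fun ω => f (V ω) :=
  condExp_ae_eq_of_indep hV.comap_le hX hfV (hf.comp (comap_measurable V)).stronglyMeasurable
    (hXm.sub (hf.comp hV)) h h0

/-- An error of mean zero independent of `(Y, W)` gives the structural property. -/
theorem structural_of_indepFun (hX : Integrable X P) (hXm : Measurable X) (hY : Measurable Y)
    (hYi : Integrable Y P) (hW : Measurable W)
    (h : IndepFun (fun ω => X ω - Y ω) (fun ω => (Y ω, W ω)) P)
    (h0 : ∫ ω, (X ω - Y ω) ∂P = 0) : Structural X Y W P := by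
  have h1 : cmRep X Y W P =ᵐ[P] Y :=
    condMean_ae_eq_of_indepFun (f := Prod.fst) hX hXm (hY.prodMk hW) measurable_fst hYi h h0
  have h2 : condMean X Y P =ᵐ[P] Y :=
    condMean_ae_eq_of_indepFun (f := id) hX hXm hY measurable_id hYi
      (h.comp (φ := id) (ψ := Prod.fst) measurable_id measurable_fst) h0
  exact ⟨h1.trans h2.symm, h2⟩

theorem Structural.condExp_sub (hX : Integrable X P) (hY : Measurable Y) (hYi : Integrable Y P)
    (hW : Measurable W) (h : Structural X Y W P) :
    P[fun ω => X ω - Y ω | MeasurableSpace.comap (fun ω => (Y ω, W ω)) inferInstance]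
      =ᵐ[P] 0 :=
  condExp_sub_ae_eq_zero (hY.prodMk hW).comap_le hX hYi
    (measurable_fst.comp (comap_measurable fun ω => (Y ω, W ω))).stronglyMeasurable h.cmRep_eq

/-- Under the structural property the error is uncorrelated with every function of `(Y, W)`. -/
theorem Structural.crossCov_sub_eq_zero {l : ℕ} {f : Euc k × 𝕎 → Euc l} (hX : MemLp X 2 P)
    (hY : Measurable Y) (hY2 : MemLp Y 2 P) (hW : Measurable W) (h : Structural X Y W P)
    (hf : Measurable f) (hf2 : MemLp (fun ω => f (Y ω, W ω)) 2 P) :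
    crossCov (fun ω => X ω - Y ω) (fun ω => f (Y ω, W ω)) P = 0 := by
  ext i j
  have hp : Measurable fun p => f p j :=
    (by fun_prop : Measurable fun x : Euc l => x j).comp hf
  exact covariance_eq_zero_of_condExp_eq_zero (hY.prodMk hW).comap_le (hX.sub hY2)
    (memLp_eval hf2 j) (hp.comp (comap_measurable fun ω => (Y ω, W ω))).stronglyMeasurable
    (h.condExp_sub (hX.integrable (by norm_num)) hY (hY2.integrable (by norm_num)) hW) i

end StructuralCriterion

end GrayWyner

namespace GrayWyner

/-! ### Gaussian reproductions with the structural property, and covariances of a realization. -/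

section Realization

open Matrix

variable {Ω : Type*} [MeasurableSpace Ω] {P : Measure Ω} [IsProbabilityMeasure P] {k l n : ℕ}

/-- The continuous linear map of a matrix. -/
noncomputable def matCLM (A : Matrix (Fin l) (Fin k) ℝ) : Euc k →L[ℝ] Euc l :=
  LinearMap.toContinuousLinearMap (toEuclideanLin A)

theorem covMat_congr {U U' : Ω → Euc k} (h : U =ᵐ[P] U') : covMat U P = covMat U' P := by
  ext i j
  simp only [covMat, crossCov, of_apply]
  have hi : ∀ i, (fun ω => U ω i) =ᵐ[P] fun ω => U' ω i := fun i => by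
    filter_upwards [h] with ω e
    rw [e]
  unfold covariance
  rw [integral_congr_ae (hi i), integral_congr_ae (hi j)]
  refine integral_congr_ae ?_
  filter_upwards [hi i, hi j] with ω e1 e2
  rw [e1, e2]

/-- Under a jointly Gaussian law with the structural property, source and reproduction are
functions of `W` plus a pair independent of `W`. -/
theorem GaussianStructural.exists_indepFun {X Y : Ω → Euc k} {W : Ω → Euc n}
    (hY : Measurable Y) (hW : Measurable W) (h : GaussianStructural X Y W P) :
    ∃ G : Matrix (Fin k) (Fin n) ℝ,
      IndepFun (fun ω => (X ω - toEuclideanLin G (W ω), Y ω - toEuclideanLin G (W ω))) W P := by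
  obtain ⟨hG, hS⟩ := h
  have hY2 : MemLp Y 2 P := hG.fst.memLp_two
  have hX2 : MemLp X 2 P := hG.snd.fst.memLp_two
  have hW2 : MemLp W 2 P := hG.snd.snd.memLp_two
  -- `G` is the regression matrix of `Y` on `W`. It also serves for `X`, because under the
  -- structural property `X - Y` is uncorrelated with `W`.
  obtain ⟨G, hGe⟩ := exists_crossCov_eq_mul hY2 hW2
  refine ⟨G, ?_⟩
  have hGW2 : MemLp (fun ω => toEuclideanLin G (W ω)) 2 P := memLp_toEuclideanLin G hW2
  have hYW : crossCov (fun ω => Y ω - toEuclideanLin G (W ω)) W P = 0 := by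
    rw [crossCov_sub_left hY2 hGW2 hW2, crossCov_toEuclideanLin_left G hW2 hW2, hGe, covMat,
      sub_self]
  have hD2 : MemLp (fun ω => X ω - Y ω) 2 P := hX2.sub hY2
  have hY'2 : MemLp (fun ω => Y ω - toEuclideanLin G (W ω)) 2 P := hY2.sub hGW2
  have hDW : crossCov (fun ω => X ω - Y ω) W P = 0 :=
    hS.crossCov_sub_eq_zero (f := Prod.snd) hX2 hY hY2 hW measurable_snd hW2
  have hXW : crossCov (fun ω => X ω - toEuclideanLin G (W ω)) W P = 0 := by
    have e : (fun ω => X ω - toEuclideanLin G (W ω))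
        = fun ω => (X ω - Y ω) + (Y ω - toEuclideanLin G (W ω)) := by
      ext1 ω
      abel
    rw [e, crossCov_add_left hD2 hY'2 hW2, hYW, hDW, add_zero]
  have hjoint : HasGaussianLaw (fun ω => (W ω, X ω - toEuclideanLin G (W ω),
      Y ω - toEuclideanLin G (W ω))) P := by
    let w : Euc k × Euc k × Euc n →L[ℝ] Euc n := .snd ℝ _ _ ∘L .snd ℝ _ _
    let x : Euc k × Euc k × Euc n →L[ℝ] Euc k := .fst ℝ _ _ ∘L .snd ℝ _ _
    exact hG.map_fun (w.prod ((x - matCLM G ∘L w).prod (.fst ℝ _ _ - matCLM G ∘L w)))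
  refine (indepFun_of_crossCov_eq_zero hjoint ?_ ?_).symm
  · rw [← crossCov_transpose, hXW, transpose_zero]
  · rw [← crossCov_transpose, hYW, transpose_zero]

theorem GaussianStructural.ae_eq_const {X Y : Ω → Euc k} {W : Ω → Euc n} (hX : Measurable X)
    (hY : Measurable Y) (hW : Measurable W) (h : GaussianStructural X Y W P) :
    (∀ᵐ w ∂(P.map W), mutualInfoAt X (cmRep X Y W P) W P w = condMutualInfo X Y W P) ∧
    (∀ᵐ w ∂(P.map W), mseAt X (cmRep X Y W P) W P w = mse X Y P) ∧
    AttainsLowerBounds X Y W P := by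
  obtain ⟨G, hind⟩ := h.exists_indepFun hY hW
  have ha : Measurable fun w : Euc n => toEuclideanLin G w := (matCLM G).continuous.measurable
  have h1 : ∀ᵐ w ∂(P.map W), mutualInfoAt X (cmRep X Y W P) W P w = condMutualInfo X Y W P := by
    rw [mutualInfoAt_congr .rfl h.2.cmRep_eq, condMutualInfo_of_sub_indepFun hX hY hW ha hind]
    exact mutualInfoAt_of_sub_indepFun hX hY hW ha hind
  have h2 : ∀ᵐ w ∂(P.map W), mseAt X (cmRep X Y W P) W P w = mse X Y P := by
    rw [mseAt_congr .rfl h.2.cmRep_eq]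
    exact mseAt_of_sub_indepFun hX hY hW ha hind
  exact ⟨h1, h2, attainsLowerBounds_of_const hX hY hW h.2 ⟨_, h1⟩ ⟨_, h2⟩⟩

/-- The independent Gaussian variables from which a realization is built: the part `U` of the
source independent of the side information `W`, and the noise `V`. -/
structure RealizationVars (Q H QV QE : Matrix (Fin k) (Fin k) ℝ) (U V : Ω → Euc k)
    (W : Ω → Euc n) (P : Measure Ω) : Prop where
  params : RealizationParams Q H QV QE
  measurable_source : Measurable U
  measurable_noise : Measurable V
  measurable_side : Measurable W
  source_law : P.map U = multivariateGaussian 0 Q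
  noise_law : P.map V = multivariateGaussian 0 QV
  gaussian_side : HasGaussianLaw W P
  indep_side : IndepFun U W P
  indep_noise : IndepFun V (fun ω => (U ω, W ω)) P

namespace RealizationVars

variable {Q H QV QE : Matrix (Fin k) (Fin k) ℝ} {U V : Ω → Euc k} {W : Ω → Euc n}
  (h : RealizationVars Q H QV QE U V W P)

include h

theorem hasGaussianLaw : HasGaussianLaw (fun ω => (V ω, U ω, W ω)) P := by
  have hU : HasGaussianLaw U P := ⟨by rw [h.source_law]; infer_instance⟩
  have hV : HasGaussianLaw V P := ⟨by rw [h.noise_law]; infer_instance⟩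
  exact h.indep_noise.hasGaussianLaw hV (h.indep_side.hasGaussianLaw hU h.gaussian_side)

theorem memLp_source : MemLp U 2 P := h.hasGaussianLaw.snd.fst.memLp_two

theorem memLp_noise : MemLp V 2 P := h.hasGaussianLaw.fst.memLp_two

theorem memLp_side : MemLp W 2 P := h.hasGaussianLaw.snd.snd.memLp_two

theorem integral_source : ∫ ω, U ω ∂P = 0 := by
  have := integral_map (μ := P) h.measurable_source.aemeasurable
    (f := id) aestronglyMeasurable_id
  rw [h.source_law] at this
  simpa using this.symm

theorem integral_noise : ∫ ω, V ω ∂P = 0 := by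
  have := integral_map (μ := P) h.measurable_noise.aemeasurable
    (f := id) aestronglyMeasurable_id
  rw [h.noise_law] at this
  simpa using this.symm

theorem covMat_source : covMat U P = Q := by
  rw [covMat_eq_momentMat (h.memLp_source.integrable (by norm_num)) h.integral_source]
  exact momentMat_of_map_eq h.measurable_source.aemeasurable h.params.cond_psd h.source_law

theorem covMat_noise : covMat V P = QV := by
  rw [covMat_eq_momentMat (h.memLp_noise.integrable (by norm_num)) h.integral_noise]
  exact momentMat_of_map_eq h.measurable_noise.aemeasurable h.params.noise_psd h.noise_law

theorem crossCov_noise_source : crossCov V U P = 0 :=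
  crossCov_eq_zero_of_indepFun h.memLp_noise h.memLp_source
    (h.indep_noise.comp measurable_id measurable_fst)

theorem crossCov_noise_side : crossCov V W P = 0 :=
  crossCov_eq_zero_of_indepFun h.memLp_noise h.memLp_side
    (h.indep_noise.comp measurable_id measurable_snd)

theorem crossCov_source_side : crossCov U W P = 0 :=
  crossCov_eq_zero_of_indepFun h.memLp_source h.memLp_side h.indep_side

theorem memLp_lin : MemLp (fun ω => toEuclideanLin H (U ω)) 2 P :=
  memLp_toEuclideanLin H h.memLp_source

theorem memLp_rep : MemLp (fun ω => toEuclideanLin H (U ω) + V ω) 2 P :=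
  h.memLp_lin.add h.memLp_noise

theorem measurable_rep : Measurable fun ω => toEuclideanLin H (U ω) + V ω :=
  ((matCLM H).continuous.measurable.comp h.measurable_source).add h.measurable_noise

theorem memLp_error : MemLp (fun ω => U ω - (toEuclideanLin H (U ω) + V ω)) 2 P :=
  h.memLp_source.sub h.memLp_rep

theorem crossCov_rep_side : crossCov (fun ω => toEuclideanLin H (U ω) + V ω) W P = 0 := by
  rw [crossCov_add_left h.memLp_lin h.memLp_noise h.memLp_side,
    crossCov_toEuclideanLin_left H h.memLp_source h.memLp_side, h.crossCov_source_side,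
    h.crossCov_noise_side, Matrix.mul_zero, add_zero]

theorem crossCov_rep_source :
    crossCov (fun ω => toEuclideanLin H (U ω) + V ω) U P = H * Q := by
  rw [crossCov_add_left h.memLp_lin h.memLp_noise h.memLp_source,
    crossCov_toEuclideanLin_left H h.memLp_source h.memLp_source, h.crossCov_noise_source,
    add_zero]
  exact congrArg _ h.covMat_source

theorem crossCov_rep_noise :
    crossCov (fun ω => toEuclideanLin H (U ω) + V ω) V P = QV := by
  have h0 : crossCov U V P = 0 := by
    rw [← crossCov_transpose, h.crossCov_noise_source, transpose_zero]
  rw [crossCov_add_left h.memLp_lin h.memLp_noise h.memLp_noise,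
    crossCov_toEuclideanLin_left H h.memLp_source h.memLp_noise, h0, Matrix.mul_zero, zero_add]
  exact h.covMat_noise

/-- The noise covariance supplies exactly what `H Q Hᵀ` lacks to be `H Q`. -/
theorem covMat_rep : covMat (fun ω => toEuclideanLin H (U ω) + V ω) P = Q - QE := by
  rw [covMat, crossCov_add_right h.memLp_rep h.memLp_lin h.memLp_noise,
    crossCov_toEuclideanLin_right H h.memLp_rep h.memLp_source, h.crossCov_rep_source,
    h.crossCov_rep_noise, h.params.noise_eq, add_sub_cancel, h.params.mul_eq]

theorem crossCov_error_source :
    crossCov (fun ω => U ω - (toEuclideanLin H (U ω) + V ω)) U P = QE := by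
  rw [crossCov_sub_left h.memLp_source h.memLp_rep h.memLp_source, h.crossCov_rep_source,
    h.params.mul_eq, ← covMat, h.covMat_source, sub_sub_cancel]

theorem crossCov_error_rep : crossCov (fun ω => U ω - (toEuclideanLin H (U ω) + V ω))
    (fun ω => toEuclideanLin H (U ω) + V ω) P = 0 := by
  rw [crossCov_sub_left h.memLp_source h.memLp_rep h.memLp_rep, ← covMat, h.covMat_rep,
    ← crossCov_transpose, h.crossCov_rep_source, transpose_mul,
    (show Qᵀ = Q from h.params.cond_psd.1), ← h.params.comm, h.params.mul_eq, sub_self]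

/-- Both the source part and its reproduction are uncorrelated with `W`. -/
theorem crossCov_error_side :
    crossCov (fun ω => U ω - (toEuclideanLin H (U ω) + V ω)) W P = 0 := by
  rw [crossCov_sub_left h.memLp_source h.memLp_rep h.memLp_side, h.crossCov_rep_side,
    h.crossCov_source_side, sub_self]

theorem integral_rep : ∫ ω, (toEuclideanLin H (U ω) + V ω) ∂P = 0 := by
  rw [integral_add (h.memLp_lin.integrable (by norm_num)) (h.memLp_noise.integrable (by norm_num)),
    h.integral_noise, add_zero]
  have := (matCLM H).integral_comp_comm (h.memLp_source.integrable (μ := P) (by norm_num))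
  rw [h.integral_source, map_zero] at this
  exact this

theorem integral_error : ∫ ω, (U ω - (toEuclideanLin H (U ω) + V ω)) ∂P = 0 := by
  rw [integral_sub (h.memLp_source.integrable (by norm_num))
    (h.memLp_rep.integrable (by norm_num)), h.integral_source, h.integral_rep, sub_zero]

theorem indepFun_error : IndepFun (fun ω => U ω - (toEuclideanLin H (U ω) + V ω))
    (fun ω => (toEuclideanLin H (U ω) + V ω, W ω)) P := by
  refine indepFun_of_crossCov_eq_zero ?_ h.crossCov_error_rep h.crossCov_error_side
  let v : Euc k × Euc k × Euc n →L[ℝ] Euc k := .fst ℝ _ _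
  let u : Euc k × Euc k × Euc n →L[ℝ] Euc k := .fst ℝ _ _ ∘L .snd ℝ _ _
  let w : Euc k × Euc k × Euc n →L[ℝ] Euc n := .snd ℝ _ _ ∘L .snd ℝ _ _
  exact h.hasGaussianLaw.map_fun
    ((u - (matCLM H ∘L u + v)).prod ((matCLM H ∘L u + v).prod w))

theorem indepFun_side : IndepFun (fun ω => (U ω, toEuclideanLin H (U ω) + V ω)) W P := by
  let v : Euc k × Euc k × Euc n →L[ℝ] Euc k := .fst ℝ _ _
  let u : Euc k × Euc k × Euc n →L[ℝ] Euc k := .fst ℝ _ _ ∘L .snd ℝ _ _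
  let w : Euc k × Euc k × Euc n →L[ℝ] Euc n := .snd ℝ _ _ ∘L .snd ℝ _ _
  have hG : HasGaussianLaw (fun ω => (W ω, U ω, toEuclideanLin H (U ω) + V ω)) P :=
    h.hasGaussianLaw.map_fun (w.prod (u.prod (matCLM H ∘L u + v)))
  refine (indepFun_of_crossCov_eq_zero hG ?_ ?_).symm
  · rw [← crossCov_transpose, h.crossCov_source_side, transpose_zero]
  · rw [← crossCov_transpose, h.crossCov_rep_side, transpose_zero]

/-- The error is uncorrelated with the reproduction, so its covariance is its cross-covariance with
the source. -/
theorem error_law : P.map (fun ω => U ω - (toEuclideanLin H (U ω) + V ω))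
    = multivariateGaussian 0 QE := by
  have hG : HasGaussianLaw (fun ω => U ω - (toEuclideanLin H (U ω) + V ω)) P := by
    let v : Euc k × Euc k × Euc n →L[ℝ] Euc k := .fst ℝ _ _
    let u : Euc k × Euc k × Euc n →L[ℝ] Euc k := .fst ℝ _ _ ∘L .snd ℝ _ _
    exact h.hasGaussianLaw.map_fun (u - (matCLM H ∘L u + v))
  rw [map_eq_multivariateGaussian hG h.integral_error]
  rw [covMat, crossCov_sub_left h.memLp_source h.memLp_rep h.memLp_error, ← crossCov_transpose,
    h.crossCov_error_source, ← crossCov_transpose _ (fun ω => toEuclideanLin H (U ω) + V ω),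
    h.crossCov_error_rep, transpose_zero, sub_zero, (show QEᵀ = QE from h.params.error_psd.1)]

end RealizationVars

end Realization

end GrayWyner

namespace GrayWyner

/-! ### Additive noise as kernels. -/

section AdditiveNoise

variable {Ω T : Type*} [MeasurableSpace Ω] [MeasurableSpace T] {P : Measure Ω}
  [IsProbabilityMeasure P] {k : ℕ}

/-- The joint law of `Z` and `f Z + D` for an independent noise `D`. -/
theorem map_prodMk_add_eq_compProd {Z : Ω → T} {D : Ω → Euc k} {f : T → Euc k} (hZ : Measurable Z)
    (hD : Measurable D) (hf : Measurable f) (h : IndepFun D Z P) (κ : Kernel T (Euc k))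
    [IsMarkovKernel κ] (hκ : ∀ t, κ t = (P.map D).map (f t + ·)) :
    P.map (fun ω => (Z ω, f (Z ω) + D ω)) = P.map Z ⊗ₘ κ := by
  have : IsProbabilityMeasure (P.map Z) := Measure.isProbabilityMeasure_map hZ.aemeasurable
  have : IsProbabilityMeasure (P.map D) := Measure.isProbabilityMeasure_map hD.aemeasurable
  have hprod := (indepFun_iff_map_prod_eq_prod_map_map hZ.aemeasurable hD.aemeasurable).1 h.symm
  refine Measure.ext_of_lintegral _ fun g hg => ?_
  have e : ∫⁻ ω, g (Z ω, f (Z ω) + D ω) ∂P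
      = ∫⁻ p, g (p.1, f p.1 + p.2) ∂(P.map fun ω => (Z ω, D ω)) := by
    rw [lintegral_map (by fun_prop) (hZ.prodMk hD)]
  rw [lintegral_map hg (by fun_prop), Measure.lintegral_compProd hg, e, hprod,
    lintegral_prod _ (by fun_prop)]
  refine lintegral_congr fun t => ?_
  rw [hκ, lintegral_map (f := fun b => g (t, b)) (by fun_prop) (by fun_prop)]

/-- The noise of an additive noise channel is independent of the input. -/
theorem compProd_map_sub_eq_prod (μ : Measure T) [IsProbabilityMeasure μ] {f : T → Euc k}
    (hf : Measurable f) (N : Measure (Euc k)) [IsProbabilityMeasure N] (κ : Kernel T (Euc k))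
    [IsMarkovKernel κ] (hκ : ∀ t, κ t = N.map (f t + ·)) :
    (μ ⊗ₘ κ).map (fun z => (z.1, z.2 - f z.1)) = μ.prod N := by
  refine Measure.ext_of_lintegral _ fun g hg => ?_
  rw [lintegral_map hg (by fun_prop), Measure.lintegral_compProd (by fun_prop),
    lintegral_prod _ hg.aemeasurable]
  refine lintegral_congr fun t => ?_
  rw [hκ, lintegral_map (by fun_prop) (by fun_prop)]
  simp

theorem indepFun_noise (μ : Measure T) [IsProbabilityMeasure μ] {f : T → Euc k}
    (hf : Measurable f) (N : Measure (Euc k)) [IsProbabilityMeasure N] (κ : Kernel T (Euc k))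
    [IsMarkovKernel κ] (hκ : ∀ t, κ t = N.map (f t + ·)) :
    (μ ⊗ₘ κ).map (fun z => z.2 - f z.1) = N ∧
      IndepFun (fun z : T × Euc k => z.2 - f z.1) Prod.fst (μ ⊗ₘ κ) := by
  have h := compProd_map_sub_eq_prod μ hf N κ hκ
  have hm : Measurable fun z : T × Euc k => z.2 - f z.1 := by fun_prop
  have h1 : (μ ⊗ₘ κ).map (fun z => z.2 - f z.1) = N := by
    have := congrArg (Measure.map Prod.snd) h
    rw [Measure.map_map measurable_snd (by fun_prop)] at this
    refine this.trans ?_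
    rw [Measure.map_snd_prod]
    simp
  refine ⟨h1, IndepFun.symm ?_⟩
  rw [indepFun_iff_map_prod_eq_prod_map_map measurable_fst.aemeasurable hm.aemeasurable, h, h1]
  congr 1
  exact (Measure.fst_compProd μ κ).symm

theorem gaussianChannel_apply {n : ℕ} (H : Matrix (Fin k) (Fin k) ℝ)
    (G : Matrix (Fin k) (Fin n) ℝ) (QV : Matrix (Fin k) (Fin k) ℝ) (t : Euc k × Euc n) :
    gaussianChannel H G QV t = (multivariateGaussian (0 : Euc k) QV).map
      ((Matrix.toEuclideanLin H t.1 + Matrix.toEuclideanLin ((1 - H) * G) t.2) + ·) := by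
  rw [gaussianChannel, Kernel.map_apply _ (measurable_reproduce H G), Kernel.prod_apply,
    Kernel.id_apply, Kernel.const_apply, Measure.dirac_prod,
    Measure.map_map (measurable_reproduce H G) (by fun_prop)]
  rfl

end AdditiveNoise

/-! ### Law, error and information of a realization. -/

section Realization

open Matrix

variable {Ω : Type*} [MeasurableSpace Ω] {P : Measure Ω} [IsProbabilityMeasure P] {k n : ℕ}

theorem hasGaussianLaw_add_const {E : Type*} [NormedAddCommGroup E] [NormedSpace ℝ E]
    [MeasurableSpace E] [BorelSpace E] [SecondCountableTopology E] {Z : Ω → E}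
    (h : HasGaussianLaw Z P) (c : E) : HasGaussianLaw (fun ω => Z ω + c) P := by
  have := h.isGaussian_map
  refine ⟨?_⟩
  have e : P.map (fun ω => Z ω + c) = (P.map Z).map (· + c) := by
    rw [AEMeasurable.map_map_of_aemeasurable (by fun_prop) h.aemeasurable]
    rfl
  rw [e]
  infer_instance

namespace RealizationVars

variable {Q H QV QE : Matrix (Fin k) (Fin k) ℝ} {U V X Y : Ω → Euc k} {W : Ω → Euc n}
  {G : Matrix (Fin k) (Fin n) ℝ} {c : Euc k}

theorem gaussianStructural (h : RealizationVars Q H QV QE U V W P)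
    (hX : ∀ ω, X ω = (toEuclideanLin G (W ω) + c) + U ω)
    (hY : ∀ ω, Y ω = (toEuclideanLin G (W ω) + c) + (toEuclideanLin H (U ω) + V ω)) :
    GaussianStructural X Y W P := by
  have hGW : Measurable fun w : Euc n => toEuclideanLin G w + c :=
    (matCLM G).continuous.measurable.add_const c
  have hYe : Y = fun ω => (toEuclideanLin G (W ω) + c) + (toEuclideanLin H (U ω) + V ω) := funext hY
  have hXe : X = fun ω => (toEuclideanLin G (W ω) + c) + U ω := funext hX
  have hXm : Measurable X := by
    rw [hXe]
    exact (hGW.comp h.measurable_side).add h.measurable_source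
  have hYm : Measurable Y := by
    rw [hYe]
    exact (hGW.comp h.measurable_side).add h.measurable_rep
  have hgauss : HasGaussianLaw (fun ω => (Y ω, X ω, W ω)) P := by
    let v : Euc k × Euc k × Euc n →L[ℝ] Euc k := .fst ℝ _ _
    let u : Euc k × Euc k × Euc n →L[ℝ] Euc k := .fst ℝ _ _ ∘L .snd ℝ _ _
    let w : Euc k × Euc k × Euc n →L[ℝ] Euc n := .snd ℝ _ _ ∘L .snd ℝ _ _
    have h1 := hasGaussianLaw_add_const (h.hasGaussianLaw.map_fun
      ((matCLM G ∘L w + (matCLM H ∘L u + v)).prod ((matCLM G ∘L w + u).prod w))) (c, c, 0)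
    convert! h1 using 1
    ext1 ω
    change _ = (toEuclideanLin G (W ω) + (toEuclideanLin H (U ω) + V ω) + c,
      toEuclideanLin G (W ω) + U ω + c, W ω + 0)
    rw [hX, hY, add_zero, add_right_comm, add_right_comm _ (U ω)]
  have hD : (fun ω => X ω - Y ω) = fun ω => U ω - (toEuclideanLin H (U ω) + V ω) := by
    ext1 ω
    rw [hX, hY]
    abel
  refine ⟨hgauss, structural_of_indepFun hgauss.snd.fst.integrable hXm hYm hgauss.fst.integrable
    h.measurable_side ?_ ?_⟩
  · rw [hD, hYe]
    exact h.indepFun_error.comp (φ := id)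
      (ψ := fun p : Euc k × Euc n => ((toEuclideanLin G p.2 + c) + p.1, p.2)) measurable_id
      (((hGW.comp measurable_snd).add measurable_fst).prodMk measurable_snd)
  · rw [hD]
    exact h.integral_error

theorem map_sub (h : RealizationVars Q H QV QE U V W P)
    (hX : ∀ ω, X ω = (toEuclideanLin G (W ω) + c) + U ω)
    (hY : ∀ ω, Y ω = (toEuclideanLin G (W ω) + c) + (toEuclideanLin H (U ω) + V ω)) :
    P.map (fun ω => X ω - Y ω) = multivariateGaussian 0 QE := by
  rw [← h.error_law]
  congr 1
  ext1 ω
  rw [hX, hY]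
  abel

theorem mse_eq (h : RealizationVars Q H QV QE U V W P)
    (hX : ∀ ω, X ω = (toEuclideanLin G (W ω) + c) + U ω)
    (hY : ∀ ω, Y ω = (toEuclideanLin G (W ω) + c) + (toEuclideanLin H (U ω) + V ω)) :
    mse X Y P = ENNReal.ofReal QE.trace := by
  have hD : (fun ω => X ω - Y ω) = fun ω => U ω - (toEuclideanLin H (U ω) + V ω) := by
    ext1 ω
    rw [hX, hY]
    abel
  rw [mse_eq_ofReal_trace (by rw [hD]; exact h.memLp_error), momentMat_of_map_eq
    (by rw [hD]; exact h.memLp_error.1.aemeasurable) h.params.error_psd (h.map_sub hX hY)]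

/-- The common translation by `G W + c` drops out, leaving the information between `U` and its
reproduction `R`. Read backwards, `U = R +` error with independent noise of covariance `QE`, a
channel whose information is known. -/
theorem condMutualInfo_eq (h : RealizationVars Q H QV QE U V W P)
    (hX : ∀ ω, X ω = (toEuclideanLin G (W ω) + c) + U ω)
    (hY : ∀ ω, Y ω = (toEuclideanLin G (W ω) + c) + (toEuclideanLin H (U ω) + V ω))
    (hQE : QE.PosDef) : condMutualInfo X Y W P = gaussianRate Q QE := by
  have hQ : Q.PosDef := by
    have := hQE.add_posSemidef h.params.diff_psd
    rwa [add_sub_cancel] at this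
  have hGW : Measurable fun w : Euc n => toEuclideanLin G w + c :=
    (matCLM G).continuous.measurable.add_const c
  have hXm : Measurable X := by
    rw [funext hX]
    exact (hGW.comp h.measurable_side).add h.measurable_source
  have hYm : Measurable Y := by
    rw [funext hY]
    exact (hGW.comp h.measurable_side).add h.measurable_rep
  set R : Ω → Euc k := fun ω => toEuclideanLin H (U ω) + V ω with hR
  have hRm : Measurable R := h.measurable_rep
  have hUm := h.measurable_source
  have e : (fun ω => (X ω - (toEuclideanLin G (W ω) + c), Y ω - (toEuclideanLin G (W ω) + c)))
      = fun ω => (U ω, R ω) := by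
    ext1 ω
    rw [hX, hY]
    simp [hR]
  have hind : IndepFun (fun ω => (X ω - (toEuclideanLin G (W ω) + c),
      Y ω - (toEuclideanLin G (W ω) + c))) W P := by
    rw [e]
    exact h.indepFun_side
  rw [condMutualInfo_of_sub_indepFun hXm hYm h.measurable_side hGW hind, e]
  have hDR : IndepFun (fun ω => U ω - R ω) R P :=
    h.indepFun_error.comp (φ := id) (ψ := Prod.fst) measurable_id measurable_fst
  have hlaw := map_prodMk_add_eq_compProd (f := id) hRm (hUm.sub hRm) measurable_id hDR
    (noiseChannel QE) (by
      intro t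
      rw [noiseChannel_apply, ← multivariateGaussian_map_add, ← h.error_law]
      rfl)
  have hRU : (fun ω => (R ω, id (R ω) + (U - R) ω)) = fun ω => (R ω, U ω) := by
    ext1 ω
    simp
  rw [hRU] at hlaw
  have hsw : P.map (fun ω => (U ω, R ω)) = (P.map fun ω => (R ω, U ω)).map Prod.swap := by
    rw [Measure.map_map measurable_swap (hRm.prodMk hUm)]
    rfl
  have : IsProbabilityMeasure (P.map R) := Measure.isProbabilityMeasure_map hRm.aemeasurable
  rw [hsw, mutualInfo_swap, hlaw]
  refine mutualInfo_compProd_noiseChannel _ hQ hQE ?_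
  rw [← hlaw, ← h.source_law, Measure.snd, Measure.map_map measurable_snd (hRm.prodMk hUm)]
  rfl

/-- `G W + c` is the conditional mean of `Y` given `W`, since the remaining term is centred and
independent of `W`. -/
theorem condCov_rep (h : RealizationVars Q H QV QE U V W P)
    (hY : ∀ ω, Y ω = (toEuclideanLin G (W ω) + c) + (toEuclideanLin H (U ω) + V ω)) :
    condCov Y W P = Q - QE := by
  have hGW : Measurable fun w : Euc n => toEuclideanLin G w + c :=
    (matCLM G).continuous.measurable.add_const c
  have hR2 := h.memLp_rep
  have hW2 : MemLp (fun ω => toEuclideanLin G (W ω) + c) 2 P :=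
    (memLp_toEuclideanLin G h.memLp_side).add (memLp_const c)
  have hYm : Measurable Y := by
    rw [funext hY]
    exact (hGW.comp h.measurable_side).add h.measurable_rep
  have hY2 : MemLp Y 2 P := by
    rw [funext hY]
    exact hW2.add hR2
  have e : (fun ω => Y ω - (toEuclideanLin G (W ω) + c))
      = fun ω => toEuclideanLin H (U ω) + V ω := by
    ext1 ω
    rw [hY, add_sub_cancel_left]
  have h1 := condMean_ae_eq_of_indepFun (f := fun w : Euc n => toEuclideanLin G w + c)
    (hY2.integrable (by norm_num)) hYm h.measurable_side hGW (hW2.integrable (by norm_num))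
    (by
      rw [e]
      exact h.indepFun_side.comp (φ := Prod.snd) (ψ := id) measurable_snd measurable_id)
    (by
      rw [e]
      exact h.integral_rep)
  rw [← h.covMat_rep, ← e]
  refine covMat_congr ?_
  filter_upwards [h1] with ω hω
  rw [hω]

end RealizationVars

end Realization

end GrayWyner

namespace GrayWyner

/-! ### Existence of realization parameters. -/

section Params

open Matrix

variable {k : ℕ}

/-- Every error covariance between `0` and `Q` is realized. -/
theorem exists_realizationParams {Q QE : Matrix (Fin k) (Fin k) ℝ} (hQE : QE.PosSemidef)
    (hB : (Q - QE).PosSemidef) : ∃ H QV, RealizationParams Q H QV QE := by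
  have hQ : Q.PosSemidef := by
    have := hQE.add hB
    rwa [add_sub_cancel] at this
  -- On the kernel of `Q` the form of `Q - QE` equals minus that of `QE`; being also nonnegative it
  -- vanishes, so `Q - QE` factors through `Q`.
  obtain ⟨H, hH⟩ := exists_mul_eq_of_ker_le (A := Q) (B := Q - QE) (by
    intro v hv
    refine (hB.dotProduct_mulVec_zero_iff v).1 (le_antisymm ?_ (hB.dotProduct_mulVec_nonneg v))
    rw [sub_mulVec, hv, zero_sub, dotProduct_neg, neg_nonpos]
    exact hQE.dotProduct_mulVec_nonneg v)
  have hQt : Qᵀ = Q := hQ.1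
  have hBt : (Q - QE)ᵀ = Q - QE := hB.1
  have hcomm : H * Q = Q * Hᵀ := by
    rw [← hQt, ← transpose_mul, hQt, hH, hBt]
  refine ⟨H, H * Q - H * Q * Hᵀ, hH, hB, hcomm, rfl, ?_, hQ, hQE⟩
  -- This identity displays the noise covariance as a sum of two positive semidefinite matrices.
  have e : H * Q - H * Q * Hᵀ = (1 - H) * (Q - QE) * (1 - H)ᴴ + H * QE * Hᴴ := by
    have e1 : QE = Q - H * Q := by
      rw [hH, sub_sub_cancel]
    simp only [conjTranspose_eq_transpose_of_trivial, transpose_sub, transpose_one]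
    rw [e1, sub_sub_cancel]
    have e2 : H * Q * Hᵀ = H * (H * Q) := by
      rw [Matrix.mul_assoc, ← hcomm]
    noncomm_ring
    rw [← Matrix.mul_assoc H Q, e2]
  rw [e]
  exact (hB.mul_mul_conjTranspose_same _).add (hQE.mul_mul_conjTranspose_same _)

end Params

/-! ### Gaussian sources with Gaussian side information. -/

section Source

open Matrix

variable {Ω : Type*} [MeasurableSpace Ω] {P : Measure Ω} [IsProbabilityMeasure P] {k n : ℕ}

/-- The source `X` is `G W + c` plus a centred Gaussian variable independent of the Gaussian side
information `W`, whose covariance matrix is `Q_{X|W}`. -/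
structure GaussianSource (X : Ω → Euc k) (W : Ω → Euc n) (G : Matrix (Fin k) (Fin n) ℝ)
    (c : Euc k) (P : Measure Ω) : Prop where
  measurable_source : Measurable X
  measurable_side : Measurable W
  memLp : MemLp X 2 P
  gaussian_side : HasGaussianLaw W P
  indep : IndepFun (fun ω => X ω - (toEuclideanLin G (W ω) + c)) W P
  law : P.map (fun ω => X ω - (toEuclideanLin G (W ω) + c))
    = multivariateGaussian 0 (condCov X W P)
  psd : (condCov X W P).PosSemidef

/-- The regression residual is uncorrelated with `W`, hence independent by joint Gaussianity; `G W +
c` is then the conditional mean and the residual covariance is `Q_{X|W}`. -/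
theorem gaussianSource_of_crossCov_eq {X : Ω → Euc k} {W : Ω → Euc n}
    {G : Matrix (Fin k) (Fin n) ℝ} {c : Euc k} (hX : Measurable X) (hW : Measurable W)
    (h : HasGaussianLaw (fun ω => (X ω, W ω)) P) (hG : crossCov X W P = G * covMat W P)
    (h0 : ∫ ω, (X ω - (toEuclideanLin G (W ω) + c)) ∂P = 0) : GaussianSource X W G c P := by
  have hX2 : MemLp X 2 P := h.fst.memLp_two
  have hW2 : MemLp W 2 P := h.snd.memLp_two
  have hGW : Measurable fun w : Euc n => toEuclideanLin G w + c :=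
    (matCLM G).continuous.measurable.add_const c
  have hL2 : MemLp (fun ω => toEuclideanLin G (W ω)) 2 P := memLp_toEuclideanLin G hW2
  have hc2 : MemLp (fun _ : Ω => c) 2 P := memLp_const c
  have hGc2 : MemLp (fun ω => toEuclideanLin G (W ω) + c) 2 P := hL2.add hc2
  have hU2 : MemLp (fun ω => X ω - (toEuclideanLin G (W ω) + c)) 2 P := hX2.sub hGc2
  have hcov : crossCov (fun ω => X ω - (toEuclideanLin G (W ω) + c)) W P = 0 := by
    rw [crossCov_sub_left hX2 hGc2 hW2, crossCov_add_left hL2 hc2 hW2, crossCov_const_left,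
      add_zero, crossCov_toEuclideanLin_left G hW2 hW2, hG, covMat, sub_self]
  -- `W` is repeated only to fit the three-component independence criterion.
  have hlin : HasGaussianLaw (fun ω => (X ω - toEuclideanLin G (W ω), W ω, W ω)) P :=
    h.map_fun ((ContinuousLinearMap.fst ℝ (Euc k) (Euc n) - matCLM G ∘L .snd ℝ _ _).prod
      ((ContinuousLinearMap.snd ℝ (Euc k) (Euc n)).prod (.snd ℝ _ _)))
  have hjoint : HasGaussianLaw
      (fun ω => (X ω - (toEuclideanLin G (W ω) + c), W ω, W ω)) P := by
    convert! hasGaussianLaw_add_const hlin (-c, 0, 0) using 1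
    ext1 ω
    simp only [Prod.mk_add_mk, add_zero, Prod.mk.injEq, and_true]
    abel
  have hind : IndepFun (fun ω => X ω - (toEuclideanLin G (W ω) + c)) W P :=
    (indepFun_of_crossCov_eq_zero hjoint hcov hcov).comp (φ := id) (ψ := Prod.fst)
      measurable_id measurable_fst
  have hcm := condMean_ae_eq_of_indepFun (f := fun w : Euc n => toEuclideanLin G w + c)
    (hX2.integrable (by norm_num)) hX hW hGW (hGc2.integrable (by norm_num)) hind h0
  have hQ : condCov X W P = covMat (fun ω => X ω - (toEuclideanLin G (W ω) + c)) P := by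
    refine covMat_congr ?_
    filter_upwards [hcm] with ω hω
    rw [hω]
  refine ⟨hX, hW, hX2, h.snd, hind, ?_, ?_⟩
  · rw [hQ]
    exact map_eq_multivariateGaussian hjoint.fst h0
  · rw [hQ]
    exact posSemidef_covMat hU2

theorem exists_gaussianSource {X : Ω → Euc k} {W : Ω → Euc n} (hX : Measurable X)
    (hW : Measurable W) (h : HasGaussianLaw (fun ω => (X ω, W ω)) P) :
    ∃ G c, GaussianSource X W G c P := by
  obtain ⟨G, hG⟩ := exists_crossCov_eq_mul h.fst.memLp_two h.snd.memLp_two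
  refine ⟨G, ∫ ω, (X ω - toEuclideanLin G (W ω)) ∂P, gaussianSource_of_crossCov_eq hX hW h hG ?_⟩
  have hi : Integrable (fun ω => X ω - toEuclideanLin G (W ω)) P :=
    h.fst.integrable.sub ((memLp_toEuclideanLin G h.snd.memLp_two).integrable (by norm_num))
  simp_rw [← sub_sub]
  rw [integral_sub hi (integrable_const _)]
  simp

theorem gaussianSource_of_posDef {X : Ω → Euc k} {W : Ω → Euc n} (hX : Measurable X)
    (hW : Measurable W) (h : HasGaussianLaw (fun ω => (X ω, W ω)) P) (hX0 : ∫ ω, X ω ∂P = 0)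
    (hW0 : ∫ ω, W ω ∂P = 0) (hQW : (covMat W P).PosDef) :
    GaussianSource X W (crossCov X W P * (covMat W P)⁻¹) 0 P := by
  refine gaussianSource_of_crossCov_eq hX hW h ?_ ?_
  · rw [Matrix.mul_assoc, nonsing_inv_mul _ ((isUnit_iff_isUnit_det _).1 hQW.isUnit),
      Matrix.mul_one]
  · simp only [add_zero]
    have := (matCLM (crossCov X W P * (covMat W P)⁻¹)).integral_comp_comm h.snd.integrable
    rw [integral_sub h.fst.integrable
      ((memLp_toEuclideanLin _ h.snd.memLp_two).integrable (by norm_num)), hX0, zero_sub,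
      neg_eq_zero]
    refine this.trans ?_
    rw [hW0, map_zero]

namespace GaussianSource

variable {X : Ω → Euc k} {W : Ω → Euc n} {G : Matrix (Fin k) (Fin n) ℝ} {c : Euc k}
  {H QV QE : Matrix (Fin k) (Fin k) ℝ}

theorem measurable_map (G : Matrix (Fin k) (Fin n) ℝ) (c : Euc k) :
    Measurable fun w : Euc n => toEuclideanLin G w + c :=
  (matCLM G).continuous.measurable.add_const c

theorem condRDF_eq (h : GaussianSource X W G c P) {Δ : ℝ≥0∞} (hΔ : Δ ≠ ∞) :
    condRDF (pairLaw X W P) Δ = rdf (multivariateGaussian 0 (condCov X W P)) Δ := by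
  rw [condRDF_pairLaw_of_sub_indepFun h.measurable_source h.memLp h.measurable_side
    (measurable_map G c) h.indep hΔ, h.law]

theorem rdf_condDistrib (h : GaussianSource X W G c P) :
    ∀ᵐ w ∂(P.map W), ∀ D, rdf (condDistrib X W P w) D
      = rdf (multivariateGaussian 0 (condCov X W P)) D := by
  filter_upwards [rdf_condDistrib_of_sub_indepFun h.measurable_source h.measurable_side
    (measurable_map G c) h.indep] with w hw D
  rw [hw D, h.law]

theorem realizationVars (h : GaussianSource X W G c P)
    (hp : RealizationParams (condCov X W P) H QV QE) {V : Ω → Euc k} (hV : Measurable V)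
    (hVl : P.map V = multivariateGaussian 0 QV) (hVi : IndepFun V (fun ω => (X ω, W ω)) P) :
    RealizationVars (condCov X W P) H QV QE (fun ω => X ω - (toEuclideanLin G (W ω) + c)) V W P where
  params := hp
  measurable_source := h.measurable_source.sub ((measurable_map G c).comp h.measurable_side)
  measurable_noise := hV
  measurable_side := h.measurable_side
  source_law := h.law
  noise_law := hVl
  gaussian_side := h.gaussian_side
  indep_side := h.indep
  indep_noise := hVi.comp (φ := id)
    (ψ := fun p : Euc k × Euc n => (p.1 - (toEuclideanLin G p.2 + c), p.2)) measurable_id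
    ((measurable_fst.sub ((measurable_map G c).comp measurable_snd)).prodMk measurable_snd)

/-- The realization obtained by driving an additive noise channel by the source. -/
theorem realizationVars_compProd (h : GaussianSource X W G c P)
    (hp : RealizationParams (condCov X W P) H QV QE) (κ : Kernel (Euc k × Euc n) (Euc k))
    [IsMarkovKernel κ] {f : Euc k × Euc n → Euc k} (hf : Measurable f)
    (hκ : ∀ t, κ t = (multivariateGaussian (0 : Euc k) QV).map (f t + ·)) :
    RealizationVars (condCov X W P) H QV QE (fun z => src z - (toEuclideanLin G (side z) + c))
      (fun z => rep z - f z.1) side (pairLaw X W P ⊗ₘ κ) := by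
  have hXW : Measurable fun ω => (X ω, W ω) := h.measurable_source.prodMk h.measurable_side
  have : IsProbabilityMeasure (pairLaw X W P) := Measure.isProbabilityMeasure_map hXW.aemeasurable
  have hm : Measurable fun p : Euc k × Euc n => p.1 - (toEuclideanLin G p.2 + c) :=
    measurable_fst.sub ((measurable_map G c).comp measurable_snd)
  obtain ⟨hl, hi⟩ := indepFun_noise (pairLaw X W P) hf (multivariateGaussian (0 : Euc k) QV) κ hκ
  have hfst : (pairLaw X W P ⊗ₘ κ).map Prod.fst = P.map fun ω => (X ω, W ω) := compProd_map_fst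
  refine ⟨hp, hm.comp measurable_fst, measurable_snd.sub (hf.comp measurable_fst),
    GrayWyner.measurable_side, ?_, hl, ⟨?_⟩, ?_, ?_⟩
  · have e : (fun z : (Euc k × Euc n) × Euc k => src z - (toEuclideanLin G (side z) + c))
      = (fun p : Euc k × Euc n => p.1 - (toEuclideanLin G p.2 + c)) ∘ Prod.fst := rfl
    rw [e, ← Measure.map_map hm measurable_fst, hfst, Measure.map_map hm hXW, ← h.law]
    rfl
  · rw [compProd_map_side, pairLaw_map_snd h.measurable_source h.measurable_side]
    exact h.gaussian_side.isGaussian_map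
  · have h1 : IndepFun (fun p : Euc k × Euc n => p.1 - (toEuclideanLin G p.2 + c)) Prod.snd
        ((pairLaw X W P ⊗ₘ κ).map Prod.fst) := by
      rw [hfst]
      exact (indepFun_map_iff hXW hm measurable_snd).2 h.indep
    exact (indepFun_map_iff measurable_fst hm measurable_snd).1 h1
  · exact hi.comp (φ := id)
      (ψ := fun p : Euc k × Euc n => (p.1 - (toEuclideanLin G p.2 + c), p.2)) measurable_id
      (hm.prodMk measurable_snd)

end GaussianSource

end Source

end GrayWyner

namespace GrayWyner

/-! ### Compactness of the set of error covariances and an optimal one. -/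

section Compactness

open Matrix

variable {k : ℕ}

/-- Testing positivity on `e_i ± e_j` gives `2 |A i j| ≤ A i i + A j j`. -/
theorem abs_apply_le_trace {A : Matrix (Fin k) (Fin k) ℝ} (hA : A.PosSemidef) (i j : Fin k) :
    |A i j| ≤ A.trace := by
  have hd : ∀ i, A i i ≤ A.trace := fun i =>
    Finset.single_le_sum (f := fun i => A i i) (fun i _ => hA.diag_nonneg) (Finset.mem_univ i)
  have hs : A j i = A i j := by
    have := congrFun (congrFun hA.1 i) j
    simpa using this
  have h1 := hA.dotProduct_mulVec_nonneg (Pi.single i 1 + Pi.single j 1)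
  have h2 := hA.dotProduct_mulVec_nonneg (Pi.single i 1 - Pi.single j 1)
  simp only [star_trivial, mulVec_add, mulVec_sub, dotProduct_add, add_dotProduct, dotProduct_sub,
    sub_dotProduct, mulVec_single_one, single_one_dotProduct, col_apply, hs] at h1 h2
  rw [abs_le]
  constructor <;> linarith [hd i, hd j]

theorem isClosed_setOf_posSemidef :
    IsClosed {A : Matrix (Fin k) (Fin k) ℝ | A.PosSemidef} := by
  have e : {A : Matrix (Fin k) (Fin k) ℝ | A.PosSemidef}
      = {A | Aᵀ = A} ∩ ⋂ v : Euc k, {A | 0 ≤ quadForm A v} := by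
    ext A
    simp only [Set.mem_ofPred_eq, Set.mem_inter_iff, Set.mem_iInter]
    exact ⟨fun h => ⟨h.1, (posSemidef_iff_quadForm h.1).1 h⟩,
      fun h => (posSemidef_iff_quadForm h.1).2 h.2⟩
  rw [e]
  refine (isClosed_eq (by fun_prop) continuous_id).inter (isClosed_iInter fun v => ?_)
  refine isClosed_le continuous_const ?_
  simp_rw [quadForm_eq_sum]
  fun_prop

theorem isCompact_errorCov (Q : Matrix (Fin k) (Fin k) ℝ) (Δ : ℝ) :
    IsCompact {A : Matrix (Fin k) (Fin k) ℝ | A.PosSemidef ∧ (Q - A).PosSemidef ∧ A.trace ≤ Δ} := by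
  have hbox : IsCompact (Set.pi Set.univ fun _ : Fin k => Set.pi Set.univ fun _ : Fin k =>
      Set.Icc (-Δ) Δ) :=
    isCompact_univ_pi fun _ => isCompact_univ_pi fun _ => isCompact_Icc
  refine IsCompact.of_isClosed_subset hbox ?_ ?_
  · refine isClosed_setOf_posSemidef.inter (IsClosed.inter ?_ ?_)
    · exact isClosed_setOf_posSemidef.preimage
        (f := fun A : Matrix (Fin k) (Fin k) ℝ => Q - A) (by fun_prop)
    · exact isClosed_le (f := fun A : Matrix (Fin k) (Fin k) ℝ => A.trace) (by fun_prop)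
        continuous_const
  · rintro A ⟨h1, -, h3⟩ i - j -
    exact abs_le.1 ((abs_apply_le_trace h1 i j).trans h3)

theorem gaussianRate_anti {Q S S' : Matrix (Fin k) (Fin k) ℝ} (hQ : Q.PosDef) (hS : S.PosDef)
    (h : S.det ≤ S'.det) : gaussianRate Q S' ≤ gaussianRate Q S := by
  unfold gaussianRate
  refine ENNReal.ofReal_le_ofReal (mul_le_mul_of_nonneg_left ?_ (by norm_num))
  refine Real.log_le_log (lt_max_of_lt_left one_pos) (max_le_max le_rfl ?_)
  exact div_le_div_of_nonneg_left hQ.det_pos.le hS.det_pos h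

/-- Minimizing the rate amounts to maximizing the determinant, which is attained on the compact set
including singular matrices; a small multiple of `Q` shows that the maximum is positive, so the
maximizer is nonsingular. -/
theorem exists_gaussianRate_minimizer {Q : Matrix (Fin k) (Fin k) ℝ} (hQ : Q.PosDef) {Δ : ℝ}
    (hΔ : 0 < Δ) :
    ∃ QE : Matrix (Fin k) (Fin k) ℝ, QE.PosDef ∧ (Q - QE).PosSemidef ∧ QE.trace ≤ Δ ∧
      ∀ S : Matrix (Fin k) (Fin k) ℝ, S.PosDef → (Q - S).PosSemidef → S.trace ≤ Δ →
        gaussianRate Q QE ≤ gaussianRate Q S := by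
  have htr : 0 ≤ Q.trace := hQ.posSemidef.trace_nonneg
  -- The minimum with `1` keeps `s Q` below `Q`, the other term keeps its trace below `Δ`; the added
  -- `1` covers trace zero, as in dimension `0`.
  set s : ℝ := min 1 (Δ / (Q.trace + 1)) with hs
  have hs0 : 0 < s := lt_min one_pos (by positivity)
  have hs1 : s ≤ 1 := min_le_left _ _
  have hsQ : (s • Q).PosDef := hQ.smul hs0
  have hmem : s • Q ∈ {A : Matrix (Fin k) (Fin k) ℝ |
      A.PosSemidef ∧ (Q - A).PosSemidef ∧ A.trace ≤ Δ} := by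
    refine ⟨hsQ.posSemidef, ?_, ?_⟩
    · have := hQ.posSemidef.smul (sub_nonneg.2 hs1)
      rwa [sub_smul, one_smul] at this
    · rw [trace_smul, smul_eq_mul]
      calc s * Q.trace ≤ Δ / (Q.trace + 1) * (Q.trace + 1) :=
            mul_le_mul (min_le_right _ _) (by linarith) htr (by positivity)
        _ = Δ := div_mul_cancel₀ _ (by positivity)
  obtain ⟨QE, ⟨h1, h2, h3⟩, hmax⟩ := (isCompact_errorCov Q Δ).exists_isMaxOn ⟨_, hmem⟩
    (f := fun A => A.det) (Continuous.continuousOn (by fun_prop))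
  have hpos : 0 < QE.det := hsQ.det_pos.trans_le (hmax hmem)
  have hPD : QE.PosDef := h1.posDef_iff_det_ne_zero.2 hpos.ne'
  exact ⟨QE, hPD, h2, h3, fun S hS hSQ hSΔ =>
    gaussianRate_anti hQ hS (hmax ⟨hS.posSemidef, hSQ, hSΔ⟩)⟩

end Compactness

/-! ### Gaussian sources: tightness of the bounds and the rate formula. -/

section Source

open Matrix

variable {Ω : Type*} [MeasurableSpace Ω] {P : Measure Ω} [IsProbabilityMeasure P] {k n : ℕ}

/-- Reproducing the mean `0` costs no information and has distortion `tr Q`. -/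
theorem rdf_multivariateGaussian_trace {Q : Matrix (Fin k) (Fin k) ℝ} (hQ : Q.PosSemidef) :
    rdf (multivariateGaussian 0 Q) (ENNReal.ofReal Q.trace) = 0 := by
  refine le_antisymm ?_ bot_le
  have h := rdf_le (ν := multivariateGaussian 0 Q) (D := ENNReal.ofReal Q.trace)
    (κ := Kernel.const _ (Measure.dirac (0 : Euc k))) (by
      rw [mse, Measure.lintegral_compProd (by fun_prop),
        ← lintegral_enorm_sq_multivariateGaussian hQ]
      simp)
  refine h.trans (le_of_eq ?_)
  rw [mutualInfo, Measure.compProd_const, Measure.fst_prod, Measure.snd_prod]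
  simp

theorem toEuclideanLin_one_sub_mul (H : Matrix (Fin k) (Fin k) ℝ) (G : Matrix (Fin k) (Fin n) ℝ)
    (w : Euc n) : toEuclideanLin ((1 - H) * G) w
      = toEuclideanLin G w - toEuclideanLin H (toEuclideanLin G w) := by
  ext i
  simp [toLpLin_apply, Matrix.sub_mul, mulVec_mulVec]

namespace GaussianSource

variable {X : Ω → Euc k} {W : Ω → Euc n} {G : Matrix (Fin k) (Fin n) ℝ} {c : Euc k}
  {H QV QE : Matrix (Fin k) (Fin k) ℝ}

theorem cmProfile_ae_eq (h : GaussianSource X W G c P) (κ : Kernel (Euc k × Euc n) (Euc k))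
    [IsMarkovKernel κ] (hκ : GaussianStructural src rep side (pairLaw X W P ⊗ₘ κ)) :
    ∀ᵐ w ∂(P.map W), cmProfile (pairLaw X W P) κ w = mse src rep (pairLaw X W P ⊗ₘ κ) := by
  have : IsProbabilityMeasure (pairLaw X W P) :=
    Measure.isProbabilityMeasure_map (h.measurable_source.prodMk h.measurable_side).aemeasurable
  have h1 := (hκ.ae_eq_const measurable_src measurable_rep GrayWyner.measurable_side).2.1
  rw [compProd_map_side, pairLaw_map_snd h.measurable_source h.measurable_side] at h1
  exact h1

/-- A Gaussian test channel with the structural property and error covariance `QE`. -/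
theorem exists_gaussianStructural (h : GaussianSource X W G c P) (hQE : QE.PosSemidef)
    (hB : (condCov X W P - QE).PosSemidef) :
    ∃ (κ : Kernel (Euc k × Euc n) (Euc k)) (_ : IsMarkovKernel κ),
      GaussianStructural src rep side (pairLaw X W P ⊗ₘ κ) ∧
      mse src rep (pairLaw X W P ⊗ₘ κ) = ENNReal.ofReal QE.trace := by
  have : IsProbabilityMeasure (pairLaw X W P) :=
    Measure.isProbabilityMeasure_map (h.measurable_source.prodMk h.measurable_side).aemeasurable
  obtain ⟨H, QV, hp⟩ := exists_realizationParams hQE hB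
  -- `H` acts on the residual only, so the offset `c` of a source with nonzero means is reproduced
  -- exactly.
  let f : Euc k × Euc n → Euc k := fun t => (toEuclideanLin G t.2 + c)
    + toEuclideanLin H (t.1 - (toEuclideanLin G t.2 + c))
  have hf : Measurable f := by
    have h1 : Measurable fun t : Euc k × Euc n => toEuclideanLin G t.2 + c :=
      (measurable_map G c).comp measurable_snd
    exact h1.add ((matCLM H).continuous.measurable.comp (measurable_fst.sub h1))
  have hR := h.realizationVars_compProd hp ((noiseChannel QV).comap f hf) hf (by
    intro t
    rw [Kernel.comap_apply, noiseChannel_apply, multivariateGaussian_map_add])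
  have hX : ∀ z : (Euc k × Euc n) × Euc k, src z = (toEuclideanLin G (side z) + c)
      + (src z - (toEuclideanLin G (side z) + c)) := fun z => (add_sub_cancel _ _).symm
  have hY : ∀ z : (Euc k × Euc n) × Euc k, rep z = (toEuclideanLin G (side z) + c)
      + (toEuclideanLin H (src z - (toEuclideanLin G (side z) + c)) + (rep z - f z.1)) := by
    intro z
    rw [← add_assoc]
    exact (add_sub_cancel _ _).symm
  exact ⟨_, inferInstance, hR.gaussianStructural hX hY, hR.mse_eq hX hY⟩

/-- Only the trace of `QE` matters here, so a multiple of `Q` with trace `Δ` suffices; once `Δ`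
reaches `tr Q` the rate is already zero and `Q` itself is taken. -/
theorem exists_psd_trace_eq {Q : Matrix (Fin k) (Fin k) ℝ} (hQ : Q.PosSemidef) (Δ : ℝ≥0) :
    ∃ QE : Matrix (Fin k) (Fin k) ℝ, QE.PosSemidef ∧ (Q - QE).PosSemidef ∧ QE.trace ≤ Δ ∧
      rdf (multivariateGaussian 0 Q) (ENNReal.ofReal QE.trace)
        ≤ rdf (multivariateGaussian 0 Q) Δ := by
  rcases le_or_gt Q.trace Δ with hle | hlt
  · refine ⟨Q, hQ, by rw [sub_self]; exact PosSemidef.zero, hle, ?_⟩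
    rw [rdf_multivariateGaussian_trace hQ]
    exact bot_le
  · have hpos : 0 < Q.trace := Δ.2.trans_lt hlt
    have htr : ((Δ / Q.trace) • Q).trace = Δ := by
      rw [trace_smul, smul_eq_mul, div_mul_cancel₀ _ hpos.ne']
    refine ⟨(Δ / Q.trace) • Q, hQ.smul (by positivity), ?_, htr.le, ?_⟩
    · have := hQ.smul (sub_nonneg.2 ((div_le_one hpos).2 hlt.le))
      rwa [sub_smul, one_smul] at this
    · rw [htr, ENNReal.ofReal_coe_nnreal]

/-- The bound by the essential infimum over `w` is tight over Gaussian test channels. -/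
theorem condRDF_eq_iInf_essInf (h : GaussianSource X W G c P) (Δ : ℝ≥0) :
    condRDF (pairLaw X W P) Δ
      = (⨅ (κ : Kernel (Euc k × Euc n) (Euc k)) (_ : IsMarkovKernel κ)
          (_ : GaussianStructural src rep side (pairLaw X W P ⊗ₘ κ))
          (_ : ∫⁻ w, cmProfile (pairLaw X W P) κ w ∂(P.map W) ≤ Δ),
          essInf (fun w =>
            rdf (condDistrib X W P w) (cmProfile (pairLaw X W P) κ w)) (P.map W)) := by
  have : IsProbabilityMeasure (P.map W) :=
    Measure.isProbabilityMeasure_map h.measurable_side.aemeasurable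
  rw [h.condRDF_eq ENNReal.coe_ne_top]
  -- For these channels the profile is almost surely constant, so both its integral and the
  -- essential infimum reduce to the unconditional mean square error.
  have key : ∀ (κ : Kernel (Euc k × Euc n) (Euc k)) (_ : IsMarkovKernel κ)
      (_ : GaussianStructural src rep side (pairLaw X W P ⊗ₘ κ)),
      (∫⁻ w, cmProfile (pairLaw X W P) κ w ∂(P.map W) = mse src rep (pairLaw X W P ⊗ₘ κ)) ∧
      essInf (fun w => rdf (condDistrib X W P w) (cmProfile (pairLaw X W P) κ w)) (P.map W)
        = rdf (multivariateGaussian 0 (condCov X W P)) (mse src rep (pairLaw X W P ⊗ₘ κ)) := by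
    intro κ hκ hS
    have h1 := h.cmProfile_ae_eq κ hS
    refine ⟨lintegral_eq_of_ae_eq_const _ h1, essInf_eq_of_ae_eq_const _ ?_⟩
    filter_upwards [h1, h.rdf_condDistrib] with w e1 e2
    rw [e2, e1]
  refine le_antisymm ?_ ?_
  · refine le_iInf fun κ => le_iInf fun hκ => le_iInf fun hS => le_iInf fun hD => ?_
    obtain ⟨e1, e2⟩ := key κ hκ hS
    rw [e2]
    rw [e1] at hD
    exact rdf_antitone _ hD
  · obtain ⟨QE, hQE, hB, htr, hle⟩ := exists_psd_trace_eq h.psd Δ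
    obtain ⟨κ, hκ, hS, hm⟩ := h.exists_gaussianStructural hQE hB
    obtain ⟨e1, e2⟩ := key κ hκ hS
    refine le_trans ?_ hle
    rw [← hm, ← e2]
    refine iInf_le_of_le κ (iInf_le_of_le hκ (iInf_le_of_le hS (iInf_le_of_le ?_ le_rfl)))
    rw [e1, hm]
    exact ENNReal.ofReal_le_of_le_toReal htr

/-- The rate distortion function is antitone, so the infimum is its value at `Δ`. -/
theorem condRDF_eq_iInf_const (h : GaussianSource X W G c P) (Δ : ℝ≥0) :
    ∀ᵐ w ∂(P.map W), condRDF (pairLaw X W P) Δ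
      = ⨅ (δ : ℝ≥0) (_ : δ ≤ Δ), rdf (condDistrib X W P w) δ := by
  filter_upwards [h.rdf_condDistrib] with w hw
  rw [h.condRDF_eq ENNReal.coe_ne_top, ← hw]
  exact le_antisymm (le_iInf fun δ => le_iInf fun hδ => rdf_antitone _ (by exact_mod_cast hδ))
    (iInf_le_of_le Δ (iInf_le _ le_rfl))

theorem realizationVars_gaussianChannel (h : GaussianSource X W G c P)
    (hp : RealizationParams (condCov X W P) H QV QE) :
    RealizationVars (condCov X W P) H QV QE (fun z => src z - (toEuclideanLin G (side z) + c))
      (fun z => rep z - (toEuclideanLin H (src z) + toEuclideanLin ((1 - H) * G) (side z))) side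
      (pairLaw X W P ⊗ₘ gaussianChannel H G QV) := by
  have hf : Measurable fun t : Euc k × Euc n =>
      toEuclideanLin H t.1 + toEuclideanLin ((1 - H) * G) t.2 :=
    ((matCLM H).continuous.measurable.comp measurable_fst).add
      ((matCLM ((1 - H) * G)).continuous.measurable.comp measurable_snd)
  exact h.realizationVars_compProd hp _ hf (gaussianChannel_apply H G QV)

/-- The properties of the Gaussian test channel of a realization. -/
theorem realization_compProd (h : GaussianSource X W G 0 P)
    (hp : RealizationParams (condCov X W P) H QV QE) :
    GaussianStructural src rep side (pairLaw X W P ⊗ₘ gaussianChannel H G QV) ∧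
    AttainsLowerBounds src rep side (pairLaw X W P ⊗ₘ gaussianChannel H G QV) ∧
    mse src rep (pairLaw X W P ⊗ₘ gaussianChannel H G QV) = ENNReal.ofReal QE.trace ∧
    (QE.PosDef → condMutualInfo src rep side (pairLaw X W P ⊗ₘ gaussianChannel H G QV)
      = gaussianRate (condCov X W P) QE) := by
  have : IsProbabilityMeasure (pairLaw X W P) :=
    Measure.isProbabilityMeasure_map (h.measurable_source.prodMk h.measurable_side).aemeasurable
  have hR := h.realizationVars_gaussianChannel hp
  have hX : ∀ z : (Euc k × Euc n) × Euc k, src z = (toEuclideanLin G (side z) + 0)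
      + (src z - (toEuclideanLin G (side z) + 0)) := fun z => (add_sub_cancel _ _).symm
  have hY : ∀ z : (Euc k × Euc n) × Euc k, rep z = (toEuclideanLin G (side z) + 0)
      + (toEuclideanLin H (src z - (toEuclideanLin G (side z) + 0)) + (rep z
        - (toEuclideanLin H (src z) + toEuclideanLin ((1 - H) * G) (side z)))) := by
    intro z
    rw [toEuclideanLin_one_sub_mul, add_zero, _root_.map_sub]
    abel
  have hS := hR.gaussianStructural hX hY
  exact ⟨hS, (hS.ae_eq_const measurable_src measurable_rep GrayWyner.measurable_side).2.2,
    hR.mse_eq hX hY, hR.condMutualInfo_eq hX hY⟩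

/-- The properties of a realization `Y = H X + (I - H) G W + V`. -/
theorem realization (h : GaussianSource X W G 0 P)
    (hp : RealizationParams (condCov X W P) H QV QE) {V Y : Ω → Euc k} (hV : Measurable V)
    (hVl : HasLaw V (multivariateGaussian 0 QV) P) (hVi : IndepFun V (fun ω => (X ω, W ω)) P)
    (hY : ∀ ω, Y ω = reproduce H G (X ω) (W ω) (V ω)) :
    P.map (fun ω => ((X ω, W ω), Y ω)) = pairLaw X W P ⊗ₘ gaussianChannel H G QV ∧
    GaussianStructural X Y W P ∧
    HasLaw (fun ω => X ω - Y ω) (multivariateGaussian 0 QE) P ∧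
    condCov Y W P = condCov X W P - QE ∧
    AttainsLowerBounds X Y W P ∧
    mse X Y P = ENNReal.ofReal QE.trace ∧
    (QE.PosDef → condMutualInfo X Y W P = gaussianRate (condCov X W P) QE) := by
  have hXW : Measurable fun ω => (X ω, W ω) := h.measurable_source.prodMk h.measurable_side
  have hf : Measurable fun t : Euc k × Euc n =>
      toEuclideanLin H t.1 + toEuclideanLin ((1 - H) * G) t.2 :=
    ((matCLM H).continuous.measurable.comp measurable_fst).add
      ((matCLM ((1 - H) * G)).continuous.measurable.comp measurable_snd)
  have hYm : Measurable Y := by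
    rw [funext hY]
    exact (hf.comp hXW).add hV
  have hR := h.realizationVars hp hV hVl.map_eq hVi
  have hX' : ∀ ω, X ω = (toEuclideanLin G (W ω) + 0) + (X ω - (toEuclideanLin G (W ω) + 0)) :=
    fun ω => (add_sub_cancel _ _).symm
  have hY' : ∀ ω, Y ω = (toEuclideanLin G (W ω) + 0)
      + (toEuclideanLin H (X ω - (toEuclideanLin G (W ω) + 0)) + V ω) := by
    intro ω
    rw [hY, reproduce, toEuclideanLin_one_sub_mul, add_zero, _root_.map_sub]
    abel
  have hS := hR.gaussianStructural hX' hY'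
  refine ⟨?_, hS, ⟨(h.measurable_source.sub hYm).aemeasurable, hR.map_sub hX' hY'⟩,
    hR.condCov_rep hY', (hS.ae_eq_const h.measurable_source hYm h.measurable_side).2.2,
    hR.mse_eq hX' hY', hR.condMutualInfo_eq hX' hY'⟩
  rw [funext hY]
  refine map_prodMk_add_eq_compProd hXW hV hf hVi (gaussianChannel H G QV) ?_
  rw [hVl.map_eq]
  exact gaussianChannel_apply H G QV

/-- The conditional rate distortion function as an infimum over error covariances. -/
theorem condRDF_eq_iInf_gaussianRate (h : GaussianSource X W G 0 P)
    (hQ : (condCov X W P).PosDef) (Δ : ℝ≥0) :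
    condRDF (pairLaw X W P) Δ = (⨅ (QE : Matrix (Fin k) (Fin k) ℝ) (_ : QE.PosDef)
      (_ : (condCov X W P - QE).PosSemidef) (_ : QE.trace ≤ Δ),
      gaussianRate (condCov X W P) QE) := by
  refine le_antisymm ?_ ?_
  · refine le_iInf fun QE => le_iInf fun hPD => le_iInf fun hB => le_iInf fun htr => ?_
    obtain ⟨H, QV, hp⟩ := exists_realizationParams hPD.posSemidef hB
    obtain ⟨-, -, hm, hI⟩ := h.realization_compProd hp
    rw [← hI hPD]
    refine iInf_le_of_le _ (iInf_le_of_le inferInstance (iInf_le_of_le ?_ le_rfl))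
    rw [hm]
    exact ENNReal.ofReal_le_of_le_toReal htr
  · rw [h.condRDF_eq ENNReal.coe_ne_top]
    refine le_iInf fun κ => le_iInf fun hκ => le_iInf fun hD => ?_
    -- Finite information is what makes the error covariance in the converse nonsingular; infinite
    -- information bounds trivially.
    by_cases hI : mutualInfo (multivariateGaussian 0 (condCov X W P) ⊗ₘ κ) = ∞
    · rw [hI]
      exact le_top
    obtain ⟨QE, hPD, hB, htr, hle⟩ := exists_gaussianRate_le hQ
      (multivariateGaussian 0 (condCov X W P) ⊗ₘ κ) (Measure.fst_compProd _ _) hD hI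
    exact iInf_le_of_le QE (iInf_le_of_le hPD (iInf_le_of_le hB (iInf_le_of_le htr hle)))

theorem exists_realization_attaining (h : GaussianSource X W G 0 P)
    (hQ : (condCov X W P).PosDef) {Δ : ℝ≥0} (hΔ : 0 < Δ) :
    ∃ H QV QE, RealizationParams (condCov X W P) H QV QE ∧ QE.PosDef ∧ QE.trace ≤ Δ ∧
      condRDF (pairLaw X W P) Δ = gaussianRate (condCov X W P) QE ∧
      mse src rep (pairLaw X W P ⊗ₘ gaussianChannel H G QV) ≤ Δ ∧
      condMutualInfo src rep side (pairLaw X W P ⊗ₘ gaussianChannel H G QV)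
        = condRDF (pairLaw X W P) Δ := by
  obtain ⟨QE, hPD, hB, htr, hmin⟩ := exists_gaussianRate_minimizer hQ (Δ := Δ) hΔ
  obtain ⟨H, QV, hp⟩ := exists_realizationParams hPD.posSemidef hB
  obtain ⟨-, -, hm, hI⟩ := h.realization_compProd hp
  have hR : condRDF (pairLaw X W P) Δ = gaussianRate (condCov X W P) QE := by
    rw [h.condRDF_eq_iInf_gaussianRate hQ]
    exact le_antisymm (iInf_le_of_le QE (iInf_le_of_le hPD (iInf_le_of_le hB (iInf_le _ htr))))
      (le_iInf fun S => le_iInf fun hS => le_iInf fun hSB => le_iInf fun hSt => hmin S hS hSB hSt)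
  refine ⟨H, QV, QE, hp, hPD, htr, hR, ?_, (hI hPD).trans hR.symm⟩
  rw [hm]
  exact ENNReal.ofReal_le_of_le_toReal htr

end GaussianSource

end Source

end GrayWyner

/-! ### The theorem. -/

open GrayWyner in
theorem theorem2 {Ω : Type*} [MeasurableSpace Ω] (P : Measure Ω) [IsProbabilityMeasure P]
    (p : Fin 2 → ℕ) (X : (i : Fin 2) → Ω → Euc (p i)) (hX : ∀ i, Measurable (X i))
    (hXgauss : HasGaussianLaw (fun ω => (X 0 ω, X 1 ω)) P)
    (hXmean : ∀ i, ∫ ω, X i ω ∂P = 0)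
    (hXcov : (jointCov (X 0) (X 1) P).PosDef) :
    -- lower bounds for an arbitrary auxiliary random variable `W`
    (∀ (𝕎 : Type*) [MeasurableSpace 𝕎] (W : Ω → 𝕎), Measurable W → ∀ i : Fin 2,
      -- arbitrary reproductions
      (∀ Y : Ω → Euc (p i), Measurable Y →
        condMutualInfo (X i) (cmRep (X i) Y W P) W P ≤ condMutualInfo (X i) Y W P ∧
        mse (X i) (cmRep (X i) Y W P) P ≤ mse (X i) Y P ∧
        (Structural (X i) Y W P →
          condMutualInfo (X i) Y W P = condMutualInfo (X i) (cmRep (X i) Y W P) W P ∧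
          mse (X i) Y P = mse (X i) (cmRep (X i) Y W P) P) ∧
        ∫⁻ w, mutualInfoAt (X i) (cmRep (X i) Y W P) W P w ∂(P.map W)
          ≤ condMutualInfo (X i) Y W P ∧
        essInf (mutualInfoAt (X i) (cmRep (X i) Y W P) W P) (P.map W)
          ≤ ∫⁻ w, mutualInfoAt (X i) (cmRep (X i) Y W P) W P w ∂(P.map W) ∧
        mse (X i) Y P = ∫⁻ w, mseAt (X i) Y W P w ∂(P.map W) ∧
        ∫⁻ w, mseAt (X i) (cmRep (X i) Y W P) W P w ∂(P.map W)
          ≤ ∫⁻ w, mseAt (X i) Y W P w ∂(P.map W) ∧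
        essInf (mseAt (X i) (cmRep (X i) Y W P) W P) (P.map W)
          ≤ ∫⁻ w, mseAt (X i) (cmRep (X i) Y W P) W P w ∂(P.map W) ∧
        (Structural (X i) Y W P →
          (∃ c, ∀ᵐ w ∂(P.map W), mutualInfoAt (X i) (cmRep (X i) Y W P) W P w = c) →
          (∃ d, ∀ᵐ w ∂(P.map W), mseAt (X i) (cmRep (X i) Y W P) W P w = d) →
          AttainsLowerBounds (X i) Y W P)) ∧
      -- the conditional rate distortion function
      (∀ Δ : ℝ≥0,
        (0 < Δ → condRDF (pairLaw (X i) W P) Δ < ∞) ∧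
        condRDF (pairLaw (X i) W P) Δ
          = (⨅ (δ : 𝕎 → ℝ≥0∞) (_ : Measurable δ) (_ : ∫⁻ w, δ w ∂(P.map W) ≤ Δ),
              ∫⁻ w, rdf (condDistrib (X i) W P w) (δ w) ∂(P.map W)) ∧
        (⨅ (κ : Kernel (Euc (p i) × 𝕎) (Euc (p i))) (_ : IsMarkovKernel κ)
            (_ : ∫⁻ w, cmProfile (pairLaw (X i) W P) κ w ∂(P.map W) ≤ Δ),
            ∫⁻ w, rdf (condDistrib (X i) W P w) (cmProfile (pairLaw (X i) W P) κ w) ∂(P.map W))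
          ≤ condRDF (pairLaw (X i) W P) Δ ∧
        (⨅ (κ : Kernel (Euc (p i) × 𝕎) (Euc (p i))) (_ : IsMarkovKernel κ)
            (_ : ∫⁻ w, cmProfile (pairLaw (X i) W P) κ w ∂(P.map W) ≤ Δ),
            essInf (fun w =>
              rdf (condDistrib (X i) W P w) (cmProfile (pairLaw (X i) W P) κ w)) (P.map W))
          ≤ (⨅ (κ : Kernel (Euc (p i) × 𝕎) (Euc (p i))) (_ : IsMarkovKernel κ)
            (_ : ∫⁻ w, cmProfile (pairLaw (X i) W P) κ w ∂(P.map W) ≤ Δ),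
            ∫⁻ w, rdf (condDistrib (X i) W P w)
              (cmProfile (pairLaw (X i) W P) κ w) ∂(P.map W)))) ∧
    -- the lower bounds are achieved in the jointly Gaussian case
    (∀ (n : ℕ) (W : Ω → Euc n), Measurable W → ∀ i : Fin 2,
      (∀ Y : Ω → Euc (p i), Measurable Y → GaussianStructural (X i) Y W P →
        (∀ᵐ w ∂(P.map W), mutualInfoAt (X i) (cmRep (X i) Y W P) W P w
          = condMutualInfo (X i) Y W P) ∧
        (∀ᵐ w ∂(P.map W), mseAt (X i) (cmRep (X i) Y W P) W P w = mse (X i) Y P) ∧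
        AttainsLowerBounds (X i) Y W P) ∧
      (HasGaussianLaw (fun ω => (X i ω, W ω)) P → ∀ Δ : ℝ≥0,
        condRDF (pairLaw (X i) W P) Δ
          = (⨅ (κ : Kernel (Euc (p i) × Euc n) (Euc (p i))) (_ : IsMarkovKernel κ)
              (_ : GaussianStructural src rep side (pairLaw (X i) W P ⊗ₘ κ))
              (_ : ∫⁻ w, cmProfile (pairLaw (X i) W P) κ w ∂(P.map W) ≤ Δ),
              essInf (fun w =>
                rdf (condDistrib (X i) W P w) (cmProfile (pairLaw (X i) W P) κ w)) (P.map W)) ∧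
        ∀ᵐ w ∂(P.map W), condRDF (pairLaw (X i) W P) Δ
          = ⨅ (δ : ℝ≥0) (_ : δ ≤ Δ), rdf (condDistrib (X i) W P w) δ)) ∧
    -- explicit realization, for `(X i, W)` jointly Gaussian with mean zero and `Q_W ≻ 0`
    (∀ (n : ℕ) (W : Ω → Euc n), Measurable W → ∀ i : Fin 2,
      HasGaussianLaw (fun ω => (X i ω, W ω)) P → ∫ ω, W ω ∂P = 0 → (covMat W P).PosDef →
      -- every admissible choice of parameters gives a realization with the stated properties
      (∀ H QV QE : Matrix (Fin (p i)) (Fin (p i)) ℝ,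
        RealizationParams (condCov (X i) W P) H QV QE →
        (∀ V Y : Ω → Euc (p i), Measurable V →
          HasLaw V (multivariateGaussian 0 QV) P →
          IndepFun V (fun ω => (X i ω, W ω)) P →
          (∀ ω, Y ω = reproduce H (crossCov (X i) W P * (covMat W P)⁻¹) (X i ω) (W ω) (V ω)) →
          P.map (fun ω => ((X i ω, W ω), Y ω)) = realizationLaw (X i) W P H QV ∧
          GaussianStructural (X i) Y W P ∧
          HasLaw (fun ω => X i ω - Y ω) (multivariateGaussian 0 QE) P ∧
          condCov Y W P = condCov (X i) W P - QE ∧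
          AttainsLowerBounds (X i) Y W P ∧
          mse (X i) Y P = ENNReal.ofReal QE.trace ∧
          (QE.PosDef → condMutualInfo (X i) Y W P = gaussianRate (condCov (X i) W P) QE)) ∧
        (GaussianStructural src rep side (realizationLaw (X i) W P H QV) ∧
          AttainsLowerBounds src rep side (realizationLaw (X i) W P H QV) ∧
          mse src rep (realizationLaw (X i) W P H QV) = ENNReal.ofReal QE.trace ∧
          (QE.PosDef → condMutualInfo src rep side (realizationLaw (X i) W P H QV)
            = gaussianRate (condCov (X i) W P) QE))) ∧
      -- every error covariance between `0` and `Q_{X|W}` is realized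
      (∀ QE : Matrix (Fin (p i)) (Fin (p i)) ℝ, QE.PosSemidef →
        (condCov (X i) W P - QE).PosSemidef →
        ∃ H QV, RealizationParams (condCov (X i) W P) H QV QE) ∧
      -- the rate distortion function, and the realization that achieves it
      ((condCov (X i) W P).PosDef → ∀ Δ : ℝ≥0,
        condRDF (pairLaw (X i) W P) Δ
          = (⨅ (QE : Matrix (Fin (p i)) (Fin (p i)) ℝ) (_ : QE.PosDef)
              (_ : (condCov (X i) W P - QE).PosSemidef) (_ : QE.trace ≤ Δ),
              gaussianRate (condCov (X i) W P) QE) ∧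
        (0 < Δ → ∃ H QV QE, RealizationParams (condCov (X i) W P) H QV QE ∧ QE.PosDef ∧
          QE.trace ≤ Δ ∧
          condRDF (pairLaw (X i) W P) Δ = gaussianRate (condCov (X i) W P) QE ∧
          mse src rep (realizationLaw (X i) W P H QV) ≤ Δ ∧
          condMutualInfo src rep side (realizationLaw (X i) W P H QV)
            = condRDF (pairLaw (X i) W P) Δ))) := by
  have hX2 : ∀ i, MemLp (X i) 2 P := fun i => by
    fin_cases i
    · exact hXgauss.fst.memLp_two
    · exact hXgauss.snd.memLp_two
  refine ⟨?_, ?_, ?_⟩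
  · intro 𝕎 _ W hW i
    refine ⟨fun Y hY => lower_bounds (hX i) (hX2 i) hY hW, fun Δ => ?_⟩
    have hXW : Measurable fun ω => (X i ω, W ω) := (hX i).prodMk hW
    have : IsProbabilityMeasure (P.map W) := Measure.isProbabilityMeasure_map hW.aemeasurable
    have : IsProbabilityMeasure (pairLaw (X i) W P) :=
      Measure.isProbabilityMeasure_map hXW.aemeasurable
    have hmem : MemLp Prod.fst 2 (pairLaw (X i) W P) :=
      (memLp_map_measure_iff (Measurable.aestronglyMeasurable (by fun_prop))
        hXW.aemeasurable).2 (hX2 i)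
    have hsnd : (pairLaw (X i) W P).map Prod.snd = P.map W := pairLaw_map_snd (hX i) hW
    refine ⟨fun hΔ => condRDF_lt_top _ hmem (by exact_mod_cast hΔ), ?_, ?_, ?_⟩
    · rw [condRDF_eq_iInf_lintegral_rdf _ hmem ENNReal.coe_ne_top, hsnd,
        condDistrib_eq_of_pairLaw (hX i) hW]
    · have h := iInf_lintegral_rdf_cmProfile_le_condRDF _ hmem (Δ : ℝ≥0∞)
      rwa [hsnd, ← condDistrib_eq_of_pairLaw (hX i) hW] at h
    -- Both infima run over the same channels, and `P.map W` is a probability measure, so each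
    -- essential infimum is at most the corresponding integral.
    · exact iInf_mono fun κ => iInf_mono fun hκ => iInf_mono fun hD => essInf_le_lintegral _ _
  · intro n W hW i
    refine ⟨fun Y hY h => h.ae_eq_const (hX i) hY hW, fun h Δ => ?_⟩
    obtain ⟨G, c, hs⟩ := exists_gaussianSource (hX i) hW h
    exact ⟨hs.condRDF_eq_iInf_essInf Δ, hs.condRDF_eq_iInf_const Δ⟩
  · intro n W hW i h hW0 hQW
    have hs := gaussianSource_of_posDef (hX i) hW h (hXmean i) hW0 hQW
    refine ⟨fun H QV QE hp => ⟨fun V Y hV hVl hVi hY => hs.realization hp hV hVl hVi hY,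
      hs.realization_compProd hp⟩, fun QE hQE hB => exists_realizationParams hQE hB,
      fun hQ Δ => ⟨hs.condRDF_eq_iInf_gaussianRate hQ Δ,
        fun hΔ => hs.exists_realization_attaining hQ hΔ⟩⟩
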